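/- Let $p$ be a prime and let $C$ be an algebraically closed field extension of $\mathbb{Q}_p$ which is complete for a valuation $v$ with values in $\mathbb{R}\cup\{\infty\}$, normalized by $v(p)=1$; let $\mathcal{O}_C$ be its ring of integers. An *integral Hodge–Tate module* is a triple $X=(T,\omega,\alpha)$ where $T$ is a free $\mathbb{Z}_p$-module of finite rank, $\omega$ is a free $\mathcal{O}_C$-module of finite rank and $\alpha:T\to\omega$ is $\mathbb{Z}_p$-linear with $\mathcal{O}_C\cdot\alpha(T)=\omega$. A *torsion Hodge–Tate module* is a triple $(M,\omega,\alpha)$ where $M$ is a finite abelian $p$-group, $\omega$ is a finitely presented torsion $\mathcal{O}_C$-module and $\alpha:M\to\omega$ is additive with $\mathcal{O}_C\cdot\alpha(M)=\omega$; if $M\neq 0$ its slope is $(\log_p|M|-\deg\omega)/\log_p|M|$, where $\deg\omega=v(\mathrm{Fitt}_0\,\omega)$, i.e. $\deg\omega=\sum_i v(a_i)$ if $\omega\simeq\bigoplus_i\mathcal{O}_C/a_i\mathcal{O}_C$. A subgroup $M'\subset M$ defines the subobject $(M',\mathcal{O}_C\cdot\alpha(M'),\alpha|_{M'})$. A nonzero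 torsion Hodge–Tate module is *semi-stable* if the slope of the subobject defined by any nonzero subgroup is at most its own slope. For $X=(T,\omega,\alpha)$ integral and $n\ge 1$ put $X[p^n]=(p^{-n}T/T,\,p^{-n}\omega/\omega,\,\alpha)$. If $X$ is nonzero, its slope is $\mu(X)=(\operatorname{rk}T-\operatorname{rk}\omega)/\operatorname{rk}T$, and $X$ is *semi-stable* if $X[p]$ is. An integral Hodge–Tate module $X$ is *of HN type* if it has a filtration $0=X_0\subsetneq X_1\subsetneq\dots\subsetneq X_r=X$, given by submodules $T_i\subset T$ with $X_i=(T_i,\mathcal{O}_C\cdot\alpha(T_i),\alpha)$, such that the quotients $X_i/X_{i-1}$ are semi-stable integral Hodge–Tate modules and $\mu(X_1/X_0)>\dots>\mu(X_r/X_{r-1})$. Two integral Hodge–Tate modules are *isogenous* if there are morphisms between them in both directions whose two composites are multiplication by the same power of $p$. For a nonzero integral Hodge–Tate module $X=(T,\omega,\alpha)$, let $Y_n\subset X[p^n]$ be the first step of the Harder–Narasimhan filtration, i.e. the largest among the nonzero subobjects of maximal slope, and let $\mathcal{F}_X=\bigcup_{n\ge 1}Y_n\subset T\otimes\mathbb{Q}_p/\mathbb{Z}_p$.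 Writing $\mathcal{F}_X=\Lambda/T$ with $T\subset\Lambda\subset T[\tfrac1p]$ and $D$ for the largest $\mathbb{Q}_p$-subspace contained in $\Lambda$, let $X/\mathcal{F}_X=(T',\omega',\alpha')$, where $T'=\Lambda/D$, $\alpha'$ is induced by $\alpha$, and $\omega'=\mathcal{O}_C\cdot\alpha'(T')\subset\omega[\tfrac1p]/(C\cdot\alpha(D))$. **Theorem.** Let $X$ be an integral Hodge–Tate module over $\mathcal{O}_C$. Then 1. $X$ is isogenous to an integral Hodge–Tate module of HN type; 2. the descent algorithm starting from $X$ terminates: in the sequence $X_0=X$, $X_{i+1}=X_i/\mathcal{F}_{X_i}$ (as long as $X_i\ne 0$), one has $X_N=0$ for some $N$. -/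

import Mathlib

noncomputable section

namespace HodgeTate

universe u v w

/-! ## The base: `𝒪_C` for a complete valued extension `C` of `ℚ_p`, with `v(p) = 1` -/

section Base

variable (C : Type w) [NormedField C] [IsUltrametricDist C]

/-- The ring of integers `𝒪_C = {x ∈ C : ‖x‖ ≤ 1}`, as a valuation subring of `C`. -/
abbrev OC : ValuationSubring C :=
  (NormedField.valuation (K := C)).valuationSubring

theorem mem_OC_iff (x : C) : x ∈ OC C ↔ ‖x‖ ≤ 1 := by
  rw [Valuation.mem_valuationSubring_iff, ← NNReal.coe_le_coe]
  rfl

variable (p : ℕ) [Fact p.Prime] [NormedAlgebra ℚ_[p] C]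

/-- The structure morphism `ℤ_p → 𝒪_C`. -/
def zpToOC : ℤ_[p] →+* OC C :=
  ((algebraMap ℚ_[p] C).comp PadicInt.Coe.ringHom).codRestrict (OC C).toSubring (by
    intro x
    refine (mem_OC_iff C _).2 ?_
    show ‖algebraMap ℚ_[p] C (x : ℚ_[p])‖ ≤ 1
    rw [norm_algebraMap']
    exact x.norm_le_one)

end Base

/-- The `0`-th Fitting ideal of a module `N`: it is generated by the determinants of all square
matrices of relations between generators of `N`. All finite generating families are allowed at
once; each of them gives the same ideal. -/
def fittingIdeal (R : Type w) [CommRing R] (N : Type v) [AddCommGroup N] [Module R N] : Ideal R :=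
  Ideal.span {d : R | ∃ (n : ℕ) (x : Fin n → N) (A : Matrix (Fin n) (Fin n) R),
    Submodule.span R (Set.range x) = ⊤ ∧ (∀ i, ∑ j, A i j • x j = 0) ∧ d = A.det}

section Degree

variable (p : ℕ) (C : Type w) [NormedField C] [IsUltrametricDist C]

/-- The valuation of a generator of a finitely generated nonzero ideal `I` of `𝒪_C`, where
`v(x) = - log_p ‖x‖`, so that `v(p) = 1`: a generator is an element of `I` of largest norm. -/
def idealValuation (I : Ideal (OC C)) : ℝ :=
  -Real.logb p (⨆ x : I, ‖((x : OC C) : C)‖)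

/-- `deg N = v(Fitt_0 N)`, for a finitely presented torsion `𝒪_C`-module `N`. -/
def degree (N : Type v) [AddCommGroup N] [Module (OC C) N] : ℝ :=
  idealValuation p C (fittingIdeal (OC C) N)

end Degree

/-! ## Hodge-Tate modules -/

/-- A triple `(T, ω, α)`: a `ℤ_p`-module `T`, an `𝒪_C`-module `ω` and a `ℤ_p`-linear map
`α : T → ω`. Integral Hodge-Tate modules are the triples that satisfy `IsIntegral`. Torsion
Hodge-Tate modules (where `T` is a finite abelian `p`-group, that is a `ℤ_p`-module with finitely
many elements) are triples too. -/
structure Triple (p : ℕ) [Fact p.Prime] (C : Type w) [NormedField C] [IsUltrametricDist C]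
    [NormedAlgebra ℚ_[p] C] where
  /-- the `ℤ_p`-module -/
  T : Type u
  /-- the `𝒪_C`-module -/
  ω : Type v
  [instT : AddCommGroup T]
  [modT : Module ℤ_[p] T]
  [instω : AddCommGroup ω]
  [modω : Module (OC C) ω]
  /-- the `ℤ_p`-linear map -/
  α : T →ₛₗ[zpToOC C p] ω

namespace Triple

attribute [instance] Triple.instT Triple.modT Triple.instω Triple.modω

variable {p : ℕ} [Fact p.Prime] {C : Type w} [NormedField C] [IsUltrametricDist C]
  [NormedAlgebra ℚ_[p] C]

/-- `𝒪_C · α(N)`, for `N ⊆ T`. -/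
def spanImage (X : Triple.{u, v, w} p C) (N : Submodule ℤ_[p] X.T) : Submodule (OC C) X.ω :=
  Submodule.span (OC C) (X.α '' (N : Set X.T))

/-- `(T, ω, α)` is an integral Hodge-Tate module: `T` and `ω` are free of finite rank, and
`𝒪_C · α(T) = ω`. -/
structure IsIntegral (X : Triple.{u, v, w} p C) : Prop where
  free_T : Module.Free ℤ_[p] X.T
  finite_T : Module.Finite ℤ_[p] X.T
  free_ω : Module.Free (OC C) X.ω
  finite_ω : Module.Finite (OC C) X.ω
  span_eq_top : X.spanImage ⊤ = ⊤

/-- Morphisms of triples. -/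
structure Hom (X Y : Triple.{u, v, w} p C) where
  f : X.T →ₗ[ℤ_[p]] Y.T
  g : X.ω →ₗ[OC C] Y.ω
  comm : ∀ t, g (X.α t) = Y.α (f t)

/-- `X` and `Y` are isogenous, i.e. isomorphic after inverting `p`: there are morphisms
`X → Y` and `Y → X` whose two composites are the multiplication by a power of `p`. -/
def Isogenous (X Y : Triple.{u, v, w} p C) : Prop :=
  ∃ (n : ℕ) (φ : Hom X Y) (ψ : Hom Y X),
    (∀ t, ψ.f (φ.f t) = (p : ℤ_[p]) ^ n • t) ∧ (∀ x, ψ.g (φ.g x) = (p : OC C) ^ n • x) ∧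
    (∀ t, φ.f (ψ.f t) = (p : ℤ_[p]) ^ n • t) ∧ (∀ x, φ.g (ψ.g x) = (p : OC C) ^ n • x)

/-- The subobject `(N, 𝒪_C · α(N), α|_N)` attached to `N ⊆ T`. -/
def sub (X : Triple.{u, v, w} p C) (N : Submodule ℤ_[p] X.T) : Triple.{u, v, w} p C where
  T := N
  ω := X.spanImage N
  α := (X.α.domRestrict N).codRestrict (X.spanImage N)
    (fun t => Submodule.subset_span ⟨t, t.2, rfl⟩)

/-- The triple `(T/N, ω/W, α mod W)`, for `α(N) ⊆ W`. -/
def quot (X : Triple.{u, v, w} p C) (N : Submodule ℤ_[p] X.T) (W : Submodule (OC C) X.ω)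
    (h : N ≤ W.comap X.α) : Triple.{u, v, w} p C where
  T := X.T ⧸ N
  ω := X.ω ⧸ W
  α := N.mapQ W X.α h

/-- For `A ⊆ B ⊆ T`, the quotient `(B/A, 𝒪_C · α(B) / 𝒪_C · α(A), α)` of the subobject attached to
`B` by the subobject attached to `A`. -/
def subquot (X : Triple.{u, v, w} p C) (A B : Submodule ℤ_[p] X.T) : Triple.{u, v, w} p C :=
  (X.sub B).quot (A.submoduleOf B) ((X.sub B).spanImage (A.submoduleOf B))
    (fun t ht => Submodule.subset_span ⟨t, ht, rfl⟩)

/-- `X[p^n] = (p^{-n}T/T, p^{-n}ω/ω, α)`, written as `(T/p^nT, ω/p^nω, α)` through the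
multiplication by `p^n`. -/
def torsion (X : Triple.{u, v, w} p C) (n : ℕ) : Triple.{u, v, w} p C :=
  X.quot (LinearMap.range (LinearMap.lsmul ℤ_[p] X.T ((p : ℤ_[p]) ^ n)))
    (LinearMap.range (LinearMap.lsmul (OC C) X.ω ((p : OC C) ^ n)))
    (by
      rintro _ ⟨t, rfl⟩
      exact ⟨X.α t, by simp [map_smulₛₗ]⟩)

/-! ## Slopes and semi-stability -/

/-- The height `log_p |M|` of a torsion Hodge-Tate module `(M, ω, α)`. -/
def torsionHeight (M : Triple.{u, v, w} p C) : ℝ :=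
  Real.logb p (Nat.card M.T)

/-- The degree `log_p |M| - deg ω` of a torsion Hodge-Tate module `(M, ω, α)`. -/
def torsionDegree (M : Triple.{u, v, w} p C) : ℝ :=
  M.torsionHeight - degree p C M.ω

/-- The slope `deg / ht` of a nonzero torsion Hodge-Tate module. -/
def torsionSlope (M : Triple.{u, v, w} p C) : ℝ :=
  M.torsionDegree / M.torsionHeight

/-- Semi-stability of a torsion Hodge-Tate module `(M, ω, α)`: it is nonzero, and the slope of the
subobject attached to any nonzero `N ⊆ M` is at most its slope. -/
def TorsionSemistable (M : Triple.{u, v, w} p C) : Prop :=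
  Nontrivial M.T ∧
    ∀ N : Submodule ℤ_[p] M.T, N ≠ ⊥ → (M.sub N).torsionSlope ≤ M.torsionSlope

/-- An integral Hodge-Tate module `X` is semi-stable if `X[p]` is. -/
def Semistable (X : Triple.{u, v, w} p C) : Prop :=
  (X.torsion 1).TorsionSemistable

/-- The slope `(rk T - rk ω) / rk T` of a nonzero integral Hodge-Tate module. -/
def slope (X : Triple.{u, v, w} p C) : ℝ :=
  ((Module.finrank ℤ_[p] X.T : ℝ) - Module.finrank (OC C) X.ω) / Module.finrank ℤ_[p] X.T

/-- An integral Hodge-Tate module `X` is of HN type if it has a filtration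
`0 = X_0 ⊊ X_1 ⊊ ... ⊊ X_r = X` whose graded pieces are semi-stable integral Hodge-Tate modules
with strictly decreasing slopes. -/
def IsHNType (X : Triple.{u, v, w} p C) : Prop :=
  ∃ (r : ℕ) (F : Fin (r + 1) → Submodule ℤ_[p] X.T),
    F 0 = ⊥ ∧ F (Fin.last r) = ⊤ ∧ StrictMono F ∧
    (∀ i : Fin r, (X.subquot (F i.castSucc) (F i.succ)).IsIntegral ∧
      (X.subquot (F i.castSucc) (F i.succ)).Semistable) ∧
    StrictAnti (fun i : Fin r => (X.subquot (F i.castSucc) (F i.succ)).slope)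

/-! ## The descent algorithm -/

/-- `N` is the first step of the Harder-Narasimhan filtration of the torsion Hodge-Tate module
`M ≠ 0`: among the nonzero subobjects of maximal slope, it is the largest. -/
def IsFirstStep (M : Triple.{u, v, w} p C) (N : Submodule ℤ_[p] M.T) : Prop :=
  N ≠ ⊥ ∧ ∀ N' : Submodule ℤ_[p] M.T, N' ≠ ⊥ →
    (M.sub N').torsionSlope ≤ (M.sub N).torsionSlope ∧
      ((M.sub N').torsionSlope = (M.sub N).torsionSlope → N' ≤ N)

/-- One step of the descent algorithm: `X' = X / 𝓕_X`, where
`𝓕_X = ⋃_n Y_n ⊆ T ⊗ ℚ_p/ℤ_p` and `Y_n ⊆ X[p^n]` is the first step of the Harder-Narasimhan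
filtration of `X[p^n]`. The projection is the morphism `(f, g) : X → X'`. On the `T`-side it is
surjective after inverting `p`, and the kernel of
`T ⊗ ℚ_p/ℤ_p → T' ⊗ ℚ_p/ℤ_p` is `𝓕_X`: an element `t ⊗ p^{-n}` dies in `T' ⊗ ℚ_p/ℤ_p` iff
`f t ∈ p^n T'`, and lies in `𝓕_X` iff the class of `t` in `T/p^nT` lies in `Y_n`. On the
`ω`-side, `ω[1/p] → ω'[1/p]` is the quotient by the subspace spanned by `α(ker f)`. -/
def IsDescentStep (X X' : Triple.{u, v, w} p C) : Prop :=
  X'.IsIntegral ∧ ∃ φ : Hom X X',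
    (∀ s : X'.T, ∃ (n : ℕ) (t : X.T), φ.f t = (p : ℤ_[p]) ^ n • s) ∧
    (∀ n : ℕ, 1 ≤ n → ∃ Y : Submodule ℤ_[p] (X.torsion n).T, (X.torsion n).IsFirstStep Y ∧
      ∀ t : X.T, (Submodule.Quotient.mk t : (X.torsion n).T) ∈ Y ↔
        ∃ s : X'.T, φ.f t = (p : ℤ_[p]) ^ n • s) ∧
    (∀ x : X.ω, φ.g x = 0 ↔
      ∃ n : ℕ, (p : OC C) ^ n • x ∈ X.spanImage (LinearMap.ker φ.f))

/-- The descent algorithm started at `X` terminates: in the sequence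
`X_0 = X`, `X_{i+1} = X_i / 𝓕_{X_i}` as long as `X_i ≠ 0`, some term `X_N` is zero. (The quotients
`X_i / 𝓕_{X_i}` are unique up to isomorphism.) -/
def DescentTerminates (X : Triple.{u, v, w} p C) : Prop :=
  ∃ (N : ℕ) (Z : ℕ → Triple.{u, v, w} p C), Z 0 = X ∧
    (∀ i < N, Nontrivial (Z i).T ∧ IsDescentStep (Z i) (Z (i + 1))) ∧ Subsingleton (Z N).T

end Triple

end HodgeTate

end

/-! Subobjects of `X[p^k]` correspond to submodules `A` with `p^k T ⊆ A ⊆ T`. Put h(A) = log_p |T/A|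
(`coheight`) and d(A) = deg(ω/𝒪α(A)) (`codeg`). Let μ be the largest slope of a nonzero subobject of
`X[p]`, ψ = (1 - μ)h - d and κ = ψ(pT). The slope of the subobject `A` of `X[p^k]` is μ + (kκ -
ψ(A))/height. Since h is modular and d is supermodular, ψ is submodular, and this reduces the bound
ψ(A) ≥ kκ to the case k = 1. So μ is the maximal slope of every `X[p^k]`, and the first step `Y k`
is the largest A ⊇ p^k T with ψ(A) = kκ. The `Y k` decrease, and pt ∈ `Y (k+1)` iff t ∈ `Y k`. With
D = ⋂ `Y k`, compactness of T and finiteness of T/pT give m with `Y (m+k)` = D + p^k `Y m` for all k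
(`exists_filtration_le`). Hence X/𝓕_X is the image of the subobject `Y m` in the saturated quotient
of X by D (`IsFirstSteps.isDescentStep`).

If D = 0, the step replaces X by the isogenous subobject `Y m`, whose maximal slope is strictly
smaller (`maxSlope_sub_lt`). This cannot go on forever: d(A) is the valuation of an element of one
finite dimensional ℚ_p-subspace of C, and the nonzero elements of such a subspace have valuations in
finitely many classes modulo ℤ. So one finite set S contains all the slopes that can occur in the
isogeny class (`exists_slopesIn`).

If D ≠ 0, then D is semi-stable of slope μ (`IsFirstSteps.semistable`), every nonzero subobject of
the saturated quotient X/D has slope < μ (`slope_satQuot_sub_lt`), and the rank drops. A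
Harder-Narasimhan chain of a lattice in X/D, rescaled by a power of p, pulled back to X and preceded
by D, is such a chain for a lattice in X (`exists_isHNChain_of_satQuot`). Both assertions follow by
induction on the rank and on the number of elements of S that are at most μ. -/

noncomputable section

namespace HodgeTate

universe u v w

set_option linter.unusedSectionVars false

/-! ### Fitting ideals of modules with a square presentation. -/

section Fitting

variable {R : Type w} [CommRing R]

/-- Expressing each generating family through the other, modulo relations, gives a block matrix
identity whose determinant reads det B = det A · (an element of R), where `A` presents N and `B` is
any square matrix of relations. -/
theorem fittingIdeal_eq_of_presentation {N : Type v} [AddCommGroup N] [Module R N] {P : Type*}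
    [AddCommGroup P] [Module R P] {n : ℕ} (e : Module.Basis (Fin n) R P) (π : P →ₗ[R] N)
    (hπ : Function.Surjective π) (u : Fin n → P)
    (hu : LinearMap.ker π = Submodule.span R (Set.range u)) :
    fittingIdeal R N = Ideal.span {e.det u} := by
  apply le_antisymm
  · refine Ideal.span_le.2 ?_
    rintro _ ⟨k, x, B, hx, hB, rfl⟩
    rw [SetLike.mem_coe, Ideal.mem_span_singleton]
    choose X hX using fun j => hπ (x j)
    have hker : ∀ y : P, π y = 0 → ∃ q : Fin n → R, ∑ j, q j • u j = y := by
      intro y hy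
      have : y ∈ Submodule.span R (Set.range u) := hu ▸ (LinearMap.mem_ker.2 hy)
      simpa [Submodule.mem_span_range_iff_exists_fun] using this
    have hspan : ∀ y : N, ∃ q : Fin k → R, ∑ j, q j • x j = y := by
      intro y
      have : y ∈ Submodule.span R (Set.range x) := hx ▸ Submodule.mem_top
      simpa [Submodule.mem_span_range_iff_exists_fun] using this
    choose Pm hPm using fun i => hspan (π (e i))
    choose Q hQ using fun i => hker (e i - ∑ j, Pm i j • X j) (by simp [hX, hPm])
    choose Y hY using fun i => hker (∑ j, B i j • X j) (by simp [hX, hB])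
    let Xm : Matrix (Fin k) (Fin n) R := Matrix.of fun j l => e.repr (X j) l
    let A : Matrix (Fin n) (Fin n) R := Matrix.of fun j l => e.repr (u j) l
    have h1 : Matrix.of Pm * Xm + Matrix.of Q * A = 1 := by
      ext i l
      have := congrArg (fun z => e.repr z l) (hQ i)
      simp only [map_sum, map_smul, map_sub, Finsupp.coe_finsetSum, Finset.sum_apply,
        Finsupp.smul_apply, Finsupp.sub_apply, Module.Basis.repr_self] at this
      simp only [Matrix.add_apply, Matrix.mul_apply, Matrix.of_apply, Xm, A, smul_eq_mul] at this ⊢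
      rw [this, Matrix.one_apply, Finsupp.single_apply]
      ring
    have h2 : B * Xm - Matrix.of Y * A = 0 := by
      ext i l
      have := congrArg (fun z => e.repr z l) (hY i)
      simp only [map_sum, map_smul, Finsupp.coe_finsetSum, Finset.sum_apply,
        Finsupp.smul_apply] at this
      simp only [Matrix.sub_apply, Matrix.mul_apply, Matrix.of_apply, Xm, A, smul_eq_mul,
        Matrix.zero_apply] at this ⊢
      rw [this, sub_self]
    have hA : e.det u = A.det := by
      rw [Module.Basis.det_apply, ← Matrix.det_transpose]
      rfl
    have h3 : Matrix.fromBlocks B (-Matrix.of Y) (Matrix.of Pm) (Matrix.of Q) *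
        Matrix.fromBlocks 1 Xm 0 A = Matrix.fromBlocks B 0 (Matrix.of Pm) 1 := by
      rw [Matrix.fromBlocks_multiply, h1, Matrix.neg_mul _ A, ← sub_eq_add_neg, h2]
      simp
    have h4 := congrArg Matrix.det h3
    rw [Matrix.det_mul, Matrix.det_fromBlocks_zero₂₁, Matrix.det_fromBlocks_zero₁₂] at h4
    rw [hA]
    rw [Matrix.det_one, Matrix.det_one, one_mul, mul_one] at h4
    exact ⟨_, by rw [← h4, mul_comm]⟩
  · rw [Ideal.span_singleton_le_iff_mem]
    refine Ideal.subset_span ⟨n, fun i => π (e i), (e.toMatrix u).transpose, ?_, ?_, ?_⟩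
    · rw [Set.range_comp' π e, Submodule.span_image, e.span_eq, Submodule.map_top,
        LinearMap.range_eq_top.2 hπ]
    · intro i
      have : π (u i) = 0 := by
        rw [← LinearMap.mem_ker, hu]
        exact Submodule.subset_span ⟨i, rfl⟩
      rw [← e.sum_repr (u i)] at this
      rw [map_sum] at this
      simpa only [map_smul, Matrix.transpose_apply, Module.Basis.toMatrix_apply] using this
    · rw [Matrix.det_transpose, Module.Basis.det_apply]

theorem fittingIdeal_le_of_surjective {N : Type v} [AddCommGroup N] [Module R N] {N' : Type*}
    [AddCommGroup N'] [Module R N'] (f : N →ₗ[R] N') (hf : Function.Surjective f) :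
    fittingIdeal R N ≤ fittingIdeal R N' := by
  refine Ideal.span_le.2 ?_
  rintro _ ⟨k, x, B, hx, hB, rfl⟩
  refine Ideal.subset_span ⟨k, fun i => f (x i), B, ?_, ?_, rfl⟩
  · rw [Set.range_comp' f x, Submodule.span_image, hx, Submodule.map_top,
      LinearMap.range_eq_top.2 hf]
  · intro i
    simpa using congrArg f (hB i)

end Fitting

/-! ### The degree of an 𝒪_C-module. -/

section Degree

variable {p : ℕ} {C : Type w} [NormedField C] [IsUltrametricDist C]

theorem norm_OC_le_one (x : OC C) : ‖(x : C)‖ ≤ 1 := (mem_OC_iff C _).1 x.2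

theorem bddAbove_norm_ideal (I : Ideal (OC C)) :
    BddAbove (Set.range fun x : I => ‖((x : OC C) : C)‖) :=
  ⟨1, by rintro _ ⟨x, rfl⟩; exact norm_OC_le_one _⟩

theorem idealValuation_span_singleton (d : OC C) :
    idealValuation p C (Ideal.span {d}) = -Real.logb p ‖(d : C)‖ := by
  have : (⨆ x : Ideal.span {d}, ‖((x : OC C) : C)‖) = ‖(d : C)‖ := by
    apply le_antisymm
    · apply ciSup_le
      rintro ⟨x, hx⟩
      obtain ⟨y, rfl⟩ := Ideal.mem_span_singleton.1 hx
      simpa using mul_le_mul_of_nonneg_left (norm_OC_le_one y) (norm_nonneg (d : C))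
    · exact le_ciSup (bddAbove_norm_ideal (Ideal.span {d}))
        ⟨d, Ideal.mem_span_singleton_self d⟩
  rw [idealValuation, this]

theorem degree_eq_of_presentation {N : Type v} [AddCommGroup N] [Module (OC C) N] {P : Type*}
    [AddCommGroup P] [Module (OC C) P] {n : ℕ} (e : Module.Basis (Fin n) (OC C) P)
    (π : P →ₗ[OC C] N) (hπ : Function.Surjective π) (u : Fin n → P)
    (hu : LinearMap.ker π = Submodule.span (OC C) (Set.range u)) :
    degree p C N = -Real.logb p ‖((e.det u : OC C) : C)‖ := by
  rw [degree, fittingIdeal_eq_of_presentation e π hπ u hu, idealValuation_span_singleton]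

theorem degree_congr {N : Type v} [AddCommGroup N] [Module (OC C) N] {N' : Type*}
    [AddCommGroup N'] [Module (OC C) N'] (e : N ≃ₗ[OC C] N') : degree p C N = degree p C N' := by
  rw [degree, degree, le_antisymm (fittingIdeal_le_of_surjective e.toLinearMap e.surjective)
    (fittingIdeal_le_of_surjective e.symm.toLinearMap e.symm.surjective)]

variable [hp : Fact p.Prime]

theorem one_lt_prime_cast (p : ℕ) [hp : Fact p.Prime] : (1 : ℝ) < p := by
  exact_mod_cast hp.out.one_lt

theorem degree_nonneg (N : Type v) [AddCommGroup N] [Module (OC C) N] : 0 ≤ degree p C N := by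
  rw [degree, idealValuation, neg_nonneg]
  apply Real.logb_nonpos (one_lt_prime_cast p)
  · exact Real.iSup_nonneg fun _ => norm_nonneg _
  · exact ciSup_le fun x => norm_OC_le_one _

/-- The hypothesis `h0` is needed because a zero Fitting ideal has degree 0, through `Real.logb p 0
= 0`, and not infinite degree. -/
theorem degree_le_of_surjective {N : Type v} [AddCommGroup N] [Module (OC C) N] {N' : Type*}
    [AddCommGroup N'] [Module (OC C) N'] (f : N →ₗ[OC C] N') (hf : Function.Surjective f)
    (h0 : fittingIdeal (OC C) N ≠ ⊥) : degree p C N' ≤ degree p C N := by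
  obtain ⟨d, hd, hd0⟩ := Submodule.exists_mem_ne_zero_of_ne_bot h0
  have hle := fittingIdeal_le_of_surjective f hf
  rw [degree, degree, idealValuation, idealValuation, neg_le_neg_iff]
  apply Real.logb_le_logb_of_le (one_lt_prime_cast p)
  · refine lt_of_lt_of_le ?_ (le_ciSup (bddAbove_norm_ideal _) ⟨d, hd⟩)
    simpa using hd0
  · exact ciSup_le fun x => le_ciSup (bddAbove_norm_ideal _) ⟨x.1, hle x.2⟩

variable [NormedAlgebra ℚ_[p] C]

theorem norm_natCast_prime : ‖((p : OC C) : C)‖ = (p : ℝ)⁻¹ := by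
  have : ((p : OC C) : C) = algebraMap ℚ_[p] C (p : ℚ_[p]) := by simp
  rw [this, norm_algebraMap', Padic.norm_p]

theorem prime_cast_ne_zero : (p : OC C) ≠ 0 := by
  intro h
  have := norm_natCast_prime (p := p) (C := C)
  rw [h] at this
  have hp0 : (p : ℝ) ≠ 0 := Nat.cast_ne_zero.2 hp.out.ne_zero
  rw [ZeroMemClass.coe_zero, norm_zero] at this
  exact inv_ne_zero hp0 this.symm

theorem logb_norm_prime_pow (k : ℕ) :
    Real.logb p ‖(((p : OC C) ^ k : OC C) : C)‖ = -(k : ℝ) := by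
  have h1 := one_lt_prime_cast p
  rw [SubmonoidClass.coe_pow, norm_pow, norm_natCast_prime, Real.logb_pow, Real.logb_inv,
    Real.logb_self_eq_one h1]
  ring

end Degree

/-! ### Lattices over 𝒪_C and their codegree. -/

section Lattice

variable (p : ℕ) {C : Type w} [NormedField C] [IsUltrametricDist C]
  {W : Type v} [AddCommGroup W] [Module (OC C) W]

/-- `M ⊆ W` is a finitely generated submodule that contains a multiple `p^k W`. -/
structure IsLattice (M : Submodule (OC C) W) : Prop where
  fg : M.FG
  exists_pow : ∃ k : ℕ, ∀ x : W, (p : OC C) ^ k • x ∈ M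

/-- The degree of `W/M`. -/
def codegree (M : Submodule (OC C) W) : ℝ := degree p C (W ⧸ M)

variable {p}

/-- A valuation ring is Bézout, so torsion-free modules are flat; finite flat modules over a local
ring are free. -/
theorem free_of_finite_isTorsionFree (N : Type*) [AddCommGroup N] [Module (OC C) N]
    [Module.Finite (OC C) N] [Module.IsTorsionFree (OC C) N] : Module.Free (OC C) N := by
  have : Module.Flat (OC C) N := by
    rw [Module.Flat.flat_iff_torsion_eq_bot_of_isBezout,
      ← Submodule.isTorsionFree_iff_torsion_eq_bot]
    infer_instance
  exact Module.free_of_flat_of_isLocalRing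

theorem det_coe_eq_mul {r : ℕ} (b : Module.Basis (Fin r) (OC C) W) (M : Submodule (OC C) W)
    (m : Module.Basis (Fin r) (OC C) M) (v : Fin r → M) :
    b.det (fun i => (v i : W)) = b.det (fun i => (m i : W)) * m.det v := by
  have := congrArg (fun f => f v)
    (AlternatingMap.eq_smul_basis_det m (b.det.compLinearMap M.subtype))
  simpa [AlternatingMap.compLinearMap_apply] using this

theorem degree_quotient_of_basis {r : ℕ} {M Q : Submodule (OC C) W} (hQM : Q ≤ M)
    (m : Module.Basis (Fin r) (OC C) M) (q : Module.Basis (Fin r) (OC C) Q) :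
    degree p C (M ⧸ Q.submoduleOf M) =
      -Real.logb p ‖((m.det (fun i => Submodule.inclusion hQM (q i)) : OC C) : C)‖ := by
  refine degree_eq_of_presentation m (Submodule.mkQ _) (Submodule.mkQ_surjective _) _ ?_
  rw [Submodule.ker_mkQ, Set.range_comp' (Submodule.inclusion hQM) q, Submodule.span_image,
    q.span_eq, Submodule.map_top, Submodule.range_inclusion, Submodule.submoduleOf]

theorem codegree_of_basis {r : ℕ} {Q : Submodule (OC C) W} (b : Module.Basis (Fin r) (OC C) W)
    (q : Module.Basis (Fin r) (OC C) Q) :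
    codegree p Q = -Real.logb p ‖((b.det (fun i => (q i : W)) : OC C) : C)‖ := by
  refine degree_eq_of_presentation b (Submodule.mkQ _) (Submodule.mkQ_surjective _) _ ?_
  have : Set.range (fun i => (q i : W)) = Q.subtype '' Set.range q := Set.range_comp _ _
  rw [Submodule.ker_mkQ, this, Submodule.span_image, q.span_eq, Submodule.map_top,
    Submodule.range_subtype]

variable [hp : Fact p.Prime] [NormedAlgebra ℚ_[p] C] [Module.Free (OC C) W]
  [Module.Finite (OC C) W]

theorem IsLattice.finite {M : Submodule (OC C) W} (hM : IsLattice p M) : Module.Finite (OC C) M :=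
  Module.Finite.iff_fg.2 hM.fg

theorem free_of_fg {M : Submodule (OC C) W} (hM : M.FG) : Module.Free (OC C) M := by
  have := Module.Finite.iff_fg.2 hM
  exact free_of_finite_isTorsionFree M

theorem IsLattice.finrank_eq {M : Submodule (OC C) W} (hM : IsLattice p M) :
    Module.finrank (OC C) M = Module.finrank (OC C) W := by
  have := hM.finite
  apply le_antisymm (Submodule.finrank_le M)
  obtain ⟨k, hk⟩ := hM.exists_pow
  let f : W →ₗ[OC C] M := (LinearMap.lsmul (OC C) W ((p : OC C) ^ k)).codRestrict M hk
  refine LinearMap.finrank_le_finrank_of_injective (f := f) ?_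
  intro x y hxy
  have h : (p : OC C) ^ k • x = (p : OC C) ^ k • y := congrArg Subtype.val hxy
  exact smul_right_injective W (pow_ne_zero k prime_cast_ne_zero) h

theorem IsLattice.exists_basis {M : Submodule (OC C) W} (hM : IsLattice p M) :
    Nonempty (Module.Basis (Fin (Module.finrank (OC C) W)) (OC C) M) := by
  have := hM.finite
  have := free_of_fg hM.fg
  exact ⟨Module.finBasisOfFinrankEq _ _ hM.finrank_eq⟩

theorem IsLattice.det_ne_zero {M : Submodule (OC C) W} (hM : IsLattice p M) {r : ℕ}
    (b : Module.Basis (Fin r) (OC C) W) (m : Module.Basis (Fin r) (OC C) M) :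
    b.det (fun i => (m i : W)) ≠ 0 := by
  obtain ⟨k, hk⟩ := hM.exists_pow
  have h := det_coe_eq_mul b M m (fun i => ⟨_, hk (b i)⟩)
  have h2 : b.det (fun i => (p : OC C) ^ k • b i) = ((p : OC C) ^ k) ^ r := by
    rw [AlternatingMap.map_smul_univ, b.det_self]
    simp
  intro h0
  simp only [h2, h0, zero_mul] at h
  exact pow_ne_zero _ (pow_ne_zero _ prime_cast_ne_zero) h

theorem IsLattice.mono {Q M : Submodule (OC C) W} (hQ : IsLattice p Q) (hM : M.FG) (h : Q ≤ M) :
    IsLattice p M :=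
  ⟨hM, hQ.exists_pow.imp fun _ hk x => h (hk x)⟩

theorem norm_coe_pos {x : OC C} (hx : x ≠ 0) : 0 < ‖(x : C)‖ := by
  simpa using hx

/-- This is the multiplicativity of determinants along Q ⊆ M ⊆ W. -/
theorem codegree_eq_add {Q M : Submodule (OC C) W} (hQ : IsLattice p Q) (hM : IsLattice p M)
    (h : Q ≤ M) : codegree p Q = codegree p M + degree p C (M ⧸ Q.submoduleOf M) := by
  obtain ⟨m⟩ := hM.exists_basis
  obtain ⟨q⟩ := hQ.exists_basis
  let b := Module.finBasis (OC C) W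
  have h1 := det_coe_eq_mul b M m (fun i => Submodule.inclusion h (q i))
  have h2 := hQ.det_ne_zero b q
  simp only [Submodule.coe_inclusion] at h1
  rw [h1] at h2
  rw [codegree_of_basis b q, codegree_of_basis b m, degree_quotient_of_basis h m q, h1]
  push_cast
  rw [norm_mul, Real.logb_mul (norm_coe_pos (left_ne_zero_of_mul h2)).ne'
    (norm_coe_pos (right_ne_zero_of_mul h2)).ne']
  ring

theorem fittingIdeal_quotient_ne_bot {Q M : Submodule (OC C) W} (hQ : IsLattice p Q)
    (hM : IsLattice p M) (h : Q ≤ M) : fittingIdeal (OC C) (M ⧸ Q.submoduleOf M) ≠ ⊥ := by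
  obtain ⟨m⟩ := hM.exists_basis
  obtain ⟨q⟩ := hQ.exists_basis
  let b := Module.finBasis (OC C) W
  have h1 := det_coe_eq_mul b M m (fun i => Submodule.inclusion h (q i))
  have h2 := hQ.det_ne_zero b q
  simp only [Submodule.coe_inclusion] at h1
  rw [h1] at h2
  rw [fittingIdeal_eq_of_presentation m (Submodule.mkQ _) (Submodule.mkQ_surjective _)
    (fun i => Submodule.inclusion h (q i))]
  · simpa using right_ne_zero_of_mul h2
  · rw [Submodule.ker_mkQ, Set.range_comp' (Submodule.inclusion h) q, Submodule.span_image,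
      q.span_eq, Submodule.map_top, Submodule.range_inclusion, Submodule.submoduleOf]

/-- The module (M + M')/M is a quotient of M'/Q. The lattice `Q` is not fixed to be M ∩ M', because
it will be 𝒪α(A ∩ B), which can be smaller than 𝒪α(A) ∩ 𝒪α(B). -/
theorem codegree_add_le {Q M M' : Submodule (OC C) W} (hQ : IsLattice p Q)
    (hM : IsLattice p M) (hM' : IsLattice p M') (h : Q ≤ M) (h' : Q ≤ M') :
    codegree p M + codegree p M' ≤ codegree p (M ⊔ M') + codegree p Q := by
  have hS : IsLattice p (M ⊔ M') := hM.mono (hM.fg.sup hM'.fg) le_sup_left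
  rw [codegree_eq_add hM hS le_sup_left, codegree_eq_add hQ hM' h']
  have : degree p C (↥(M ⊔ M') ⧸ M.submoduleOf (M ⊔ M')) ≤ degree p C (M' ⧸ Q.submoduleOf M') := by
    refine degree_le_of_surjective (Submodule.mapQ _ _
      (Submodule.inclusion (le_sup_right : M' ≤ M ⊔ M')) ?_) ?_ (fittingIdeal_quotient_ne_bot hQ hM' h')
    · intro x hx
      exact h hx
    · intro y
      obtain ⟨⟨y, hy⟩, rfl⟩ := Submodule.mkQ_surjective _ y
      obtain ⟨a, ha, c, hc, rfl⟩ := Submodule.mem_sup.1 hy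
      refine ⟨Submodule.Quotient.mk ⟨c, hc⟩, ?_⟩
      refine (Submodule.Quotient.eq _).2 ?_
      show c - (a + c) ∈ M
      simpa using ha
  linarith

theorem codegree_le_of_mem {M : Submodule (OC C) W} (hM : IsLattice p M) {r : ℕ}
    (b : Module.Basis (Fin r) (OC C) W) (v : Fin r → W) (hv : ∀ i, v i ∈ M) (h0 : b.det v ≠ 0) :
    codegree p M ≤ -Real.logb p ‖((b.det v : OC C) : C)‖ := by
  obtain rfl : r = Module.finrank (OC C) W := by simpa using (Module.finrank_eq_card_basis b).symm
  obtain ⟨m⟩ := hM.exists_basis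
  have h1 := det_coe_eq_mul b M m (fun i => ⟨v i, hv i⟩)
  simp only at h1
  rw [codegree_of_basis b m, neg_le_neg_iff]
  apply Real.logb_le_logb_of_le (one_lt_prime_cast p) (norm_coe_pos h0)
  rw [h1]
  push_cast
  rw [norm_mul]
  exact mul_le_of_le_one_right (norm_nonneg _) (norm_OC_le_one _)

theorem codegree_nonneg (M : Submodule (OC C) W) : 0 ≤ codegree p M := degree_nonneg _

theorem codegree_top : codegree p (⊤ : Submodule (OC C) W) = 0 := by
  have hT : IsLattice p (⊤ : Submodule (OC C) W) := ⟨Module.Finite.fg_top, 0, by simp⟩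
  have := codegree_le_of_mem hT (Module.finBasis (OC C) W) (Module.finBasis (OC C) W) (by simp)
    (by simp [Module.Basis.det_self])
  rw [Module.Basis.det_self] at this
  exact le_antisymm (by simpa using this) (codegree_nonneg _)

theorem codegree_map_prime_smul {M : Submodule (OC C) W} (hM : IsLattice p M) :
    codegree p (M.map (LinearMap.lsmul (OC C) W (p : OC C))) =
      codegree p M + Module.finrank (OC C) W := by
  obtain ⟨m⟩ := hM.exists_basis
  let b := Module.finBasis (OC C) W
  have hinj : Function.Injective (LinearMap.lsmul (OC C) W (p : OC C)) :=
    smul_right_injective W prime_cast_ne_zero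
  let q := m.map (Submodule.equivMapOfInjective _ hinj M)
  rw [codegree_of_basis b q, codegree_of_basis b m]
  have : (fun i => (q i : W)) = fun i => (p : OC C) • (m i : W) := by
    ext i
    simp [q]
  rw [this, AlternatingMap.map_smul_univ]
  have h0 := hM.det_ne_zero b m
  simp only [Finset.prod_const, Finset.card_univ, Fintype.card_fin, smul_eq_mul]
  have h1 := logb_norm_prime_pow (p := p) (C := C) (Module.finrank (OC C) W)
  have h2 := norm_coe_pos (pow_ne_zero (Module.finrank (OC C) W) (prime_cast_ne_zero (p := p) (C := C)))
  rw [MulMemClass.coe_mul, norm_mul, Real.logb_mul h2.ne' (norm_coe_pos h0).ne', h1]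
  ring

end Lattice

/-! ### Full submodules of a ℤ_p-lattice and their coheight. -/

section Height

variable (p : ℕ) [hp : Fact p.Prime] {T : Type u} [AddCommGroup T] [Module ℤ_[p] T]

/-- The submodule `p^k A`. -/
def ppow (k : ℕ) (A : Submodule ℤ_[p] T) : Submodule ℤ_[p] T :=
  A.map (LinearMap.lsmul ℤ_[p] T ((p : ℤ_[p]) ^ k))

/-- `A` contains a multiple `p^k T`. -/
def IsFull (A : Submodule ℤ_[p] T) : Prop := ∃ k : ℕ, ppow p k ⊤ ≤ A

/-- The height of `T/A`, i.e. `log_p |T/A|`. -/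
def coheight (A : Submodule ℤ_[p] T) : ℝ := Real.logb p A.toAddSubgroup.index

variable {p}

theorem mem_ppow {k : ℕ} {A : Submodule ℤ_[p] T} {t : T} :
    t ∈ ppow p k A ↔ ∃ a ∈ A, (p : ℤ_[p]) ^ k • a = t := Submodule.mem_map

theorem smul_mem_ppow {k : ℕ} {A : Submodule ℤ_[p] T} {t : T} (ht : t ∈ A) :
    (p : ℤ_[p]) ^ k • t ∈ ppow p k A := mem_ppow.2 ⟨t, ht, rfl⟩

theorem ppow_le (k : ℕ) (A : Submodule ℤ_[p] T) : ppow p k A ≤ A := by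
  rintro _ ⟨a, ha, rfl⟩
  exact A.smul_mem _ ha

theorem ppow_mono {k : ℕ} {A B : Submodule ℤ_[p] T} (h : A ≤ B) : ppow p k A ≤ ppow p k B :=
  Submodule.map_mono h

theorem ppow_ppow (j k : ℕ) (A : Submodule ℤ_[p] T) : ppow p j (ppow p k A) = ppow p (j + k) A := by
  ext t
  constructor
  · rintro ⟨_, ⟨a, ha, rfl⟩, rfl⟩
    exact ⟨a, ha, by simp only [LinearMap.lsmul_apply, smul_smul, pow_add]⟩
  · rintro ⟨a, ha, rfl⟩
    exact ⟨_, ⟨a, ha, rfl⟩, by simp only [LinearMap.lsmul_apply, smul_smul, pow_add]⟩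

theorem ppow_zero (A : Submodule ℤ_[p] T) : ppow p 0 A = A := by
  ext t; simp [mem_ppow]

theorem ppow_comap (k : ℕ) (A : Submodule ℤ_[p] T) :
    ppow p k (A.comap (LinearMap.lsmul ℤ_[p] T ((p : ℤ_[p]) ^ k))) = A ⊓ ppow p k ⊤ := by
  rw [ppow, Submodule.map_comap_eq, inf_comm, ppow, Submodule.map_top]

theorem isFull_ppow_top (k : ℕ) : IsFull p (ppow p k (⊤ : Submodule ℤ_[p] T)) := ⟨k, le_rfl⟩

theorem isFull_top : IsFull p (⊤ : Submodule ℤ_[p] T) := ⟨0, le_top⟩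

theorem IsFull.mono {A B : Submodule ℤ_[p] T} (hA : IsFull p A) (h : A ≤ B) : IsFull p B :=
  hA.imp fun _ hk => hk.trans h

theorem IsFull.ppow {A : Submodule ℤ_[p] T} (hA : IsFull p A) (k : ℕ) :
    IsFull p (ppow p k A) := by
  obtain ⟨j, hj⟩ := hA
  exact ⟨k + j, by rw [← ppow_ppow]; exact ppow_mono hj⟩

theorem IsFull.inf {A B : Submodule ℤ_[p] T} (hA : IsFull p A) (hB : IsFull p B) :
    IsFull p (A ⊓ B) := by
  obtain ⟨j, hj⟩ := hA
  obtain ⟨k, hk⟩ := hB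
  refine ⟨j + k, le_inf ?_ ?_⟩
  · rw [← ppow_ppow]; exact (ppow_mono le_top).trans hj
  · rw [add_comm, ← ppow_ppow]; exact (ppow_mono le_top).trans hk

theorem prime_pow_ne_zero (k : ℕ) : (p : ℤ_[p]) ^ k ≠ 0 :=
  pow_ne_zero _ (Nat.cast_ne_zero.2 hp.out.ne_zero)

theorem smul_pow_injective [Module.IsTorsionFree ℤ_[p] T] (k : ℕ) :
    Function.Injective (LinearMap.lsmul ℤ_[p] T ((p : ℤ_[p]) ^ k)) :=
  smul_right_injective T (prime_pow_ne_zero k)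

theorem smul_mem_ppow_iff [Module.IsTorsionFree ℤ_[p] T] {k : ℕ} {A : Submodule ℤ_[p] T} {t : T} :
    (p : ℤ_[p]) ^ k • t ∈ ppow p k A ↔ t ∈ A := by
  refine ⟨?_, smul_mem_ppow⟩
  rintro ⟨a, ha, h⟩
  rwa [← smul_pow_injective k h]

variable [Module.Free ℤ_[p] T] [Module.Finite ℤ_[p] T]

theorem index_ppow_one_top :
    (ppow p 1 (⊤ : Submodule ℤ_[p] T)).toAddSubgroup.index = p ^ Module.finrank ℤ_[p] T := by
  let b := Module.finBasis ℤ_[p] T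
  let f : T →+ (Fin (Module.finrank ℤ_[p] T) → ZMod p) :=
    { toFun := fun t i => PadicInt.toZMod (b.repr t i)
      map_zero' := by ext; simp
      map_add' := by intros; ext; simp }
  have hf : Function.Surjective f := by
    intro y
    choose x hx using fun i => ZMod.ringHom_surjective (PadicInt.toZMod (p := p)) (y i)
    refine ⟨∑ i, x i • b i, ?_⟩
    ext i
    show PadicInt.toZMod (b.repr (∑ i, x i • b i) i) = y i
    rw [b.repr_sum_self, hx]
  have hker : f.ker = (ppow p 1 (⊤ : Submodule ℤ_[p] T)).toAddSubgroup := by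
    ext t
    rw [AddMonoidHom.mem_ker, Submodule.mem_toAddSubgroup, mem_ppow]
    constructor
    · intro h
      have h1 : ∀ i, ∃ a, (p : ℤ_[p]) * a = b.repr t i := by
        intro i
        have : b.repr t i ∈ RingHom.ker (PadicInt.toZMod (p := p)) := congrFun h i
        rw [PadicInt.ker_toZMod, PadicInt.maximalIdeal_eq_span_p, Ideal.mem_span_singleton] at this
        exact this.imp fun _ h => h.symm
      choose a ha using h1
      refine ⟨∑ i, a i • b i, trivial, ?_⟩
      rw [pow_one, Finset.smul_sum]
      simp_rw [smul_smul, ha]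
      exact b.sum_repr t
    · rintro ⟨a, -, rfl⟩
      ext i
      show PadicInt.toZMod (b.repr _ i) = 0
      simp
  rw [← hker, AddSubgroup.index_ker, AddMonoidHom.range_eq_top.2 hf]
  simp

theorem index_ppow_one (A : Submodule ℤ_[p] T) :
    (ppow p 1 A).toAddSubgroup.index = A.toAddSubgroup.index * p ^ Module.finrank ℤ_[p] T := by
  have h := AddSubgroup.index_map_of_injective (A.toAddSubgroup)
    (f := (LinearMap.lsmul ℤ_[p] T ((p : ℤ_[p]) ^ 1)).toAddMonoidHom) (smul_pow_injective 1)
  rw [← index_ppow_one_top, ppow, ppow, Submodule.map_top]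
  exact h

theorem index_ppow (k : ℕ) (A : Submodule ℤ_[p] T) :
    (ppow p k A).toAddSubgroup.index =
      A.toAddSubgroup.index * p ^ (k * Module.finrank ℤ_[p] T) := by
  induction k with
  | zero => simp [ppow_zero]
  | succ k ih =>
    rw [add_comm, ← ppow_ppow, index_ppow_one, ih, mul_assoc, ← pow_add]
    congr 2
    ring

theorem IsFull.index_dvd {k : ℕ} {A : Submodule ℤ_[p] T} (hk : HodgeTate.ppow p k ⊤ ≤ A) :
    A.toAddSubgroup.index ∣ p ^ (k * Module.finrank ℤ_[p] T) := by
  have := AddSubgroup.index_dvd_of_le (Submodule.toAddSubgroup_mono hk)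
  rw [index_ppow] at this
  simpa using this

theorem IsFull.index_ne_zero {A : Submodule ℤ_[p] T} (hA : IsFull p A) :
    A.toAddSubgroup.index ≠ 0 := by
  obtain ⟨k, hk⟩ := hA
  exact ne_zero_of_dvd_ne_zero (pow_ne_zero _ hp.out.ne_zero) (IsFull.index_dvd hk)

theorem IsFull.exists_coheight {A : Submodule ℤ_[p] T} (hA : IsFull p A) :
    ∃ j : ℕ, coheight p A = j := by
  obtain ⟨k, hk⟩ := hA
  obtain ⟨j, -, hj⟩ := (Nat.dvd_prime_pow hp.out).1 (IsFull.index_dvd hk)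
  refine ⟨j, ?_⟩
  rw [coheight, hj, Nat.cast_pow, Real.logb_pow, Real.logb_self_eq_one (one_lt_prime_cast p), mul_one]

theorem coheight_top : coheight p (⊤ : Submodule ℤ_[p] T) = 0 := by simp [coheight]

theorem coheight_ppow {A : Submodule ℤ_[p] T} (hA : IsFull p A) (k : ℕ) :
    coheight p (ppow p k A) = coheight p A + k * Module.finrank ℤ_[p] T := by
  have h0 := hA.index_ne_zero
  have h1 : (p : ℝ) ≠ 0 := Nat.cast_ne_zero.2 hp.out.ne_zero
  rw [coheight, index_ppow, Nat.cast_mul, Real.logb_mul (by simpa using h0) (by simp [hp.out.ne_zero]),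
    Nat.cast_pow, Real.logb_pow, Real.logb_self_eq_one (one_lt_prime_cast p), coheight]
  push_cast
  ring

/-- Second isomorphism theorem. Equality here, against a mere inequality for the degrees, makes the
slope function submodular. -/
theorem coheight_sup_add_inf {A B : Submodule ℤ_[p] T} (hA : IsFull p A) (hB : IsFull p B) :
    coheight p (A ⊔ B) + coheight p (A ⊓ B) = coheight p A + coheight p B := by
  have hS := (hA.mono (le_sup_left : A ≤ A ⊔ B)).index_ne_zero
  have hI := (hA.inf hB).index_ne_zero
  have h1 := AddSubgroup.relIndex_mul_index (Submodule.toAddSubgroup_mono (inf_le_right : A ⊓ B ≤ B))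
  have h2 := AddSubgroup.relIndex_mul_index (Submodule.toAddSubgroup_mono (le_sup_left : A ≤ A ⊔ B))
  have h3 : (A ⊓ B).toAddSubgroup.relIndex B.toAddSubgroup =
      A.toAddSubgroup.relIndex B.toAddSubgroup :=
    AddSubgroup.inf_relIndex_right A.toAddSubgroup B.toAddSubgroup
  have h4 : A.toAddSubgroup.relIndex (A ⊔ B).toAddSubgroup =
      A.toAddSubgroup.relIndex B.toAddSubgroup := by
    rw [Submodule.sup_toAddSubgroup, AddSubgroup.relIndex_sup_left]
  rw [h3] at h1
  rw [h4] at h2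
  have hA' := hA.index_ne_zero
  have hB' := hB.index_ne_zero
  have hx : (A ⊔ B).toAddSubgroup.index * (A ⊓ B).toAddSubgroup.index =
      A.toAddSubgroup.index * B.toAddSubgroup.index := by
    rw [← h1, ← h2]; ring
  simp only [coheight]
  rw [← Real.logb_mul (by exact_mod_cast hS) (by exact_mod_cast hI),
    ← Real.logb_mul (by exact_mod_cast hA') (by exact_mod_cast hB')]
  congr 1
  exact_mod_cast hx

theorem coheight_eq_add {A B : Submodule ℤ_[p] T} (hA : IsFull p A) (h : A ≤ B) :
    coheight p A = coheight p B + Real.logb p (Nat.card (B ⧸ A.submoduleOf B)) := by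
  have h1 := AddSubgroup.relIndex_mul_index (Submodule.toAddSubgroup_mono h)
  have h2 := hA.index_ne_zero
  have h3 : A.toAddSubgroup.relIndex B.toAddSubgroup = Nat.card (B ⧸ A.submoduleOf B) := rfl
  rw [← h1] at h2
  rw [coheight, coheight, ← h3, ← h1, Nat.cast_mul, Real.logb_mul, add_comm]
  · exact_mod_cast left_ne_zero_of_mul h2
  · exact_mod_cast right_ne_zero_of_mul h2

theorem coheight_le {A B : Submodule ℤ_[p] T} (hA : IsFull p A) (h : A ≤ B) :
    coheight p B ≤ coheight p A := by
  rw [coheight, coheight]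
  have h0 := (hA.mono h).index_ne_zero
  apply Real.logb_le_logb_of_le (one_lt_prime_cast p)
  · exact_mod_cast Nat.pos_of_ne_zero h0
  · exact_mod_cast Nat.le_of_dvd (Nat.pos_of_ne_zero hA.index_ne_zero)
      (AddSubgroup.index_dvd_of_le (Submodule.toAddSubgroup_mono h))

theorem coheight_lt {A B : Submodule ℤ_[p] T} (hA : IsFull p A) (h : A < B) :
    coheight p B < coheight p A := by
  have h0 := (hA.mono h.le).index_ne_zero
  have h1 := AddSubgroup.relIndex_mul_index (Submodule.toAddSubgroup_mono h.le)
  refine Real.logb_lt_logb (one_lt_prime_cast p) (by exact_mod_cast Nat.pos_of_ne_zero h0) ?_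
  refine Nat.cast_lt.2 (lt_of_le_of_ne (Nat.le_of_dvd (Nat.pos_of_ne_zero hA.index_ne_zero)
      (AddSubgroup.index_dvd_of_le (Submodule.toAddSubgroup_mono h.le))) fun heq => ?_)
  rw [← heq] at h1
  exact h.not_ge (AddSubgroup.relIndex_eq_one.1 (Nat.eq_of_mul_eq_mul_right
    (Nat.pos_of_ne_zero h0) (by rw [h1, one_mul])))

end Height

/-! ### Submodular slope functions and the maximal submodules they define. -/

section Filtration

variable {p : ℕ} [hp : Fact p.Prime] {T : Type u} [AddCommGroup T] [Module ℤ_[p] T]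
  [Module.Free ℤ_[p] T] [Module.Finite ℤ_[p] T]

variable (p) in
/-- The properties of `ψ(A) = (1 - μ) ht(T/A) - deg(ω/𝒪α(A))` that give the first steps of the
Harder-Narasimhan filtrations. -/
structure IsSlopeFunction (ψ : Submodule ℤ_[p] T → ℝ) (κ : ℝ) : Prop where
  sup_add_inf_le : ∀ A B, IsFull p A → IsFull p B → ψ (A ⊔ B) + ψ (A ⊓ B) ≤ ψ A + ψ B
  ppow_one : ∀ A, IsFull p A → ψ (ppow p 1 A) = ψ A + κ
  top : ψ ⊤ = 0
  le_of_ppow_one : ∀ A, ppow p 1 ⊤ ≤ A → κ ≤ ψ A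

namespace IsSlopeFunction

variable {ψ : Submodule ℤ_[p] T → ℝ} {κ : ℝ} (hψ : IsSlopeFunction p ψ κ)
include hψ

theorem ppow {A : Submodule ℤ_[p] T} (hA : IsFull p A) (k : ℕ) :
    ψ (ppow p k A) = ψ A + k * κ := by
  induction k with
  | zero => simp [ppow_zero]
  | succ k ih =>
    rw [add_comm, ← ppow_ppow, hψ.ppow_one _ (hA.ppow k), ih]
    push_cast
    ring

theorem ppow_top (k : ℕ) : ψ (HodgeTate.ppow p k ⊤) = k * κ := by
  rw [hψ.ppow isFull_top, hψ.top, zero_add]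

/-- Induction on k, by submodularity for A and pT: A + pT contains pT, and A ∩ pT = pB, where B
contains p^k T if A contains p^(k+1) T. In terms of slopes, X[p^k] has no subobject of slope larger
than those of X[p]. -/
theorem le {k : ℕ} {A : Submodule ℤ_[p] T} (hA : HodgeTate.ppow p k ⊤ ≤ A) : k * κ ≤ ψ A := by
  induction k generalizing A with
  | zero =>
    rw [ppow_zero, top_le_iff] at hA
    simp [hA, hψ.top]
  | succ k ih =>
    have h1 := hψ.sup_add_inf_le A _ ⟨_, hA⟩ (isFull_ppow_top 1)
    have hB : HodgeTate.ppow p k ⊤ ≤ A.comap (LinearMap.lsmul ℤ_[p] T ((p : ℤ_[p]) ^ 1)) := by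
      rintro _ ⟨a, ha, rfl⟩
      refine hA ⟨a, ha, ?_⟩
      simp only [LinearMap.lsmul_apply, smul_smul, ← pow_add, add_comm]
    rw [← ppow_comap, hψ.ppow_one _ ⟨k, hB⟩, hψ.ppow_top] at h1
    have h2 := hψ.le_of_ppow_one (A ⊔ HodgeTate.ppow p 1 ⊤) le_sup_right
    have h3 := ih hB
    push_cast at *
    linarith

/-- The minimizers of ψ above p^k T are stable under sums: if ψ(Y) and ψ(A) are at most kκ and ψ(Y ∩
A) ≥ kκ, then ψ(Y + A) ≤ kκ. A maximal one is therefore the largest. -/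
theorem exists_filtration : ∃ Y : ℕ → Submodule ℤ_[p] T,
    (∀ k, HodgeTate.ppow p k ⊤ ≤ Y k) ∧ (∀ k, ψ (Y k) = k * κ) ∧
      ∀ k A, HodgeTate.ppow p k ⊤ ≤ A → ψ A ≤ k * κ → A ≤ Y k := by
  have key : ∀ k : ℕ, ∃ Y : Submodule ℤ_[p] T, HodgeTate.ppow p k ⊤ ≤ Y ∧ ψ Y = k * κ ∧
      ∀ A, HodgeTate.ppow p k ⊤ ≤ A → ψ A ≤ k * κ → A ≤ Y := by
    intro k
    let S : Set (Submodule ℤ_[p] T) := {A | HodgeTate.ppow p k ⊤ ≤ A ∧ ψ A ≤ k * κ}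
    have hS : S.Nonempty := ⟨HodgeTate.ppow p k ⊤, le_rfl, (hψ.ppow_top k).le⟩
    obtain ⟨Y, hY, hmax⟩ := set_has_maximal_iff_noetherian.2
      (inferInstance : IsNoetherian ℤ_[p] T) S hS
    refine ⟨Y, hY.1, le_antisymm hY.2 (hψ.le hY.1), fun A hA hA' => ?_⟩
    have h1 := hψ.sup_add_inf_le Y A ⟨k, hY.1⟩ ⟨k, hA⟩
    have h2 := hψ.le (le_inf hY.1 hA)
    have h3 : Y ⊔ A ∈ S := ⟨hY.1.trans le_sup_left, by linarith [hY.2]⟩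
    have h4 := hmax _ h3
    by_contra hle
    exact h4 (lt_of_le_of_ne le_sup_left fun h => hle (h ▸ le_sup_right))
  choose Y h1 h2 h3 using key
  exact ⟨Y, h1, h2, h3⟩

variable {Y : ℕ → Submodule ℤ_[p] T} (h1 : ∀ k, HodgeTate.ppow p k ⊤ ≤ Y k)
  (h2 : ∀ k, ψ (Y k) = k * κ) (h3 : ∀ k A, HodgeTate.ppow p k ⊤ ≤ A → ψ A ≤ k * κ → A ≤ Y k)
include h1 h2 h3

/-- By submodularity for `Y (k+1)` and p^k T, their sum has ψ ≤ kκ, hence lies in `Y k`. -/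
theorem filtration_succ_le (k : ℕ) : Y (k + 1) ≤ Y k := by
  have h4 := hψ.sup_add_inf_le (Y (k + 1)) _ ⟨_, h1 _⟩ (isFull_ppow_top k)
  have hB : HodgeTate.ppow p 1 ⊤ ≤
      (Y (k + 1)).comap (LinearMap.lsmul ℤ_[p] T ((p : ℤ_[p]) ^ k)) := by
    rintro _ ⟨a, ha, rfl⟩
    refine h1 (k + 1) ⟨a, ha, ?_⟩
    simp only [LinearMap.lsmul_apply, smul_smul, ← pow_add]
  rw [← ppow_comap, hψ.ppow ⟨1, hB⟩, hψ.ppow_top, h2] at h4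
  have h5 := hψ.le_of_ppow_one _ hB
  refine le_sup_left.trans (h3 k _ le_sup_right ?_)
  push_cast at h4
  linarith

/-- This makes the subgroups p^{-k} `Y k`/T compatible: the p^k-torsion of the (k+1)-st one is the
k-th. For the first direction write `Y (k+1)` ∩ pT = pB; submodularity with pT forces ψ(B) ≤ kκ. -/
theorem smul_mem_filtration_succ (k : ℕ) (t : T) : (p : ℤ_[p]) • t ∈ Y (k + 1) ↔ t ∈ Y k := by
  constructor
  · intro ht
    have h4 := hψ.sup_add_inf_le (Y (k + 1)) _ ⟨_, h1 _⟩ (isFull_ppow_top 1)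
    have hB : HodgeTate.ppow p k ⊤ ≤
        (Y (k + 1)).comap (LinearMap.lsmul ℤ_[p] T ((p : ℤ_[p]) ^ 1)) := by
      rintro _ ⟨a, ha, rfl⟩
      refine h1 (k + 1) ⟨a, ha, ?_⟩
      simp only [LinearMap.lsmul_apply, smul_smul, ← pow_add, add_comm]
    rw [← ppow_comap, hψ.ppow ⟨k, hB⟩, hψ.ppow_top, h2] at h4
    have h5 := hψ.le_of_ppow_one (Y (k + 1) ⊔ HodgeTate.ppow p 1 ⊤) le_sup_right
    refine h3 k _ hB ?_ (by simpa using ht)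
    push_cast at h4
    linarith
  · intro ht
    have h4 : HodgeTate.ppow p 1 (Y k) ≤ Y (k + 1) := by
      apply h3
      · rw [add_comm, ← ppow_ppow]
        exact ppow_mono (h1 k)
      · rw [hψ.ppow_one _ ⟨k, h1 k⟩, h2]
        push_cast
        linarith
    simpa using h4 (smul_mem_ppow ht)

end IsSlopeFunction

/-! ### The shape of the filtration for large k. -/

section Limit

theorem isClosed_submodule_pi {n : ℕ} (N : Submodule ℤ_[p] (Fin n → ℤ_[p])) :
    IsClosed (N : Set (Fin n → ℤ_[p])) := by
  obtain ⟨m, f, hf⟩ := (Submodule.fg_iff_exists_fin_linearMap _ _).1 (IsNoetherian.noetherian N)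
  rw [← hf, LinearMap.coe_range]
  exact (isCompact_range f.continuous_on_pi).isClosed

/-- Submodules of ℤ_p^n are compact. The decompositions of t with first term in `A k` and second in
`B` form a decreasing sequence of nonempty compact sets, so one decomposition serves all k. -/
theorem mem_iInf_sup_of_forall {A : ℕ → Submodule ℤ_[p] T} (hA : ∀ k, A (k + 1) ≤ A k)
    (B : Submodule ℤ_[p] T) {t : T} (ht : ∀ k, t ∈ A k ⊔ B) : t ∈ (⨅ k, A k) ⊔ B := by
  let e := (Module.finBasis ℤ_[p] T).equivFun
  let f : (Fin (Module.finrank ℤ_[p] T) → ℤ_[p]) →ₗ[ℤ_[p]] T := e.symm.toLinearMap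
  let K : ℕ → Set (Fin (Module.finrank ℤ_[p] T) → ℤ_[p]) :=
    fun k => (((A k).comap f : Submodule _ _) : Set _) ∩
      (fun x => e t - x) ⁻¹' ((B.comap f : Submodule _ _) : Set _)
  have hcl : ∀ k, IsClosed (K k) := fun k =>
    (isClosed_submodule_pi _).inter ((isClosed_submodule_pi _).preimage (by fun_prop))
  obtain ⟨x, hx⟩ := IsCompact.nonempty_iInter_of_sequence_nonempty_isCompact_isClosed K
    (fun k x hx => ⟨hA k hx.1, hx.2⟩) (fun k => by
      obtain ⟨a, ha, b, hb, hab⟩ := Submodule.mem_sup.1 (ht k)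
      refine ⟨e a, ?_, ?_⟩
      · simpa [f] using ha
      · simpa [f, ← hab] using hb) (hcl 0).isCompact hcl
  rw [Set.mem_iInter] at hx
  refine Submodule.mem_sup.2 ⟨f x, (Submodule.mem_iInf _).2 fun k => (hx k).1, t - f x, ?_, by simp⟩
  have := (hx 0).2
  simpa [f] using this

variable {Y : ℕ → Submodule ℤ_[p] T} (hY : ∀ k, Y (k + 1) ≤ Y k)
  (hp1 : ∀ k t, (p : ℤ_[p]) • t ∈ Y (k + 1) ↔ t ∈ Y k)

include hp1 in
theorem pow_smul_mem_iff (j k : ℕ) (t : T) : (p : ℤ_[p]) ^ j • t ∈ Y (k + j) ↔ t ∈ Y k := by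
  induction j with
  | zero => simp
  | succ j ih => rw [pow_succ', mul_smul, ← add_assoc, hp1, ih]

include hY hp1 in
theorem mem_iInf_of_pow_smul_mem (j : ℕ) {t : T} (ht : (p : ℤ_[p]) ^ j • t ∈ ⨅ k, Y k) :
    t ∈ ⨅ k, Y k := by
  rw [Submodule.mem_iInf] at *
  exact fun k => (pow_smul_mem_iff hp1 j k t).1 (ht _)

include hY hp1 in
-- The images of the `Y k` in the finite group T/pT are constant from some m on, so by compactness
-- `Y m` ⊆ D + pT, where D is the intersection. If d + pa with d ∈ D lies in `Y (m+k+1)`, then so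
-- does pa, whence a ∈ `Y (m+k)`; iterate.
theorem exists_filtration_le : ∃ m, ∀ k, Y (m + k) ≤ (⨅ k, Y k) ⊔ ppow p k (Y m) := by
  have hanti : Antitone Y := antitone_nat_of_succ_le hY
  have hfin : Finite (T ⧸ ppow p 1 (⊤ : Submodule ℤ_[p] T)) :=
    Nat.finite_of_card_ne_zero (isFull_ppow_top 1).index_ne_zero
  obtain ⟨m, hm⟩ := IsArtinian.monotone_stabilizes
    (⟨fun k => OrderDual.toDual ((Y k).map (ppow p 1 (⊤ : Submodule ℤ_[p] T)).mkQ), fun a b hab =>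
      Submodule.map_mono (hanti hab)⟩ : ℕ →o (Submodule ℤ_[p] (T ⧸ ppow p 1 (⊤ : Submodule ℤ_[p] T)))ᵒᵈ)
  have hsup : ∀ t ∈ Y m, ∀ k, t ∈ Y k ⊔ ppow p 1 ⊤ := by
    intro t ht k
    rcases le_total m k with hk | hk
    · have h1 : (Y m).map (ppow p 1 (⊤ : Submodule ℤ_[p] T)).mkQ =
        (Y k).map (ppow p 1 (⊤ : Submodule ℤ_[p] T)).mkQ := hm k hk
      have h2 : (ppow p 1 (⊤ : Submodule ℤ_[p] T)).mkQ t ∈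
          (Y k).map (ppow p 1 (⊤ : Submodule ℤ_[p] T)).mkQ := h1 ▸ Submodule.mem_map_of_mem ht
      obtain ⟨y, hy, hyt⟩ := h2
      rw [Submodule.mkQ_apply, Submodule.mkQ_apply, eq_comm, Submodule.Quotient.eq] at hyt
      exact Submodule.mem_sup.2 ⟨y, hy, t - y, hyt, by abel⟩
    · exact Submodule.mem_sup_left (hanti hk ht)
  have hstep : ∀ k, Y (m + k + 1) ≤ (⨅ k, Y k) ⊔ ppow p 1 (Y (m + k)) := by
    intro k t ht
    obtain ⟨d, hd, _, ⟨a, -, rfl⟩, rfl⟩ := Submodule.mem_sup.1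
      (mem_iInf_sup_of_forall hY _ (hsup t (hanti (by omega) ht)))
    have h1 : (LinearMap.lsmul ℤ_[p] T ((p : ℤ_[p]) ^ 1)) a ∈ Y (m + k + 1) := by
      have := (Y (m + k + 1)).sub_mem ht ((Submodule.mem_iInf _).1 hd (m + k + 1))
      simpa using this
    refine Submodule.add_mem_sup hd ⟨a, ?_, rfl⟩
    exact (hp1 _ _).1 (by simpa using h1)
  refine ⟨m, fun k => ?_⟩
  induction k with
  | zero => rw [ppow_zero]; exact le_sup_right
  | succ k ih =>
    refine (hstep k).trans (sup_le le_sup_left ?_)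
    refine (ppow_mono ih).trans ?_
    rw [ppow, Submodule.map_sup, ← ppow, ← ppow, ppow_ppow, add_comm 1 k]
    exact sup_le_sup_right (ppow_le _ _) _

include hp1 in
theorem sup_ppow_le_filtration (m k : ℕ) : (⨅ k, Y k) ⊔ ppow p k (Y m) ≤ Y (m + k) := by
  refine sup_le (iInf_le _ _) ?_
  rintro _ ⟨a, ha, rfl⟩
  exact (pow_smul_mem_iff hp1 k m a).2 ha

end Limit

end Filtration

/-- The image of `M` in `W/Q` is `M/Q`. -/
def mapMkQEquiv {R : Type*} [CommRing R] {W : Type*} [AddCommGroup W] [Module R W]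
    (Q M : Submodule R W) : (M ⧸ Q.submoduleOf M) ≃ₗ[R] M.map Q.mkQ :=
  (Submodule.quotEquivOfEq _ _ (by
    ext x
    rw [LinearMap.mem_ker, Subtype.ext_iff]
    exact (Submodule.Quotient.mk_eq_zero Q).symm)).trans
    ((Q.mkQ.submoduleMap M).quotKerEquivOfSurjective (Q.mkQ.submoduleMap_surjective M))

/-! ### Subobjects of X[p^k] as submodules of T that contain p^k T. -/

namespace Triple

variable {p : ℕ} [hp : Fact p.Prime] {C : Type w} [NormedField C] [IsUltrametricDist C]
  [NormedAlgebra ℚ_[p] C] (X Z : Triple.{u, v, w} p C)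

theorem α_smul (c : ℤ_[p]) (t : X.T) : X.α (c • t) = zpToOC C p c • X.α t := map_smulₛₗ _ _ _

theorem α_pow_smul (k : ℕ) (t : X.T) :
    X.α ((p : ℤ_[p]) ^ k • t) = (p : OC C) ^ k • X.α t := by
  rw [α_smul, map_pow, map_natCast]

theorem mem_spanImage {A : Submodule ℤ_[p] X.T} {t : X.T} (ht : t ∈ A) :
    X.α t ∈ X.spanImage A := Submodule.subset_span ⟨t, ht, rfl⟩

theorem spanImage_mono {A B : Submodule ℤ_[p] X.T} (h : A ≤ B) : X.spanImage A ≤ X.spanImage B :=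
  Submodule.span_mono (Set.image_mono h)

theorem spanImage_le {A : Submodule ℤ_[p] X.T} {M : Submodule (OC C) X.ω}
    (h : ∀ t ∈ A, X.α t ∈ M) : X.spanImage A ≤ M := by
  rw [spanImage, Submodule.span_le]
  rintro _ ⟨t, ht, rfl⟩
  exact h t ht

theorem spanImage_bot : X.spanImage ⊥ = ⊥ := by simp [spanImage]

theorem spanImage_sup (A B : Submodule ℤ_[p] X.T) :
    X.spanImage (A ⊔ B) = X.spanImage A ⊔ X.spanImage B := by
  refine le_antisymm (X.spanImage_le ?_)
    (sup_le (X.spanImage_mono le_sup_left) (X.spanImage_mono le_sup_right))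
  intro t ht
  obtain ⟨a, ha, b, hb, rfl⟩ := Submodule.mem_sup.1 ht
  rw [map_add]
  exact Submodule.add_mem_sup (X.mem_spanImage ha) (X.mem_spanImage hb)

theorem spanImage_ppow (k : ℕ) (A : Submodule ℤ_[p] X.T) :
    X.spanImage (ppow p k A) = (X.spanImage A).map (LinearMap.lsmul (OC C) X.ω ((p : OC C) ^ k)) := by
  rw [spanImage, spanImage, Submodule.map_span, ← Set.image_comp, ppow, Submodule.map_coe,
    ← Set.image_comp]
  congr 2
  ext t
  exact X.α_pow_smul k t

theorem spanImage_fg [Module.Finite ℤ_[p] X.T] (A : Submodule ℤ_[p] X.T) :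
    (X.spanImage A).FG := by
  obtain ⟨s, hs⟩ := IsNoetherian.noetherian A
  classical
  refine ⟨s.image X.α, le_antisymm ?_ ?_⟩
  · rw [Submodule.span_le, Finset.coe_image]
    rintro _ ⟨t, ht, rfl⟩
    exact X.mem_spanImage (hs ▸ Submodule.subset_span ht)
  · refine X.spanImage_le fun t ht => ?_
    rw [← hs] at ht
    induction ht using Submodule.span_induction with
    | mem t ht => exact Submodule.subset_span (by simpa using ⟨t, ht, rfl⟩)
    | zero => simp
    | add a b _ _ ha hb => rw [map_add]; exact Submodule.add_mem _ ha hb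
    | smul c a _ ha => rw [α_smul]; exact Submodule.smul_mem _ _ ha

variable {X Z} in
theorem Hom.map_spanImage (φ : Hom X Z) (A : Submodule ℤ_[p] X.T) :
    (X.spanImage A).map φ.g = Z.spanImage (A.map φ.f) := by
  rw [spanImage, spanImage, Submodule.map_span, ← Set.image_comp, Submodule.map_coe,
    ← Set.image_comp]
  congr 2
  ext t
  exact φ.comm t

/-- The inclusion of a subobject. -/
def subHom (A : Submodule ℤ_[p] X.T) : Hom (X.sub A) X :=
  ⟨A.subtype, (X.spanImage A).subtype, fun _ => rfl⟩

/-- The projection to a quotient. -/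
def quotHom (N : Submodule ℤ_[p] X.T) (W : Submodule (OC C) X.ω) (h : N ≤ W.comap X.α) :
    Hom X (X.quot N W h) := ⟨N.mkQ, W.mkQ, fun _ => rfl⟩

/-- The projection `X → X[p^k]`. -/
def torsionHom (k : ℕ) : Hom X (X.torsion k) := quotHom _ _ _ _

/-- The submodule of `X[p^k]` attached to `A`. -/
def torsionSub (k : ℕ) (A : Submodule ℤ_[p] X.T) : Submodule ℤ_[p] (X.torsion k).T :=
  A.map (X.torsionHom k).f

variable {X}

theorem torsionHom_eq_zero_iff {k : ℕ} {t : X.T} : (X.torsionHom k).f t = 0 ↔ t ∈ ppow p k ⊤ := by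
  rw [ppow, Submodule.map_top]
  exact Submodule.Quotient.mk_eq_zero _

theorem torsionHom_mem_torsionSub {k : ℕ} {A : Submodule ℤ_[p] X.T} (hA : ppow p k ⊤ ≤ A)
    {t : X.T} : (X.torsionHom k).f t ∈ X.torsionSub k A ↔ t ∈ A := by
  refine ⟨?_, Submodule.mem_map_of_mem⟩
  rintro ⟨a, ha, h⟩
  have h1 : t - a ∈ ppow p k ⊤ := by
    rw [← torsionHom_eq_zero_iff, map_sub, h, sub_self]
  simpa using A.add_mem (hA h1) ha

theorem exists_eq_torsionSub (k : ℕ) (N : Submodule ℤ_[p] (X.torsion k).T) :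
    ∃ A, ppow p k ⊤ ≤ A ∧ N = X.torsionSub k A := by
  refine ⟨N.comap (X.torsionHom k).f, ?_, ?_⟩
  · intro t ht
    rw [Submodule.mem_comap, torsionHom_eq_zero_iff.2 ht]
    exact N.zero_mem
  · exact (Submodule.map_comap_eq_of_surjective (Submodule.mkQ_surjective _) N).symm

theorem torsionSub_le_iff {k : ℕ} {A B : Submodule ℤ_[p] X.T} (hB : ppow p k ⊤ ≤ B) :
    X.torsionSub k A ≤ X.torsionSub k B ↔ A ≤ B := by
  refine ⟨fun h t ht => (torsionHom_mem_torsionSub hB).1 (h (Submodule.mem_map_of_mem ht)),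
    Submodule.map_mono⟩

theorem torsionSub_eq_bot_iff {k : ℕ} {A : Submodule ℤ_[p] X.T} :
    X.torsionSub k A = ⊥ ↔ A ≤ ppow p k ⊤ := by
  rw [torsionSub, ← le_bot_iff, Submodule.map_le_iff_le_comap]
  exact ⟨fun h t ht => torsionHom_eq_zero_iff.1 (by simpa using h ht),
    fun h t ht => by simpa using torsionHom_eq_zero_iff.2 (h ht)⟩

variable (X)

/-- `deg(ω/𝒪α(A))`. -/
def codeg (A : Submodule ℤ_[p] X.T) : ℝ := codegree p (X.spanImage A)

/-- The rank of `T`. -/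
abbrev rkT : ℕ := Module.finrank ℤ_[p] X.T

/-- The rank of `ω`. -/
abbrev rkω : ℕ := Module.finrank (OC C) X.ω

section Integral

variable [hX : Fact X.IsIntegral]

instance : Module.Free ℤ_[p] X.T := hX.out.free_T
instance : Module.Finite ℤ_[p] X.T := hX.out.finite_T
instance : Module.Free (OC C) X.ω := hX.out.free_ω
instance : Module.Finite (OC C) X.ω := hX.out.finite_ω

theorem isLattice_spanImage {A : Submodule ℤ_[p] X.T} (hA : IsFull p A) :
    IsLattice p (X.spanImage A) := by
  refine ⟨X.spanImage_fg A, ?_⟩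
  obtain ⟨k, hk⟩ := hA
  refine ⟨k, fun x => X.spanImage_mono hk ?_⟩
  rw [spanImage_ppow, hX.out.span_eq_top]
  exact ⟨x, trivial, rfl⟩

theorem codeg_top : X.codeg ⊤ = 0 := by
  rw [codeg, hX.out.span_eq_top, codegree_top]

theorem codeg_ppow {A : Submodule ℤ_[p] X.T} (hA : IsFull p A) (k : ℕ) :
    X.codeg (ppow p k A) = X.codeg A + k * X.rkω := by
  induction k with
  | zero => simp [ppow_zero]
  | succ k ih =>
    rw [add_comm, ← ppow_ppow, codeg, spanImage_ppow, pow_one,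
      codegree_map_prime_smul (X.isLattice_spanImage (hA.ppow k)), ← codeg, ih]
    push_cast
    ring

theorem codeg_add_le {A B : Submodule ℤ_[p] X.T} (hA : IsFull p A) (hB : IsFull p B) :
    X.codeg A + X.codeg B ≤ X.codeg (A ⊔ B) + X.codeg (A ⊓ B) := by
  rw [codeg, codeg, codeg, codeg, spanImage_sup]
  exact codegree_add_le (X.isLattice_spanImage (hA.inf hB)) (X.isLattice_spanImage hA)
    (X.isLattice_spanImage hB) (X.spanImage_mono inf_le_left) (X.spanImage_mono inf_le_right)

theorem codeg_eq_add {A B : Submodule ℤ_[p] X.T} (hA : IsFull p A) (h : A ≤ B) :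
    X.codeg A = X.codeg B +
      degree p C (X.spanImage B ⧸ (X.spanImage A).submoduleOf (X.spanImage B)) :=
  codegree_eq_add (X.isLattice_spanImage hA) (X.isLattice_spanImage (hA.mono h))
    (X.spanImage_mono h)

theorem codeg_le {A B : Submodule ℤ_[p] X.T} (hA : IsFull p A) (h : A ≤ B) :
    X.codeg B ≤ X.codeg A := by
  rw [X.codeg_eq_add hA h]
  linarith [degree_nonneg (p := p) (C := C) (X.spanImage B ⧸ (X.spanImage A).submoduleOf (X.spanImage B))]

theorem codeg_le_of_ppow_le {k : ℕ} {A : Submodule ℤ_[p] X.T} (hA : ppow p k ⊤ ≤ A) :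
    X.codeg A ≤ k * X.rkω := by
  have := X.codeg_le (isFull_ppow_top k) hA
  rwa [X.codeg_ppow isFull_top, X.codeg_top, zero_add] at this

theorem coheight_ppow_top (k : ℕ) : coheight p (ppow p k (⊤ : Submodule ℤ_[p] X.T)) = k * X.rkT := by
  rw [coheight_ppow isFull_top, coheight_top, zero_add]

theorem torsionHeight_torsionSub {k : ℕ} {A : Submodule ℤ_[p] X.T} (hA : ppow p k ⊤ ≤ A) :
    ((X.torsion k).sub (X.torsionSub k A)).torsionHeight = k * X.rkT - coheight p A := by
  have h := coheight_eq_add (isFull_ppow_top k) hA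
  rw [coheight_ppow_top] at h
  rw [torsionHeight, h, add_sub_cancel_left]
  congr 2
  refine Nat.card_congr (LinearEquiv.toEquiv (?_ : _ ≃ₗ[ℤ_[p]] _))
  refine (mapMkQEquiv _ A).symm.trans (Submodule.quotEquivOfEq _ _ ?_)
  rw [ppow, Submodule.map_top]

theorem degree_torsionSub {k : ℕ} {A : Submodule ℤ_[p] X.T} (hA : ppow p k ⊤ ≤ A) :
    degree p C ((X.torsion k).sub (X.torsionSub k A)).ω = k * X.rkω - X.codeg A := by
  have h := X.codeg_eq_add (isFull_ppow_top k) hA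
  rw [X.codeg_ppow isFull_top, X.codeg_top, zero_add] at h
  rw [h, add_sub_cancel_left]
  show degree p C ((X.torsion k).spanImage (X.torsionSub k A)) = _
  have h1 : X.spanImage (ppow p k ⊤) = LinearMap.range (LinearMap.lsmul (OC C) X.ω ((p : OC C) ^ k)) := by
    rw [spanImage_ppow, hX.out.span_eq_top, Submodule.map_top]
  rw [h1, torsionSub, ← Hom.map_spanImage]
  exact (degree_congr (mapMkQEquiv _ (X.spanImage A))).symm

theorem torsionSlope_torsionSub {k : ℕ} {A : Submodule ℤ_[p] X.T} (hA : ppow p k ⊤ ≤ A) :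
    ((X.torsion k).sub (X.torsionSub k A)).torsionSlope =
      ((k * X.rkT - coheight p A) - (k * X.rkω - X.codeg A)) / (k * X.rkT - coheight p A) := by
  rw [torsionSlope, torsionDegree, torsionHeight_torsionSub X hA, degree_torsionSub X hA]

/-- The function `(1 - μ) ht(T/A) - deg(ω/𝒪α(A))`. -/
def slopeFun (μ : ℝ) (A : Submodule ℤ_[p] X.T) : ℝ := (1 - μ) * coheight p A - X.codeg A

/-- The value of `slopeFun` at `pT`. -/
def slopeConst (μ : ℝ) : ℝ := (1 - μ) * X.rkT - X.rkω

/-- `μ` is the largest slope of a nonzero subobject of `X[p]`. -/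
structure IsMaxSlope (μ : ℝ) : Prop where
  le_one : μ ≤ 1
  le_slopeFun : ∀ A, ppow p 1 ⊤ ≤ A → X.slopeConst μ ≤ X.slopeFun μ A
  exists_eq : ∃ A, ppow p 1 ⊤ < A ∧ X.slopeFun μ A = X.slopeConst μ

variable {X}

theorem coheight_lt_of_lt {k : ℕ} {A : Submodule ℤ_[p] X.T} (hA : ppow p k ⊤ < A) :
    0 < k * X.rkT - coheight p A := by
  have := coheight_lt (isFull_ppow_top k) hA
  rw [coheight_ppow_top] at this
  linarith

/-- As the height in the denominator is positive, comparing a slope with μ becomes comparing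
`slopeFun μ A` with k times its value at pT. -/
theorem torsionSlope_torsionSub_eq (μ : ℝ) {k : ℕ} {A : Submodule ℤ_[p] X.T}
    (hA : ppow p k ⊤ < A) :
    ((X.torsion k).sub (X.torsionSub k A)).torsionSlope =
      μ + (k * X.slopeConst μ - X.slopeFun μ A) / (k * X.rkT - coheight p A) := by
  have h := coheight_lt_of_lt hA
  rw [torsionSlope_torsionSub X hA.le, slopeConst, slopeFun]
  field_simp
  ring

theorem IsMaxSlope.isSlopeFunction {μ : ℝ} (hμ : X.IsMaxSlope μ) :
    IsSlopeFunction p (X.slopeFun μ) (X.slopeConst μ) where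
  sup_add_inf_le A B hA hB := by
    have h1 := X.codeg_add_le hA hB
    have h2 := coheight_sup_add_inf hA hB
    have h3 := congrArg (fun x => (1 - μ) * x) h2
    simp only [mul_add] at h3
    simp only [slopeFun]
    linarith
  ppow_one A hA := by
    simp only [slopeFun, slopeConst]
    rw [coheight_ppow hA, X.codeg_ppow hA]
    push_cast
    ring
  top := by simp [slopeFun, coheight_top, codeg_top]
  le_of_ppow_one := hμ.le_slopeFun

theorem IsMaxSlope.isFirstStep {μ : ℝ} (hμ : X.IsMaxSlope μ) {k : ℕ} (hk : 1 ≤ k)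
    {Y : Submodule ℤ_[p] X.T} (h1 : ppow p k ⊤ ≤ Y) (h2 : X.slopeFun μ Y = k * X.slopeConst μ)
    (h3 : ∀ A, ppow p k ⊤ ≤ A → X.slopeFun μ A ≤ k * X.slopeConst μ → A ≤ Y) :
    (X.torsion k).IsFirstStep (X.torsionSub k Y) := by
  have hψ := hμ.isSlopeFunction
  obtain ⟨A, hA, hA'⟩ := hμ.exists_eq
  -- If A realizes the maximal slope in X[p], then p^(k-1) A is a minimizer above p^k T, so it lies
  -- in `Y`; it is larger than p^k T.
  have hlt : ppow p k ⊤ < Y := by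
    refine lt_of_le_of_ne h1 fun heq => ?_
    obtain ⟨j, rfl⟩ := Nat.exists_eq_add_of_le hk
    have hle : ppow p j A ≤ Y := by
      refine h3 _ ?_ ?_
      · rw [add_comm, ← ppow_ppow]; exact ppow_mono hA.le
      · rw [hψ.ppow ⟨1, hA.le⟩, hA']
        push_cast
        linarith
    refine hA.not_ge fun t ht => ?_
    have h4 := hle (smul_mem_ppow ht)
    rwa [← heq, add_comm, ← ppow_ppow, smul_mem_ppow_iff] at h4
  have hYs := torsionSlope_torsionSub_eq μ hlt
  rw [h2, sub_self, zero_div, add_zero] at hYs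
  refine ⟨fun h => hlt.not_ge (torsionSub_eq_bot_iff.1 h), fun N hN => ?_⟩
  obtain ⟨B, hB, rfl⟩ := exists_eq_torsionSub k N
  have hBlt : ppow p k ⊤ < B := lt_of_le_of_ne hB fun h => hN (torsionSub_eq_bot_iff.2 h.ge)
  have hpos := coheight_lt_of_lt hBlt
  have hBs := torsionSlope_torsionSub_eq μ hBlt
  have hle := hψ.le hB
  rw [hYs, hBs]
  constructor
  · have : (k * X.slopeConst μ - X.slopeFun μ B) / (k * X.rkT - coheight p B) ≤ 0 :=
      div_nonpos_of_nonpos_of_nonneg (by linarith) hpos.le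
    linarith
  · intro h
    rw [add_eq_left, div_eq_zero_iff, or_iff_left hpos.ne'] at h
    exact (torsionSub_le_iff h1).2 (h3 B hB (by linarith))

theorem finite_setOf_ppow_le (k : ℕ) : {A : Submodule ℤ_[p] X.T | ppow p k ⊤ ≤ A}.Finite := by
  have hfin : Finite (X.T ⧸ ppow p k (⊤ : Submodule ℤ_[p] X.T)) :=
    Nat.finite_of_card_ne_zero (isFull_ppow_top k).index_ne_zero
  have : Finite (Submodule ℤ_[p] (X.T ⧸ ppow p k (⊤ : Submodule ℤ_[p] X.T))) :=
    Finite.of_injective (fun N => (N : Set (X.T ⧸ ppow p k (⊤ : Submodule ℤ_[p] X.T))))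
      SetLike.coe_injective
  refine Set.Finite.subset (Set.finite_range (Submodule.comap (ppow p k ⊤).mkQ)) ?_
  intro A hA
  exact ⟨A.map (ppow p k ⊤).mkQ, by rw [Submodule.comap_map_mkQ, sup_eq_right.2 hA]⟩

theorem ppow_one_top_lt [Nontrivial X.T] : ppow p 1 (⊤ : Submodule ℤ_[p] X.T) < ⊤ := by
  rw [lt_top_iff_ne_top]
  intro h
  have h1 := X.coheight_ppow_top 1
  rw [h, coheight_top] at h1
  have h2 : 0 < X.rkT := Module.finrank_pos
  have h3 : (X.rkT : ℝ) = 0 := by simpa using h1.symm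
  exact h2.ne' (by exact_mod_cast h3)

/-- Only finitely many A contain pT, so the ratio σ of degree to height attains a minimum, and μ is
one minus this minimum. -/
theorem exists_isMaxSlope [Nontrivial X.T] : ∃ μ, X.IsMaxSlope μ := by
  let σ : Submodule ℤ_[p] X.T → ℝ := fun A => (X.rkω - X.codeg A) / (X.rkT - coheight p A)
  have hfin : {A : Submodule ℤ_[p] X.T | ppow p 1 ⊤ < A}.Finite :=
    (finite_setOf_ppow_le 1).subset fun A (hA : ppow p 1 ⊤ < A) => hA.le
  obtain ⟨A, hA, hmin⟩ := hfin.exists_minimalFor σ _ ⟨⊤, ppow_one_top_lt⟩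
  have hpos : ∀ B : Submodule ℤ_[p] X.T, ppow p 1 ⊤ < B → 0 < X.rkT - coheight p B := by
    intro B hB
    simpa using coheight_lt_of_lt hB
  refine ⟨1 - σ A, ?_, ?_, A, hA, ?_⟩
  · have h1 : X.codeg A ≤ X.rkω := by simpa using X.codeg_le_of_ppow_le (le_of_lt hA)
    have h2 : 0 ≤ σ A := div_nonneg (by linarith) (hpos A hA).le
    linarith
  · intro B hB
    rcases hB.eq_or_lt with rfl | hB
    · simp only [slopeConst, slopeFun, X.coheight_ppow_top, X.codeg_ppow isFull_top, X.codeg_top]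
      simp
    · have h1 : σ A ≤ σ B := by
        rcases le_total (σ A) (σ B) with h | h
        · exact h
        · exact hmin hB h
      rw [le_div_iff₀ (hpos B hB)] at h1
      simp only [slopeConst, slopeFun]
      linarith
  · have h1 : σ A * (X.rkT - coheight p A) = X.rkω - X.codeg A :=
      div_mul_cancel₀ _ (hpos A hA).ne'
    simp only [slopeConst, slopeFun]
    linarith

end Integral

end Triple

/-! ### Finiteness of the set of slopes in an isogeny class. -/

section Discrete

variable {p : ℕ} [hp : Fact p.Prime] {C : Type w} [NormedField C] [IsUltrametricDist C]
  [NormedAlgebra ℚ_[p] C]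

theorem fract_logb_norm_smul {a : ℚ_[p]} (ha : a ≠ 0) {x : C} (hx : x ≠ 0) :
    Int.fract (Real.logb p ‖a • x‖) = Int.fract (Real.logb p ‖x‖) := by
  have h1 := one_lt_prime_cast p
  rw [norm_smul, Real.logb_mul (norm_ne_zero_iff.2 ha) (norm_ne_zero_iff.2 hx),
    Padic.norm_eq_zpow_neg_valuation ha, ← Real.rpow_intCast, Real.logb_rpow_eq_mul_logb_of_pos (by positivity), Real.logb_self_eq_one h1, mul_one,
    Int.fract_intCast_add]

/-- The norms of the nonzero elements of a finite dimensional `ℚ_p`-subspace of `C` lie in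
finitely many classes modulo `p^ℤ`. -/
theorem finite_fract_logb_norm (U : Submodule ℚ_[p] C) [FiniteDimensional ℚ_[p] U] :
    {s : ℝ | ∃ x ∈ U, x ≠ 0 ∧ Int.fract (Real.logb p ‖x‖) = s}.Finite := by
  let S : Set ℝ := {s : ℝ | ∃ x ∈ U, x ≠ 0 ∧ Int.fract (Real.logb p ‖x‖) = s}
  choose x hxU hx0 hxs using fun s : S => s.2
  have hli : LinearIndependent ℚ_[p] (fun s : S => (⟨x s, hxU s⟩ : U)) := by
    apply LinearIndependent.of_comp U.subtype
    rw [linearIndependent_iff']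
    intro t g hg i hi
    by_contra hne
    classical
    let t' := t.filter fun j => g j ≠ 0
    have ht' : t'.Nonempty := ⟨i, Finset.mem_filter.2 ⟨hi, hne⟩⟩
    have hsum : ∑ j ∈ t', g j • x j = 0 := by
      rw [Finset.sum_filter_of_ne]
      · exact hg
      · intro j _ h h0
        exact h (by rw [h0, zero_smul])
    -- Scalars from ℚ_p shift the logarithm of the norm by integers, so distinct fractional parts
    -- keep the norms of the terms pairwise distinct, and a vanishing combination would have the
    -- norm of its largest term.
    have hmax := IsUltrametricDist.norm_sum_eq_sup'_of_pairwise_ne ht'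
      (f := fun j => g j • x j) (by
        intro j hj k hk hjk h
        apply hjk
        have hj' := (Finset.mem_filter.1 hj).2
        have hk' := (Finset.mem_filter.1 hk).2
        apply Subtype.ext
        rw [← hxs j, ← hxs k, ← fract_logb_norm_smul hj' (hx0 j),
          ← fract_logb_norm_smul hk' (hx0 k), h])
    rw [hsum, norm_zero] at hmax
    have hle := Finset.le_sup' (fun j => ‖g j • x j‖) (Finset.mem_filter.2 ⟨hi, hne⟩ : i ∈ t')
    rw [← hmax] at hle
    have := norm_le_zero_iff.1 hle
    exact (smul_ne_zero hne (hx0 i)) this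
  have : Finite S := hli.finite
  exact Set.toFinite S

theorem prod_mem_pow {U : Submodule ℚ_[p] C} {ι : Type*} (s : Finset ι) (f : ι → C)
    (hf : ∀ i ∈ s, f i ∈ U) : ∏ i ∈ s, f i ∈ U ^ s.card := by
  classical
  induction s using Finset.induction_on with
  | empty => simp
  | insert i s hi ih =>
    rw [Finset.prod_insert hi, Finset.card_insert_of_notMem hi, pow_succ']
    exact Submodule.mul_mem_mul (hf i (Finset.mem_insert_self i s))
      (ih fun j hj => hf j (Finset.mem_insert_of_mem hj))

end Discrete

namespace Triple

variable {p : ℕ} [hp : Fact p.Prime] {C : Type w} [NormedField C] [IsUltrametricDist C]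
  [NormedAlgebra ℚ_[p] C] (X : Triple.{u, v, w} p C)

section Integral

variable [hX : Fact X.IsIntegral]

/-- Over the local ring 𝒪_C, every generating family of a finite free module contains a basis. The
freedom in `f` is used twice: for discreteness, and for the degree of E + p^k T. -/
theorem exists_codeg_eq_of_span {A : Submodule ℤ_[p] X.T} (hA : IsFull p A)
    (b : Module.Basis (Fin X.rkω) (OC C) X.ω) {ι : Type*} (f : ι → X.ω)
    (hf : Submodule.span (OC C) (Set.range f) = X.spanImage A) :
    ∃ a : Fin X.rkω → ι, LinearIndependent (OC C) (fun i => f (a i)) ∧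
      b.det (fun i => f (a i)) ≠ 0 ∧
      X.codeg A = -Real.logb p ‖((b.det (fun i => f (a i)) : OC C) : C)‖ := by
  have hL := X.isLattice_spanImage hA
  have := hL.finite
  have := free_of_fg hL.fg
  have : Module.FinitePresentation (OC C) (X.spanImage A) :=
    Module.finitePresentation_of_projective _ _
  have hmem : ∀ i, f i ∈ X.spanImage A := fun i => hf ▸ Submodule.subset_span ⟨i, rfl⟩
  obtain ⟨κ, a, m, hm⟩ := Module.exists_basis_of_span_of_flat
    (fun i => (⟨f i, hmem i⟩ : X.spanImage A)) (by
      apply Submodule.map_injective_of_injective (X.spanImage A).injective_subtype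
      rw [Submodule.map_span, Submodule.map_subtype_top, ← Set.range_comp]
      exact hf)
  have : Fintype κ := @Fintype.ofFinite _ (Module.Finite.finite_basis m)
  have e : κ ≃ Fin X.rkω :=
    Fintype.equivFinOfCardEq (by rw [← Module.finrank_eq_card_basis m, hL.finrank_eq])
  have hval : ∀ i, ((m.reindex e) i : X.ω) = f (a (e.symm i)) := by
    intro i
    simp [hm]
  refine ⟨fun i => a (e.symm i), ?_, ?_, ?_⟩
  · simp_rw [← hval]
    exact (m.reindex e).linearIndependent.map' (X.spanImage A).subtype (Submodule.ker_subtype _)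
  · simp_rw [← hval]
    exact hL.det_ne_zero b _
  · simp_rw [← hval]
    exact codegree_of_basis b _

/-- The coordinates of all α(t) lie in the finite dimensional ℚ_p-space `U0`, so the determinants
that compute `codeg A` lie in its power with exponent rk ω, whatever A is. -/
theorem exists_finset_codeg : ∃ F : Finset ℝ, ∀ A : Submodule ℤ_[p] X.T, IsFull p A →
    ∃ f ∈ F, ∃ z : ℤ, X.codeg A = z - f := by
  let b := Module.finBasis (OC C) X.ω
  let t := Module.finBasis ℤ_[p] X.T
  let U0 : Submodule ℚ_[p] C := Submodule.span ℚ_[p]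
    (Set.range fun ij : Fin X.rkT × Fin X.rkω => ((b.repr (X.α (t ij.1)) ij.2 : OC C) : C))
  have hU0 : U0.FG := Submodule.fg_span (Set.finite_range _)
  have : FiniteDimensional ℚ_[p] (U0 ^ X.rkω : Submodule ℚ_[p] C) :=
    Module.Finite.iff_fg.2 (hU0.pow _)
  have hmem : ∀ (x : X.T) j, ((b.repr (X.α x) j : OC C) : C) ∈ U0 := by
    intro x j
    rw [← t.sum_repr x]
    simp only [map_sum, α_smul, map_smul, Finsupp.coe_finsetSum, Finset.sum_apply,
      Finsupp.smul_apply, smul_eq_mul, AddSubmonoidClass.coe_finsetSum, MulMemClass.coe_mul]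
    refine Submodule.sum_mem _ fun i _ => ?_
    have : ((zpToOC C p (t.repr x i) : OC C) : C) * ((b.repr (X.α (t i)) j : OC C) : C) =
        ((t.repr x i : ℤ_[p]) : ℚ_[p]) • ((b.repr (X.α (t i)) j : OC C) : C) := by
      rw [Algebra.smul_def]
      rfl
    rw [this]
    exact Submodule.smul_mem _ _ (Submodule.subset_span ⟨(i, j), rfl⟩)
  have hdet : ∀ a : Fin X.rkω → X.T, ((b.det fun i => X.α (a i) : OC C) : C) ∈ U0 ^ X.rkω := by
    intro a
    rw [Module.Basis.det_apply, Matrix.det_apply]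
    simp only [AddSubmonoidClass.coe_finsetSum]
    refine Submodule.sum_mem _ fun σ _ => ?_
    have h1 : ∏ i, ((b.toMatrix (fun i => X.α (a i)) (σ i) i : OC C) : C) ∈ U0 ^ X.rkω := by
      have := prod_mem_pow (U := U0) Finset.univ
        (fun i => ((b.toMatrix (fun i => X.α (a i)) (σ i) i : OC C) : C)) fun i _ => hmem _ _
      simpa using this
    rcases Int.units_eq_one_or (Equiv.Perm.sign σ) with h | h
    · rw [h, one_smul]
      simpa using h1
    · rw [h, Units.neg_smul, one_smul]
      simpa using h1
  refine ⟨(finite_fract_logb_norm (U0 ^ X.rkω : Submodule ℚ_[p] C)).toFinset, fun A hA => ?_⟩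
  obtain ⟨a, -, h0, ha⟩ := X.exists_codeg_eq_of_span hA b (fun x : A => X.α x) (by
    rw [spanImage]
    congr 1
    ext y
    simp)
  refine ⟨_, (Set.Finite.mem_toFinset _).2 ⟨_, hdet (fun i => (a i : X.T)), ?_, rfl⟩,
    -⌊Real.logb p ‖((b.det (fun i => X.α (a i)) : OC C) : C)‖⌋, ?_⟩
  · simpa using h0
  · rw [ha, Int.cast_neg, ← neg_add', Int.floor_add_fract]

/-- The slope of `B/pA`, for `pA ⊆ B ⊆ A`. -/
def relSlope (A B : Submodule ℤ_[p] X.T) : ℝ :=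
  1 - (X.rkω - (X.codeg B - X.codeg A)) / (X.rkT - (coheight p B - coheight p A))

/-- `S` contains the slopes of all subobjects of all `Y[p]`, for `Y` isogenous to `X`. -/
def SlopesIn (S : Finset ℝ) : Prop :=
  ∀ A B : Submodule ℤ_[p] X.T, IsFull p A → ppow p 1 A ≤ B → B ≤ A → X.relSlope A B ∈ S

/-- For pA ⊆ B ⊆ A the differences of degrees and heights are bounded; the height is an integer and
the degree is discrete by `exists_finset_codeg`. -/
theorem exists_slopesIn : ∃ S, X.SlopesIn S := by
  obtain ⟨F, hF⟩ := X.exists_finset_codeg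
  let D : Finset ℝ := ((F ×ˢ F) ×ˢ Finset.Icc (-((∑ f ∈ F, ⌈|f|⌉) + ∑ f ∈ F, ⌈|f|⌉))
    (X.rkω + ((∑ f ∈ F, ⌈|f|⌉) + ∑ f ∈ F, ⌈|f|⌉))).image fun x => (x.2 : ℝ) - x.1.1 + x.1.2
  -- The difference of heights is rk T when B = pA; the denominator of `relSlope` is then 0 and its
  -- value is 1.
  refine ⟨(D ×ˢ Finset.range (X.rkT + 1)).image
    fun x => 1 - (X.rkω - x.1) / (X.rkT - (x.2 : ℝ)), fun A B hA h1 h2 => ?_⟩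
  have hB : IsFull p B := (hA.ppow 1).mono h1
  have hfin : IsFull p (ppow p 1 A) := hA.ppow 1
  have hc1 := X.codeg_le hB h2
  have hc2 := X.codeg_le hfin h1
  have hh1 := coheight_le hB h2
  have hh2 := coheight_le hfin h1
  rw [codeg_ppow X hA] at hc2
  rw [coheight_ppow hA] at hh2
  obtain ⟨i, hi⟩ := hA.exists_coheight
  obtain ⟨j, hj⟩ := hB.exists_coheight
  rw [hi, hj] at hh1 hh2
  have hij : i ≤ j := by exact_mod_cast hh1
  have hji : j ≤ i + X.rkT := by
    have : (j : ℝ) ≤ ((i + X.rkT : ℕ) : ℝ) := by push_cast; simpa using hh2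
    exact_mod_cast this
  obtain ⟨f, hf, z, hz⟩ := hF A hA
  obtain ⟨f', hf', z', hz'⟩ := hF B hB
  have hbound : ∀ f ∈ F, |f| ≤ ((∑ f ∈ F, ⌈|f|⌉ : ℤ) : ℝ) := by
    intro f hf
    refine (Int.le_ceil _).trans (Int.cast_le.2 ?_)
    exact Finset.single_le_sum (f := fun f : ℝ => ⌈|f|⌉)
      (fun i _ => Int.ceil_nonneg (abs_nonneg i)) hf
  have hbf := abs_le.1 (hbound f hf)
  have hbf' := abs_le.1 (hbound f' hf')
  have hD : X.codeg B - X.codeg A ∈ D := by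
    refine Finset.mem_image.2 ⟨((f', f), z' - z), ?_, ?_⟩
    · simp only [Finset.mem_product, Finset.mem_Icc]
      refine ⟨⟨hf', hf⟩, ?_, ?_⟩
      · rw [← Int.cast_le (R := ℝ)]
        push_cast at *
        linarith
      · rw [← Int.cast_le (R := ℝ)]
        push_cast at *
        linarith
    · rw [hz, hz']
      push_cast
      ring
  refine Finset.mem_image.2 ⟨(X.codeg B - X.codeg A, j - i), ?_, ?_⟩
  · exact Finset.mem_product.2 ⟨hD, Finset.mem_range.2 (by omega)⟩
  · rw [relSlope, hi, hj]
    simp only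
    rw [Nat.cast_sub hij]

variable {X}

theorem IsMaxSlope.exists_relSlope {μ : ℝ} (hμ : X.IsMaxSlope μ) :
    ∃ B, ppow p 1 ⊤ ≤ B ∧ X.relSlope ⊤ B = μ := by
  obtain ⟨A, hA, h⟩ := hμ.exists_eq
  refine ⟨A, hA.le, ?_⟩
  have hpos := coheight_lt_of_lt hA
  rw [Nat.cast_one, one_mul] at hpos
  rw [relSlope, codeg_top, coheight_top, sub_zero, sub_zero]
  rw [slopeFun, slopeConst] at h
  have : (X.rkω - X.codeg A : ℝ) = (1 - μ) * (X.rkT - coheight p A) := by linarith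
  rw [this, mul_div_cancel_right₀ _ hpos.ne']
  ring

theorem IsMaxSlope.mem {μ : ℝ} (hμ : X.IsMaxSlope μ) {S : Finset ℝ} (hS : X.SlopesIn S) :
    μ ∈ S := by
  obtain ⟨B, hB, rfl⟩ := hμ.exists_relSlope
  exact hS _ _ isFull_top hB le_top

end Integral

end Triple

/-! ### Saturation with respect to one element. -/

section Saturation

variable {R : Type*} [CommRing R] {W : Type*} [AddCommGroup W] [Module R W]

/-- The submodule of all `x` with `a^n x ∈ M` for some `n`. -/
def saturation (a : R) (M : Submodule R W) : Submodule R W where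
  carrier := {x | ∃ n : ℕ, a ^ n • x ∈ M}
  zero_mem' := ⟨0, by simp⟩
  add_mem' := by
    rintro x y ⟨n, hx⟩ ⟨k, hy⟩
    refine ⟨n + k, ?_⟩
    rw [smul_add]
    refine Submodule.add_mem _ ?_ ?_
    · rw [pow_add, mul_comm, mul_smul]
      exact Submodule.smul_mem _ _ hx
    · rw [pow_add, mul_smul]
      exact Submodule.smul_mem _ _ hy
  smul_mem' := by
    rintro c x ⟨n, hx⟩
    exact ⟨n, by rw [smul_comm]; exact Submodule.smul_mem _ _ hx⟩

theorem le_saturation (a : R) (M : Submodule R W) : M ≤ saturation a M :=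
  fun x hx => ⟨0, by simpa using hx⟩

theorem exists_pow_smul_mem_of_fg {a : R} {M : Submodule R W} (h : (saturation a M).FG) :
    ∃ k : ℕ, ∀ x ∈ saturation a M, a ^ k • x ∈ M := by
  obtain ⟨s, hs⟩ := h
  have hmem : ∀ x : s, (x : W) ∈ saturation a M := fun x => hs ▸ Submodule.subset_span x.2
  choose n hn using hmem
  refine ⟨∑ x, n x, fun x hx => ?_⟩
  rw [← hs] at hx
  induction hx using Submodule.span_induction with
  | mem x hx =>
    obtain ⟨j, hj⟩ := Nat.exists_eq_add_of_le
      (Finset.single_le_sum (f := n) (fun _ _ => Nat.zero_le _) (Finset.mem_univ ⟨x, hx⟩))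
    rw [hj, pow_add, mul_comm, mul_smul]
    exact M.smul_mem _ (hn ⟨x, hx⟩)
  | zero => simp
  | add x y _ _ hx hy => rw [smul_add]; exact M.add_mem hx hy
  | smul c x _ hx => rw [smul_comm]; exact M.smul_mem _ hx

theorem finrank_le_of_pow_smul_mem [IsDomain R] [Module.IsTorsionFree R W] {a : R} (ha : a ≠ 0)
    (k : ℕ) {M N : Submodule R W} [Module.Finite R M] (h : ∀ x ∈ N, a ^ k • x ∈ M) :
    Module.finrank R N ≤ Module.finrank R M := by
  let f : N →ₗ[R] M := (LinearMap.lsmul R W (a ^ k)).restrict h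
  refine LinearMap.finrank_le_finrank_of_injective (f := f) fun x y hxy => ?_
  exact Subtype.ext (smul_right_injective W (pow_ne_zero k ha) (congrArg Subtype.val hxy))

end Saturation

section Height

variable {p : ℕ} [hp : Fact p.Prime] {T : Type u} [AddCommGroup T] [Module ℤ_[p] T]

theorem map_ppow {T' : Type*} [AddCommGroup T'] [Module ℤ_[p] T'] (f : T →ₗ[ℤ_[p]] T') (k : ℕ)
    (A : Submodule ℤ_[p] T) : (ppow p k A).map f = ppow p k (A.map f) := by
  rw [ppow, ppow, ← Submodule.map_comp, ← Submodule.map_comp]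
  congr 1
  ext t
  simp

theorem IsFull.map_subtype {A : Submodule ℤ_[p] T} (hA : IsFull p A) {B : Submodule ℤ_[p] A}
    (hB : IsFull p B) : IsFull p (B.map A.subtype) := by
  obtain ⟨j, hj⟩ := hA
  obtain ⟨k, hk⟩ := hB
  refine ⟨k + j, ?_⟩
  rw [← ppow_ppow]
  refine (ppow_mono hj).trans ?_
  have := Submodule.map_mono (f := A.subtype) hk
  rwa [map_ppow, Submodule.map_subtype_top] at this

variable [Module.Free ℤ_[p] T] [Module.Finite ℤ_[p] T]

theorem coheight_map_subtype {A : Submodule ℤ_[p] T} (hA : IsFull p A) {B : Submodule ℤ_[p] A}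
    (hB : IsFull p B) : coheight p (B.map A.subtype) = coheight p B + coheight p A := by
  have h : (B.map A.subtype).toAddSubgroup.index =
      B.toAddSubgroup.index * A.toAddSubgroup.index :=
    AddSubgroup.index_map_subtype (H := A.toAddSubgroup) B.toAddSubgroup
  have h1 := hA.index_ne_zero
  have h2 := hB.index_ne_zero
  rw [coheight, h, Nat.cast_mul, Real.logb_mul (by exact_mod_cast h2) (by exact_mod_cast h1)]
  rfl

theorem IsFull.finrank_eq {A : Submodule ℤ_[p] T} (hA : IsFull p A) :
    Module.finrank ℤ_[p] A = Module.finrank ℤ_[p] T := by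
  apply le_antisymm (Submodule.finrank_le A)
  obtain ⟨k, hk⟩ := hA
  let f : T →ₗ[ℤ_[p]] A :=
    (LinearMap.lsmul ℤ_[p] T ((p : ℤ_[p]) ^ k)).codRestrict A fun t => hk (smul_mem_ppow trivial)
  refine LinearMap.finrank_le_finrank_of_injective (f := f) fun x y hxy => ?_
  exact smul_pow_injective k (congrArg Subtype.val hxy)

end Height

/-! ### Subobjects, isogenies and saturated quotients. -/

namespace Triple

variable {p : ℕ} [hp : Fact p.Prime] {C : Type w} [NormedField C] [IsUltrametricDist C]
  [NormedAlgebra ℚ_[p] C] {X Z Z' : Triple.{u, v, w} p C}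

/-- The composite of two morphisms. -/
def Hom.comp (ψ : Hom Z Z') (φ : Hom X Z) : Hom X Z' :=
  ⟨ψ.f ∘ₗ φ.f, ψ.g ∘ₗ φ.g, fun t => by simp [φ.comm, ψ.comm]⟩

/-- The identity. -/
def Hom.id (X : Triple.{u, v, w} p C) : Hom X X := ⟨LinearMap.id, LinearMap.id, fun _ => rfl⟩

/-- The restriction of a morphism to a subobject and its image. -/
def Hom.restrict (φ : Hom X Z) (A : Submodule ℤ_[p] X.T) : Hom (X.sub A) (Z.sub (A.map φ.f)) where
  f := φ.f.submoduleMap A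
  g := φ.g.restrict (p := X.spanImage A) (q := Z.spanImage (A.map φ.f)) fun _ hx =>
    φ.map_spanImage A ▸ Submodule.mem_map_of_mem hx
  comm t := Subtype.ext (φ.comm ((X.subHom A).f t))

theorem Hom.restrict_f_surjective (φ : Hom X Z) (A : Submodule ℤ_[p] X.T) :
    Function.Surjective (φ.restrict A).f := φ.f.submoduleMap_surjective A

theorem Hom.restrict_g_surjective (φ : Hom X Z) (A : Submodule ℤ_[p] X.T) :
    Function.Surjective (φ.restrict A).g := by
  rintro ⟨y, hy⟩
  rw [← φ.map_spanImage A] at hy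
  obtain ⟨x, hx, rfl⟩ := hy
  exact ⟨⟨x, hx⟩, rfl⟩

/-- Multiplication by `p^k` from `X` to a subobject that contains `p^k T`. -/
def powHom (k : ℕ) (A : Submodule ℤ_[p] X.T) (hA : ppow p k ⊤ ≤ A) (hX : X.spanImage ⊤ = ⊤) :
    Hom X (X.sub A) where
  f := (LinearMap.lsmul ℤ_[p] X.T ((p : ℤ_[p]) ^ k)).codRestrict A fun t =>
    hA (smul_mem_ppow trivial)
  g := (LinearMap.lsmul (OC C) X.ω ((p : OC C) ^ k)).codRestrict (X.spanImage A) fun x =>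
    X.spanImage_mono hA (by
      rw [spanImage_ppow, hX]
      exact Submodule.mem_map_of_mem trivial)
  comm t := Subtype.ext (X.α_pow_smul k t).symm

theorem submoduleOf_spanImage_map_subtype (A : Submodule ℤ_[p] X.T)
    (B : Submodule ℤ_[p] (X.sub A).T) :
    (X.spanImage (B.map (X.subHom A).f)).submoduleOf (X.spanImage A) = (X.sub A).spanImage B := by
  rw [← Hom.map_spanImage]
  exact Submodule.comap_map_eq_of_injective (X.spanImage A).injective_subtype _

section Integral

variable [hX : Fact X.IsIntegral]

instance sub_isIntegral (A : Submodule ℤ_[p] X.T) : Fact (X.sub A).IsIntegral := by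
  refine ⟨⟨inferInstanceAs (Module.Free ℤ_[p] A), inferInstanceAs (Module.Finite ℤ_[p] A),
    free_of_fg (X.spanImage_fg A), Module.Finite.iff_fg.2 (X.spanImage_fg A), ?_⟩⟩
  rw [← submoduleOf_spanImage_map_subtype]
  have : (⊤ : Submodule ℤ_[p] (X.sub A).T).map (X.subHom A).f = A := Submodule.map_subtype_top A
  rw [this]
  exact Submodule.submoduleOf_self _

theorem rkT_sub {A : Submodule ℤ_[p] X.T} (hA : IsFull p A) : (X.sub A).rkT = X.rkT :=
  hA.finrank_eq

theorem rkω_sub {A : Submodule ℤ_[p] X.T} (hA : IsFull p A) : (X.sub A).rkω = X.rkω :=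
  (X.isLattice_spanImage hA).finrank_eq

theorem codeg_map_subtype {A : Submodule ℤ_[p] X.T} (hA : IsFull p A)
    {B : Submodule ℤ_[p] (X.sub A).T} (hB : IsFull p B) :
    X.codeg (B.map (X.subHom A).f) = (X.sub A).codeg B + X.codeg A := by
  refine (X.codeg_eq_add (hA.map_subtype hB) (Submodule.map_subtype_le A B)).trans ?_
  rw [add_comm]
  have h1 : (X.sub A).codeg B =
      degree p C (X.spanImage A ⧸ ((X.sub A).spanImage B : Submodule (OC C) (X.spanImage A))) := rfl
  rw [h1, ← submoduleOf_spanImage_map_subtype]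
  rfl

/-- Passing from A to T shifts all coheights and all codegrees by constants, which cancel in
`relSlope`. So one set S serves along a whole sequence of isogenies. -/
theorem SlopesIn.sub {S : Finset ℝ} (hS : X.SlopesIn S) {A : Submodule ℤ_[p] X.T}
    (hA : IsFull p A) : (X.sub A).SlopesIn S := by
  intro B B' hB h1 h2
  have hB' : IsFull p B' := (hB.ppow 1).mono h1
  have := hS (B.map (X.subHom A).f) (B'.map (X.subHom A).f) (hA.map_subtype hB)
    (by rw [← map_ppow]; exact Submodule.map_mono h1) (Submodule.map_mono h2)
  rw [relSlope, codeg_map_subtype hA hB, codeg_map_subtype hA hB'] at this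
  have e1 : coheight p (B.map (X.subHom A).f) = coheight p B + coheight p A :=
    coheight_map_subtype hA hB
  have e2 : coheight p (B'.map (X.subHom A).f) = coheight p B' + coheight p A :=
    coheight_map_subtype hA hB'
  rw [e1, e2, add_sub_add_right_eq_sub, add_sub_add_right_eq_sub] at this
  rwa [relSlope, rkT_sub hA, rkω_sub hA]

end Integral

section Saturation

variable (X)

/-- The saturation of `𝒪_C α(D)`. -/
def satImage (D : Submodule ℤ_[p] X.T) : Submodule (OC C) X.ω :=
  saturation (p : OC C) (X.spanImage D)

theorem spanImage_le_satImage (D : Submodule ℤ_[p] X.T) : X.spanImage D ≤ X.satImage D :=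
  le_saturation _ _

theorem le_comap_satImage (D : Submodule ℤ_[p] X.T) : D ≤ (X.satImage D).comap X.α :=
  fun _ ht => X.spanImage_le_satImage D (X.mem_spanImage ht)

/-- The quotient of `X` by `D` and the saturation of `𝒪_C α(D)`. -/
def satQuot (D : Submodule ℤ_[p] X.T) : Triple.{u, v, w} p C :=
  X.quot D (X.satImage D) (X.le_comap_satImage D)

/-- The projection to `satQuot`. -/
def satQuotHom (D : Submodule ℤ_[p] X.T) : Hom X (X.satQuot D) := X.quotHom _ _ _

theorem satQuotHom_f_eq_zero {D : Submodule ℤ_[p] X.T} {t : X.T} :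
    (X.satQuotHom D).f t = 0 ↔ t ∈ D := Submodule.Quotient.mk_eq_zero _

theorem satQuotHom_g_eq_zero {D : Submodule ℤ_[p] X.T} {x : X.ω} :
    (X.satQuotHom D).g x = 0 ↔ x ∈ X.satImage D := Submodule.Quotient.mk_eq_zero _

theorem satQuotHom_f_surjective (D : Submodule ℤ_[p] X.T) :
    Function.Surjective (X.satQuotHom D).f := Submodule.mkQ_surjective _

theorem satQuotHom_g_surjective (D : Submodule ℤ_[p] X.T) :
    Function.Surjective (X.satQuotHom D).g := Submodule.mkQ_surjective _

variable (p) in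
/-- `D` is saturated in `T`. -/
def _root_.HodgeTate.IsSaturated {T : Type*} [AddCommGroup T] [Module ℤ_[p] T]
    (D : Submodule ℤ_[p] T) : Prop := ∀ (k : ℕ) (t : T), (p : ℤ_[p]) ^ k • t ∈ D → t ∈ D

/-- The valuation has rank one, so every nonzero `a` divides a power of p; saturating at p removes
all the torsion of the quotient. -/
theorem satImage_smul_mem {D : Submodule ℤ_[p] X.T} {a : OC C} (ha : a ≠ 0) {x : X.ω}
    (hx : a • x ∈ X.satImage D) : x ∈ X.satImage D := by
  have hpos := norm_coe_pos ha
  obtain ⟨n, hn⟩ := exists_pow_lt_of_lt_one hpos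
    (inv_lt_one_of_one_lt₀ (one_lt_prime_cast p))
  have ha' : (a : C) ≠ 0 := by simpa using ha
  have hb : ‖((p : OC C) ^ n : OC C) / (a : C)‖ ≤ 1 := by
    rw [norm_div, div_le_one hpos, SubmonoidClass.coe_pow, norm_pow, norm_natCast_prime]
    exact hn.le
  obtain ⟨b, hpn⟩ : ∃ b : OC C, (p : OC C) ^ n = b * a :=
    ⟨⟨_, (mem_OC_iff C _).2 hb⟩, Subtype.ext (div_mul_cancel₀ _ ha').symm⟩
  obtain ⟨k, hk⟩ := (X.satImage D).smul_mem b hx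
  rw [smul_smul b, ← hpn, smul_smul, ← pow_add] at hk
  exact ⟨_, hk⟩

theorem isSaturated_smul_mem {T : Type*} [AddCommGroup T] [Module ℤ_[p] T]
    {D : Submodule ℤ_[p] T} (hD : IsSaturated p D) {a : ℤ_[p]} (ha : a ≠ 0) {t : T}
    (ht : a • t ∈ D) : t ∈ D := by
  rw [PadicInt.unitCoeff_spec ha, mul_smul, ← Units.smul_def] at ht
  exact hD _ _ ((D.smul_mem_iff_of_isUnit (PadicInt.unitCoeff ha).isUnit).1 ht)

theorem satQuot_isIntegral [hX : Fact X.IsIntegral] {D : Submodule ℤ_[p] X.T}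
    (hD : IsSaturated p D) : (X.satQuot D).IsIntegral := by
  have h1 : Module.Finite ℤ_[p] (X.T ⧸ D) := inferInstance
  have h2 : Module.Finite (OC C) (X.ω ⧸ X.satImage D) :=
    Module.Finite.of_surjective _ (Submodule.mkQ_surjective (X.satImage D))
  have h3 : Module.IsTorsionFree ℤ_[p] (X.T ⧸ D) := by
    refine Module.IsTorsionFree.of_smul_eq_zero fun a x hax => ?_
    obtain ⟨t, rfl⟩ := Submodule.mkQ_surjective _ x
    by_contra! hne
    rw [Submodule.mkQ_apply, ← Submodule.Quotient.mk_smul, Submodule.Quotient.mk_eq_zero] at hax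
    exact hne.2 ((Submodule.Quotient.mk_eq_zero _).2 (isSaturated_smul_mem hD hne.1 hax))
  have h4 : Module.IsTorsionFree (OC C) (X.ω ⧸ X.satImage D) := by
    refine Module.IsTorsionFree.of_smul_eq_zero fun a x hax => ?_
    obtain ⟨t, rfl⟩ := Submodule.mkQ_surjective _ x
    by_contra! hne
    rw [Submodule.mkQ_apply, ← Submodule.Quotient.mk_smul, Submodule.Quotient.mk_eq_zero] at hax
    exact hne.2 ((Submodule.Quotient.mk_eq_zero _).2 (X.satImage_smul_mem hne.1 hax))
  refine ⟨(inferInstance : Module.Free ℤ_[p] (X.T ⧸ D)), h1,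
    @free_of_finite_isTorsionFree C _ _ (X.ω ⧸ X.satImage D) _ _ h2 h4, h2, ?_⟩
  have := (X.satQuotHom D).map_spanImage ⊤
  rw [hX.out.span_eq_top, Submodule.map_top, Submodule.map_top,
    LinearMap.range_eq_top.2 (X.satQuotHom_f_surjective D),
    LinearMap.range_eq_top.2 (X.satQuotHom_g_surjective D)] at this
  exact this.symm

end Saturation

/-! ### The descent step in terms of the filtration. -/

section Step

theorem descentTerminates_of_subsingleton (h : Subsingleton X.T) : X.DescentTerminates :=
  ⟨0, fun _ => X, rfl, fun _ hi => absurd hi (Nat.not_lt_zero _), h⟩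

theorem DescentTerminates.of_step (h0 : Nontrivial X.T) (h : IsDescentStep X Z)
    (hZ : Z.DescentTerminates) : X.DescentTerminates := by
  obtain ⟨N, W, hW0, hW, hN⟩ := hZ
  refine ⟨N + 1, fun i => Nat.casesOn i X W, rfl, ?_, hN⟩
  intro i hi
  cases i with
  | zero => exact ⟨h0, by simpa [hW0] using h⟩
  | succ i => exact hW i (by omega)

variable [hX : Fact X.IsIntegral]

/-- The first steps `Y k` of the Harder-Narasimhan filtrations of the `X[p^k]`. -/
structure IsFirstSteps (μ : ℝ) (Y : ℕ → Submodule ℤ_[p] X.T) : Prop where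
  isMaxSlope : X.IsMaxSlope μ
  ppow_le : ∀ k, ppow p k ⊤ ≤ Y k
  slopeFun_eq : ∀ k : ℕ, X.slopeFun μ (Y k) = k * X.slopeConst μ
  le_of_slopeFun_le : ∀ (k : ℕ) A, ppow p k ⊤ ≤ A → X.slopeFun μ A ≤ k * X.slopeConst μ → A ≤ Y k

theorem IsMaxSlope.exists_isFirstSteps {μ : ℝ} (hμ : X.IsMaxSlope μ) :
    ∃ Y : ℕ → Submodule ℤ_[p] X.T, IsFirstSteps μ Y :=
  let ⟨Y, h1, h2, h3⟩ := hμ.isSlopeFunction.exists_filtration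
  ⟨Y, hμ, h1, h2, h3⟩

namespace IsFirstSteps

variable {μ : ℝ} {Y : ℕ → Submodule ℤ_[p] X.T} (h : IsFirstSteps μ Y)
include h

theorem succ_le (k : ℕ) : Y (k + 1) ≤ Y k :=
  h.isMaxSlope.isSlopeFunction.filtration_succ_le h.2 h.3 h.4 k

theorem smul_mem (k : ℕ) (t : X.T) : (p : ℤ_[p]) • t ∈ Y (k + 1) ↔ t ∈ Y k :=
  h.isMaxSlope.isSlopeFunction.smul_mem_filtration_succ h.2 h.3 h.4 k t

theorem isSaturated : IsSaturated p (⨅ k, Y k) :=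
  fun k _ ht => mem_iInf_of_pow_smul_mem h.succ_le h.smul_mem k ht

theorem isFull (k : ℕ) : IsFull p (Y k) := ⟨k, h.ppow_le k⟩

/-- With Λ = p^{-m} `Y m` + D[1/p], multiplication by p^m identifies Λ modulo D[1/p] with `Y m`
modulo D. So X → X/𝓕_X is p^m : X → `Y m` followed by the projection `ρ` modulo D. -/
theorem isDescentStep {m : ℕ} (hm : ∀ k, Y (m + k) ≤ (⨅ k, Y k) ⊔ ppow p k (Y m))
    (hZ : Z.IsIntegral) (ρ : Hom (X.sub (Y m)) Z) (hsurj : Function.Surjective ρ.f)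
    (hf : ∀ t, ρ.f t = 0 ↔ (X.subHom (Y m)).f t ∈ ⨅ k, Y k)
    (hg : ∀ x, ρ.g x = 0 ↔ (X.subHom (Y m)).g x ∈ X.satImage (⨅ k, Y k)) :
    IsDescentStep X Z := by
  let P : Hom X (X.sub (Y m)) := powHom m (Y m) (h.ppow_le m) hX.out.span_eq_top
  let φ : Hom X Z := ρ.comp P
  have hD := h.isSaturated
  have hφf : ∀ t, φ.f t = ρ.f (P.f t) := fun _ => rfl
  have hP : ∀ t, (X.subHom (Y m)).f (P.f t) = (p : ℤ_[p]) ^ m • t := fun _ => rfl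
  have hker : LinearMap.ker φ.f = ⨅ k, Y k := by
    ext t
    rw [LinearMap.mem_ker, hφf, hf, hP]
    exact ⟨fun ht => hD m t ht, fun ht => Submodule.smul_mem _ _ ht⟩
  refine ⟨hZ, φ, ?_, ?_, ?_⟩
  · intro s
    obtain ⟨y, rfl⟩ := hsurj s
    refine ⟨m, (X.subHom (Y m)).f y, ?_⟩
    rw [hφf, ← map_smul]
    rfl
  · intro k hk
    refine ⟨X.torsionSub k (Y k),
      h.isMaxSlope.isFirstStep hk (h.ppow_le k) (h.slopeFun_eq k) (h.le_of_slopeFun_le k), ?_⟩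
    intro t
    refine (torsionHom_mem_torsionSub (h.ppow_le k)).trans ?_
    have hiff : (∃ s, φ.f t = (p : ℤ_[p]) ^ k • s) ↔
        ∃ y ∈ Y m, (p : ℤ_[p]) ^ m • t - (p : ℤ_[p]) ^ k • y ∈ ⨅ k, Y k := by
      constructor
      · rintro ⟨s, hs⟩
        obtain ⟨y, rfl⟩ := hsurj s
        refine ⟨(X.subHom (Y m)).f y, y.2, ?_⟩
        rwa [hφf, ← map_smul, ← sub_eq_zero, ← map_sub, hf, map_sub, map_smul, hP] at hs
      · rintro ⟨y, hy, hyt⟩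
        obtain ⟨y, rfl⟩ : ∃ z, (X.subHom (Y m)).f z = y := ⟨⟨y, hy⟩, rfl⟩
        refine ⟨ρ.f y, ?_⟩
        rwa [hφf, ← map_smul, ← sub_eq_zero, ← map_sub, hf, map_sub, map_smul, hP]
    rw [hiff]
    have hpow := pow_smul_mem_iff h.smul_mem
    -- For k ≥ m the criterion is `Y (m+j)` = D + p^j `Y m`; for k ≤ m it is that t ∈ `Y k` iff
    -- p^(m-k) t ∈ `Y m`.
    rcases le_total m k with hmk | hkm
    · obtain ⟨j, rfl⟩ := Nat.exists_eq_add_of_le hmk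
      constructor
      · intro ht
        obtain ⟨d, hd, _, ⟨y, hy, rfl⟩, rfl⟩ := Submodule.mem_sup.1 (hm j ht)
        refine ⟨y, hy, ?_⟩
        rw [LinearMap.lsmul_apply, smul_add, smul_smul, ← pow_add, add_sub_cancel_right]
        exact Submodule.smul_mem _ _ hd
      · rintro ⟨y, hy, hyt⟩
        rw [pow_add, mul_smul, ← smul_sub] at hyt
        have := sup_ppow_le_filtration h.smul_mem m j
          (Submodule.add_mem_sup (hD m _ hyt) (smul_mem_ppow (k := j) hy))
        simpa using this
    · obtain ⟨j, rfl⟩ := Nat.exists_eq_add_of_le hkm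
      constructor
      · intro ht
        refine ⟨(p : ℤ_[p]) ^ j • t, (hpow j k t).2 ht, ?_⟩
        rw [smul_smul, ← pow_add, sub_self]
        exact Submodule.zero_mem _
      · rintro ⟨y, hy, hyt⟩
        rw [pow_add, mul_smul, ← smul_sub] at hyt
        have h1 := (Submodule.mem_iInf _).1 (hD k _ hyt) (k + j)
        have h2 := Submodule.add_mem _ h1 hy
        rw [sub_add_cancel] at h2
        exact (hpow j k t).1 h2
  · intro x
    rw [hker]
    refine (hg _).trans ⟨?_, ?_⟩
    · exact fun hx => X.satImage_smul_mem (pow_ne_zero m prime_cast_ne_zero) hx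
    · exact fun hx => Submodule.smul_mem _ _ hx

theorem isDescentStep_sub {m : ℕ} (hm : ∀ k, Y (m + k) ≤ (⨅ k, Y k) ⊔ ppow p k (Y m))
    (hD : ⨅ k, Y k = ⊥) : IsDescentStep X (X.sub (Y m)) := by
  refine h.isDescentStep hm (sub_isIntegral (Y m)).out (Hom.id _) Function.surjective_id ?_ ?_
  · intro t
    rw [hD, Submodule.mem_bot]
    exact (Submodule.coe_eq_zero (x := (t : Y m))).symm
  · intro x
    have : (X.subHom (Y m)).g x ∈ X.satImage (⨅ k, Y k) ↔ (X.subHom (Y m)).g x = 0 := by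
      constructor
      · rintro ⟨n, hn⟩
        rw [hD, spanImage_bot, Submodule.mem_bot] at hn
        exact (smul_eq_zero.1 hn).resolve_left (pow_ne_zero n prime_cast_ne_zero)
      · intro hx
        rw [hx]
        exact Submodule.zero_mem _
    rw [this]
    exact (Submodule.coe_eq_zero (x := (x : X.spanImage (Y m)))).symm

theorem isDescentStep_satQuot {m : ℕ} (hm : ∀ k, Y (m + k) ≤ (⨅ k, Y k) ⊔ ppow p k (Y m)) :
    IsDescentStep X
      ((X.satQuot (⨅ k, Y k)).sub ((Y m).map (X.satQuotHom (⨅ k, Y k)).f)) := by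
  have := Fact.mk (X.satQuot_isIntegral h.isSaturated)
  refine h.isDescentStep hm (sub_isIntegral _).out ((X.satQuotHom _).restrict (Y m))
    (Hom.restrict_f_surjective _ _) ?_ ?_
  · intro t
    rw [← X.satQuotHom_f_eq_zero]
    exact Subtype.ext_iff
  · intro x
    rw [← X.satQuotHom_g_eq_zero]
    exact Subtype.ext_iff

/-- If A ⊆ `Y m`, strictly larger than p `Y m`, had slope ≥ μ in `Y m` modulo p, then ψ(A) ≤ (m+1)κ,
hence A ⊆ `Y (m+1)` ⊆ p `Y m` because D = 0. -/
theorem maxSlope_sub_lt {m : ℕ} (hm : ∀ k, Y (m + k) ≤ (⨅ k, Y k) ⊔ ppow p k (Y m))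
    (hD : ⨅ k, Y k = ⊥) {ν : ℝ} (hν : (X.sub (Y m)).IsMaxSlope ν) : ν < μ := by
  by_contra! hle
  obtain ⟨A, hA, hAν⟩ := hν.exists_eq
  have hAf : IsFull p A := ⟨1, hA.le⟩
  have hpos := coheight_lt_of_lt hA
  have hY := h.isFull m
  have e1 : coheight p (A.map (X.subHom (Y m)).f) = coheight p A + coheight p (Y m) :=
    coheight_map_subtype hY hAf
  have e2 := codeg_map_subtype hY hAf
  have e3 := h.slopeFun_eq m
  rw [rkT_sub hY, Nat.cast_one, one_mul] at hpos
  have h1 : X.slopeFun μ (A.map (X.subHom (Y m)).f) ≤ (m + 1 : ℕ) * X.slopeConst μ := by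
    simp only [slopeFun, slopeConst] at hAν e3 ⊢
    rw [rkT_sub hY, rkω_sub hY] at hAν
    rw [e1, e2]
    push_cast
    nlinarith
  have hle : ppow p 1 (Y m) ≤ A.map (X.subHom (Y m)).f := by
    have := Submodule.map_mono (f := (X.subHom (Y m)).f) hA.le
    rw [map_ppow] at this
    have e4 : (⊤ : Submodule ℤ_[p] (X.sub (Y m)).T).map (X.subHom (Y m)).f = Y m :=
      Submodule.map_subtype_top (Y m)
    rwa [e4] at this
  have h2 := (h.le_of_slopeFun_le (m + 1) _
    ((by rw [add_comm, ← ppow_ppow]; exact ppow_mono (h.ppow_le m) :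
      ppow p (m + 1) ⊤ ≤ ppow p 1 (Y m)).trans hle) h1).trans (hm 1)
  rw [hD, bot_sup_eq] at h2
  refine hA.not_ge fun a ha => ?_
  obtain ⟨y, hy, hya⟩ := h2 (Submodule.mem_map_of_mem ha)
  exact ⟨⟨y, hy⟩, trivial, Subtype.ext hya⟩

theorem exists_le : ∃ m, ∀ k, Y (m + k) ≤ (⨅ k, Y k) ⊔ ppow p k (Y m) :=
  exists_filtration_le h.succ_le h.smul_mem

end IsFirstSteps

end Step

end Triple

/-! ### Heights, degrees and the slope of the divisible part D. -/

section Height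

variable {p : ℕ} [hp : Fact p.Prime] {T : Type u} [AddCommGroup T] [Module ℤ_[p] T]

theorem isSaturated_saturation (A : Submodule ℤ_[p] T) :
    IsSaturated p (saturation (p : ℤ_[p]) A) := by
  rintro k t ⟨n, hn⟩
  exact ⟨n + k, by rwa [pow_add, mul_smul]⟩

variable [Module.Free ℤ_[p] T] [Module.Finite ℤ_[p] T]

theorem IsSaturated.free_quotient {E : Submodule ℤ_[p] T} (hE : IsSaturated p E) :
    Module.Free ℤ_[p] (T ⧸ E) := by
  have : Module.IsTorsionFree ℤ_[p] (T ⧸ E) := by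
    refine Module.IsTorsionFree.of_smul_eq_zero fun a x hax => ?_
    obtain ⟨t, rfl⟩ := Submodule.mkQ_surjective _ x
    by_contra! hne
    rw [Submodule.mkQ_apply, ← Submodule.Quotient.mk_smul, Submodule.Quotient.mk_eq_zero] at hax
    exact hne.2 ((Submodule.Quotient.mk_eq_zero _).2
      (Triple.isSaturated_smul_mem hE hne.1 hax))
  infer_instance

theorem index_comap_of_surjective {T' : Type*} [AddCommGroup T'] [Module ℤ_[p] T']
    {f : T →ₗ[ℤ_[p]] T'} (hf : Function.Surjective f) (N : Submodule ℤ_[p] T') :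
    (N.comap f).toAddSubgroup.index = N.toAddSubgroup.index :=
  AddSubgroup.index_comap_of_surjective (f := f.toAddMonoidHom) N.toAddSubgroup hf

theorem coheight_sup_ppow {E : Submodule ℤ_[p] T} (hE : IsSaturated p E) (k : ℕ) :
    coheight p (E ⊔ ppow p k ⊤) =
      k * ((Module.finrank ℤ_[p] T : ℝ) - Module.finrank ℤ_[p] E) := by
  have := hE.free_quotient
  have h1 : (ppow p k (⊤ : Submodule ℤ_[p] (T ⧸ E))).comap E.mkQ = E ⊔ ppow p k ⊤ := by
    rw [← Submodule.comap_map_mkQ, map_ppow, Submodule.map_top, Submodule.range_mkQ]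
  have h2 := index_comap_of_surjective (Submodule.mkQ_surjective E)
    (ppow p k (⊤ : Submodule ℤ_[p] (T ⧸ E)))
  rw [h1] at h2
  have h3 : coheight p (E ⊔ ppow p k ⊤) = coheight p (ppow p k (⊤ : Submodule ℤ_[p] (T ⧸ E))) := by
    rw [coheight, h2, coheight]
  rw [h3, coheight_ppow isFull_top, coheight_top, zero_add, ← E.finrank_quotient_add_finrank]
  push_cast
  ring

/-- Saturation gives E ∩ pT = pE ⊆ A, so (A + pT) ∩ E = A. -/
theorem coheight_map_subtype_sup {E : Submodule ℤ_[p] T} (hE : IsSaturated p E)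
    {A : Submodule ℤ_[p] E} (hA : ppow p 1 ⊤ ≤ A) :
    coheight p (A.map E.subtype ⊔ ppow p 1 ⊤) =
      coheight p A + ((Module.finrank ℤ_[p] T : ℝ) - Module.finrank ℤ_[p] E) := by
  have h0 := coheight_sup_ppow hE 1
  rw [Nat.cast_one, one_mul] at h0
  rw [← h0]
  have hle : A.map E.subtype ⊔ ppow p 1 ⊤ ≤ E ⊔ ppow p 1 ⊤ :=
    sup_le_sup_right (Submodule.map_subtype_le E A) _
  have h1 := AddSubgroup.relIndex_mul_index (Submodule.toAddSubgroup_mono hle)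
  have h2 : E ⊔ ppow p 1 ⊤ = (A.map E.subtype ⊔ ppow p 1 ⊤) ⊔ E := by
    rw [sup_right_comm, sup_eq_right.2 (Submodule.map_subtype_le E A)]
  have h3 : (A.map E.subtype ⊔ ppow p 1 ⊤).toAddSubgroup.relIndex (E ⊔ ppow p 1 ⊤).toAddSubgroup =
      A.toAddSubgroup.index := by
    rw [h2, Submodule.sup_toAddSubgroup _ E, AddSubgroup.relIndex_sup_left]
    show ((A.map E.subtype ⊔ ppow p 1 ⊤).comap E.subtype).toAddSubgroup.index = _
    congr 2
    refine le_antisymm ?_ fun a ha => Submodule.mem_sup_left (Submodule.mem_map_of_mem ha)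
    intro e he
    obtain ⟨_, ⟨a, ha, rfl⟩, _, ⟨t, -, rfl⟩, h⟩ := Submodule.mem_sup.1 (Submodule.mem_comap.1 he)
    have ht : (p : ℤ_[p]) ^ 1 • t ∈ E := by
      have : (LinearMap.lsmul ℤ_[p] T ((p : ℤ_[p]) ^ 1)) t = (e - a : E) := by
        rw [Submodule.coe_sub]
        exact eq_sub_of_add_eq' h
      rw [LinearMap.lsmul_apply] at this
      rw [this]
      exact (e - a).2
    have h4 : e = a + (p : ℤ_[p]) ^ 1 • (⟨t, hE 1 t ht⟩ : E) := Subtype.ext h.symm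
    rw [h4]
    exact A.add_mem ha (hA (smul_mem_ppow trivial))
  have hA0 : IsFull p A := ⟨1, hA⟩
  have hf : IsFull p (E ⊔ ppow p 1 ⊤) := (isFull_ppow_top 1).mono le_sup_right
  rw [h3] at h1
  rw [coheight, ← h1, Nat.cast_mul, Real.logb_mul (by exact_mod_cast hA0.index_ne_zero)
    (by exact_mod_cast hf.index_ne_zero)]
  rfl

end Height

namespace Triple

variable {p : ℕ} [hp : Fact p.Prime] {C : Type w} [NormedField C] [IsUltrametricDist C]
  [NormedAlgebra ℚ_[p] C] {X : Triple.{u, v, w} p C} [hX : Fact X.IsIntegral]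

theorem finite_spanImage (E : Submodule ℤ_[p] X.T) : Module.Finite (OC C) (X.spanImage E) :=
  Module.Finite.iff_fg.2 (X.spanImage_fg E)

/-- Choose a basis of the lattice inside α(E) ∪ p^k α(T). At most rk 𝒪α(E) of its vectors come from
α(E), and each of the others puts a factor p^k into the determinant. -/
theorem le_codeg_sup_ppow (E : Submodule ℤ_[p] X.T) (k : ℕ) :
    k * ((X.rkω : ℝ) - (X.sub E).rkω) ≤ X.codeg (E ⊔ ppow p k ⊤) := by
  classical
  let b := Module.finBasis (OC C) X.ω
  let f : E ⊕ X.T → X.ω := Sum.elim (fun e => X.α e) (fun t => (p : OC C) ^ k • X.α t)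
  have hf : Submodule.span (OC C) (Set.range f) = X.spanImage (E ⊔ ppow p k ⊤) := by
    rw [Set.Sum.elim_range, Submodule.span_union, spanImage_sup]
    congr 1
    · rw [spanImage]
      congr 1
      ext; simp
    · rw [spanImage]
      congr 1
      ext y
      constructor
      · rintro ⟨t, rfl⟩
        exact ⟨_, smul_mem_ppow trivial, X.α_pow_smul k t⟩
      · rintro ⟨_, ⟨t, -, rfl⟩, rfl⟩
        exact ⟨t, (X.α_pow_smul k t).symm⟩
  obtain ⟨a, hli, h0, ha⟩ := X.exists_codeg_eq_of_span
    ((isFull_ppow_top k).mono (le_sup_right : _ ≤ E ⊔ ppow p k ⊤)) b f hf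
  let J : Finset (Fin X.rkω) := Finset.univ.filter fun i => (a i).isLeft
  have hJ : J.card ≤ (X.sub E).rkω := by
    have := finite_spanImage E
    have hmem : ∀ i : J, f (a i) ∈ X.spanImage E := by
      rintro ⟨i, hi⟩
      obtain ⟨e, he⟩ := Sum.isLeft_iff.1 (Finset.mem_filter.1 hi).2
      simp only [he, f, Sum.elim_inl]
      exact X.mem_spanImage e.2
    have hli' : LinearIndependent (OC C) (fun i : J => (⟨f (a i), hmem i⟩ : X.spanImage E)) := by
      apply LinearIndependent.of_comp (X.spanImage E).subtype
      exact hli.comp (fun i : J => (i : Fin X.rkω)) Subtype.val_injective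
    have h := hli'.fintype_card_le_finrank
    rwa [Fintype.card_coe] at h
  let s : Fin X.rkω → OC C := fun i => if i ∈ J then 1 else (p : OC C) ^ k
  let v : Fin X.rkω → X.ω := fun i => Sum.elim (fun e : E => X.α e) X.α (a i)
  have hfs : (fun i => f (a i)) = fun i => s i • v i := by
    ext i
    rcases h : a i with e | t
    · simp [f, s, v, J, h]
    · simp [f, s, v, J, h]
  have hs : ∏ i, s i = (p : OC C) ^ (k * (X.rkω - J.card)) := by
    rw [Finset.prod_ite, Finset.prod_const_one, one_mul, Finset.prod_const, ← pow_mul]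
    congr 2
    rw [Finset.filter_not, Finset.filter_mem_eq_inter, Finset.univ_inter,
      ← Finset.compl_eq_univ_sdiff, Finset.card_compl, Fintype.card_fin]
  have hle : J.card ≤ X.rkω := by simpa using Finset.card_le_univ J
  rw [hfs, AlternatingMap.map_smul_univ, hs] at ha h0
  rw [smul_eq_mul] at ha h0
  have h1 : Real.logb p ‖(((p : OC C) ^ (k * (X.rkω - J.card)) * b.det v : OC C) : C)‖ ≤
      Real.logb p ‖(((p : OC C) ^ (k * (X.rkω - J.card)) : OC C) : C)‖ := by
    refine Real.logb_le_logb_of_le (one_lt_prime_cast p) (norm_coe_pos h0) ?_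
    rw [MulMemClass.coe_mul, norm_mul]
    exact mul_le_of_le_one_right (norm_nonneg _) (norm_OC_le_one _)
  rw [logb_norm_prime_pow] at h1
  have h2 : (k * (X.rkω - J.card) : ℝ) ≤ X.codeg (E ⊔ ppow p k ⊤) := by
    rw [ha]
    push_cast [Nat.cast_sub hle] at h1 ⊢
    linarith
  refine le_trans (mul_le_mul_of_nonneg_left ?_ (Nat.cast_nonneg k)) h2
  have : (J.card : ℝ) ≤ (X.sub E).rkω := by exact_mod_cast hJ
  linarith

section Saturated

variable {D : Submodule ℤ_[p] X.T} (hD : IsSaturated p D)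
include hD

theorem free_quotient_satImage : Module.Free (OC C) (X.ω ⧸ X.satImage D) :=
  (X.satQuot_isIntegral hD).free_ω

/-- Kernel of a surjection from a finite module onto a finitely presented one; 𝒪_C need not be
Noetherian. -/
theorem satImage_fg : (X.satImage D).FG := by
  have := free_quotient_satImage hD
  have h2 : Module.Finite (OC C) (X.ω ⧸ X.satImage D) := (X.satQuot_isIntegral hD).finite_ω
  have : Module.FinitePresentation (OC C) (X.ω ⧸ X.satImage D) :=
    Module.finitePresentation_of_projective _ _
  have := Module.FinitePresentation.fg_ker (X.satImage D).mkQ (Submodule.mkQ_surjective _)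
  rwa [Submodule.ker_mkQ] at this

theorem exists_pow_smul_mem_spanImage :
    ∃ k : ℕ, ∀ x ∈ X.satImage D, (p : OC C) ^ k • x ∈ X.spanImage D :=
  exists_pow_smul_mem_of_fg (satImage_fg hD)

theorem finrank_satImage : Module.finrank (OC C) (X.satImage D) = (X.sub D).rkω := by
  have h1 := finite_spanImage D
  have h2 := Module.Finite.iff_fg.2 (satImage_fg hD)
  obtain ⟨k, hk⟩ := exists_pow_smul_mem_spanImage hD
  exact le_antisymm (finrank_le_of_pow_smul_mem prime_cast_ne_zero k hk)
    (Submodule.finrank_mono (X.spanImage_le_satImage D))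

/-- Converse of `le_codeg_sup_ppow` up to a constant, which measures how far 𝒪α(D) is from its
saturation. The test vectors are p^j times a basis of the saturation and p^k times lifts of a basis
of the quotient. -/
theorem exists_codeg_sup_ppow_le : ∃ K : ℝ, ∀ k : ℕ,
    X.codeg (D ⊔ ppow p k ⊤) ≤ k * ((X.rkω : ℝ) - (X.sub D).rkω) + K := by
  classical
  obtain ⟨j, hj⟩ := exists_pow_smul_mem_spanImage hD
  have h1 := free_of_fg (satImage_fg hD)
  have h2 := Module.Finite.iff_fg.2 (satImage_fg hD)
  have h3 := free_quotient_satImage hD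
  have h4 : Module.Finite (OC C) (X.ω ⧸ X.satImage D) := (X.satQuot_isIntegral hD).finite_ω
  let bW := Module.finBasis (OC C) (X.satImage D)
  let bQ := Module.finBasis (OC C) (X.ω ⧸ X.satImage D)
  let b := bW.sumQuot bQ
  let e := Fintype.equivFin (Fin (Module.finrank (OC C) (X.satImage D)) ⊕
    Fin (Module.finrank (OC C) (X.ω ⧸ X.satImage D)))
  have hsum := (X.satImage D).finrank_quotient_add_finrank
  have hle := finrank_satImage hD
  refine ⟨j * (X.sub D).rkω, fun k => ?_⟩
  let s : Fin (Module.finrank (OC C) (X.satImage D)) ⊕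
    Fin (Module.finrank (OC C) (X.ω ⧸ X.satImage D)) → OC C :=
      Sum.elim (fun _ => (p : OC C) ^ j) (fun _ => (p : OC C) ^ k)
  have hdet : (b.reindex e).det (fun i => s (e.symm i) • b (e.symm i)) =
      (p : OC C) ^ (j * (X.sub D).rkω + k * (X.rkω - (X.sub D).rkω)) := by
    rw [AlternatingMap.map_smul_univ]
    have : (fun i => b (e.symm i)) = b.reindex e := by ext; simp
    rw [this, Module.Basis.det_self, smul_eq_mul, mul_one,
      Equiv.prod_comp e.symm s, Fintype.prod_sum_type]
    simp only [s, Sum.elim_inl, Sum.elim_inr, Finset.prod_const, Finset.card_univ,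
      Fintype.card_fin, ← pow_mul, ← pow_add]
    rw [← hle, Nat.eq_sub_of_add_eq hsum]
  have hfull : IsFull p (D ⊔ ppow p k ⊤) := (isFull_ppow_top k).mono le_sup_right
  have := codegree_le_of_mem (X.isLattice_spanImage hfull) (b.reindex e)
    (fun i => s (e.symm i) • b (e.symm i)) (by
      intro i
      rw [spanImage_sup]
      rcases e.symm i with l | l
      · refine Submodule.mem_sup_left ?_
        simp only [s, b, Sum.elim_inl, Module.Basis.sumQuot_inl]
        exact hj _ (bW l).2
      · refine Submodule.mem_sup_right ?_
        rw [spanImage_ppow, hX.out.span_eq_top]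
        exact Submodule.mem_map_of_mem trivial) (by
      rw [hdet]
      exact pow_ne_zero _ prime_cast_ne_zero)
  rw [hdet, logb_norm_prime_pow, neg_neg] at this
  refine this.trans ?_
  have hle' : (X.sub D).rkω ≤ X.rkω := by
    rw [← hle, rkω]
    omega
  push_cast [Nat.cast_sub hle']
  linarith

/-- For D ≠ 0 this bounds the slope of D by μ: test the maximality of μ on D + pT. -/
theorem IsMaxSlope.mul_rkT_le {μ : ℝ} (hμ : X.IsMaxSlope μ) :
    (1 - μ) * (X.sub D).rkT ≤ (X.sub D).rkω := by
  have h1 := hμ.isSlopeFunction.le (k := 1) (le_sup_right : _ ≤ D ⊔ ppow p 1 ⊤)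
  have h2 := le_codeg_sup_ppow D 1
  simp only [slopeFun, slopeConst] at h1
  rw [coheight_sup_ppow hD] at h1
  have h3 : Module.finrank ℤ_[p] D = (X.sub D).rkT := rfl
  rw [h3] at h1
  push_cast at *
  linarith

theorem IsFirstSteps.le_iInf_of_rkω_le {μ : ℝ} {Y : ℕ → Submodule ℤ_[p] X.T} (h : IsFirstSteps μ Y)
    (hle : ((X.sub D).rkω : ℝ) ≤ (1 - μ) * (X.sub D).rkT) : D ≤ ⨅ k, Y k := by
  refine le_iInf fun k => le_sup_left.trans (h.le_of_slopeFun_le k (D ⊔ ppow p k ⊤) le_sup_right ?_)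
  have h2 := le_codeg_sup_ppow D k
  simp only [slopeFun, slopeConst]
  rw [coheight_sup_ppow hD]
  have h3 : Module.finrank ℤ_[p] D = (X.sub D).rkT := rfl
  rw [h3]
  have h4 := mul_le_mul_of_nonneg_left hle (Nat.cast_nonneg (α := ℝ) k)
  linarith

end Saturated

namespace IsFirstSteps

variable {μ : ℝ} {Y : ℕ → Submodule ℤ_[p] X.T} (h : IsFirstSteps μ Y)
include h

/-- The slope of D is μ if D ≠ 0. From D + p^(m+k) T ⊆ `Y (m+k)` ⊆ D + p^k T and ψ(`Y (m+k)`) =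
(m+k)κ, the quantity k(rk 𝒪α(D) - (1 - μ) rk D) is bounded in k, hence not positive. Here 1 - μ ≥ 0
is used. -/
theorem rkω_eq : ((X.sub (⨅ k, Y k)).rkω : ℝ) = (1 - μ) * (X.sub (⨅ k, Y k)).rkT := by
  have hD := h.isSaturated
  refine le_antisymm ?_ (h.isMaxSlope.mul_rkT_le hD)
  obtain ⟨m, hm⟩ := h.exists_le
  obtain ⟨K, hK⟩ := exists_codeg_sup_ppow_le hD
  have h3 : Module.finrank ℤ_[p] ↥(⨅ k, Y k) = (X.sub (⨅ k, Y k)).rkT := rfl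
  by_contra! hlt
  obtain ⟨k, hk⟩ := exists_nat_gt (((1 - μ) * m * X.rkT + K) /
    ((X.sub (⨅ k, Y k)).rkω - (1 - μ) * (X.sub (⨅ k, Y k)).rkT))
  rw [div_lt_iff₀ (by linarith)] at hk
  have h1 := h.slopeFun_eq (m + k)
  have hc := X.codeg_le ((isFull_ppow_top (m + k)).mono le_sup_right)
    (sup_le (iInf_le _ _) (h.ppow_le (m + k)) : (⨅ k, Y k) ⊔ ppow p (m + k) ⊤ ≤ Y (m + k))
  have hh := coheight_le (h.isFull (m + k)) ((hm k).trans (sup_le_sup_left (ppow_mono le_top) _))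
  have hK' := hK (m + k)
  rw [coheight_sup_ppow hD, h3] at hh
  simp only [slopeFun, slopeConst] at h1
  have h5 := mul_le_mul_of_nonneg_left hh (sub_nonneg.2 h.isMaxSlope.le_one)
  have h6 : (0 : ℝ) ≤ m * (X.sub (⨅ k, Y k)).rkω := by positivity
  push_cast at *
  linarith

/-- The subobject A of D[p] and its image A + pT in X[p] have the same height, as D is saturated,
and 𝒪α(A)/p𝒪α(D) surjects onto 𝒪α(A + pT)/pω. So the slope in D[p] is at most that in X[p], which is
at most μ. -/
theorem codeg_sub_le {D : Submodule ℤ_[p] X.T} (hDY : D = ⨅ k, Y k)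
    {A : Submodule ℤ_[p] (X.sub D).T} (hA : ppow p 1 ⊤ ≤ A) :
    (X.sub D).codeg A ≤ (1 - μ) * coheight p A := by
  have hD := h.isSaturated
  have h2 := h.rkω_eq
  rw [← hDY] at hD h2
  let A' : Submodule ℤ_[p] X.T := A.map (X.subHom D).f ⊔ ppow p 1 ⊤
  have hA' : ppow p 1 ⊤ ≤ A' := le_sup_right
  have e1 : coheight p A' = coheight p A + ((X.rkT : ℝ) - (X.sub D).rkT) :=
    coheight_map_subtype_sup hD hA
  have h1 := h.isMaxSlope.le_slopeFun A' hA'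
  have e2 := X.codeg_eq_add (isFull_ppow_top 1) hA'
  have e3 := (X.sub D).codeg_eq_add (isFull_ppow_top 1) hA
  rw [codeg_ppow _ isFull_top, codeg_top] at e2 e3
  have hmem : ∀ x ∈ (X.sub D).spanImage A, (X.subHom D).g x ∈ X.spanImage A' := fun x hx =>
    X.spanImage_mono le_sup_left ((X.subHom D).map_spanImage A ▸ Submodule.mem_map_of_mem hx)
  have hle : degree p C (X.spanImage A' ⧸ (X.spanImage (ppow p 1 ⊤)).submoduleOf (X.spanImage A')) ≤
      degree p C ((X.sub D).spanImage A ⧸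
        ((X.sub D).spanImage (ppow p 1 ⊤)).submoduleOf ((X.sub D).spanImage A)) := by
    refine degree_le_of_surjective (Submodule.mapQ _ _ ((X.subHom D).g.restrict hmem) ?_) ?_
      (fittingIdeal_quotient_ne_bot ((X.sub D).isLattice_spanImage (isFull_ppow_top 1))
        ((X.sub D).isLattice_spanImage ⟨1, hA⟩) ((X.sub D).spanImage_mono hA))
    · intro x hx
      have h5 : (X.subHom D).g x ∈ X.spanImage ((ppow p 1 ⊤).map (X.subHom D).f) :=
        (X.subHom D).map_spanImage (ppow p 1 ⊤) ▸ Submodule.mem_map_of_mem hx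
      rw [map_ppow] at h5
      exact X.spanImage_mono (ppow_mono le_top) h5
    · intro y
      obtain ⟨⟨y, hy⟩, rfl⟩ := Submodule.mkQ_surjective _ y
      have hy' := hy
      rw [spanImage_sup, ← Hom.map_spanImage] at hy'
      obtain ⟨_, ⟨x, hx, rfl⟩, z, hz, rfl⟩ := Submodule.mem_sup.1 hy'
      refine ⟨Submodule.Quotient.mk ⟨x, hx⟩, (Submodule.Quotient.eq _).2 ?_⟩
      show (X.subHom D).g x - ((X.subHom D).g x + z) ∈ X.spanImage (ppow p 1 ⊤)
      simpa using hz
  simp only [slopeFun, slopeConst] at h1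
  rw [e1] at h1
  push_cast at *
  linarith

end IsFirstSteps

end Triple

/-! ### Semi-stability in terms of the slope function. -/

namespace Triple

variable {p : ℕ} [hp : Fact p.Prime] {C : Type w} [NormedField C] [IsUltrametricDist C]
  [NormedAlgebra ℚ_[p] C] {X Z : Triple.{u, v, w} p C}

section Semistable

theorem torsionSlope_sub_top (h : X.spanImage ⊤ = ⊤) : (X.sub ⊤).torsionSlope = X.torsionSlope := by
  have h1 : (X.sub ⊤).torsionHeight = X.torsionHeight := by
    rw [torsionHeight, torsionHeight]
    congr 2
    exact Nat.card_congr (Submodule.topEquiv (R := ℤ_[p]) (M := X.T)).toEquiv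
  have h2 : degree p C (X.sub ⊤).ω = degree p C X.ω :=
    degree_congr ((LinearEquiv.ofEq _ _ h).trans (Submodule.topEquiv (R := OC C) (M := X.ω)))
  rw [torsionSlope, torsionSlope, torsionDegree, torsionDegree, h1, h2]

variable [hX : Fact X.IsIntegral]

theorem torsionSlope_torsion_one : (X.torsion 1).torsionSlope = X.slope := by
  have h1 : (X.torsion 1).spanImage ⊤ = ⊤ := by
    have h2 := (X.torsionHom 1).map_spanImage ⊤
    have h3 : LinearMap.range (X.torsionHom 1).f = ⊤ :=
      LinearMap.range_eq_top.2 (Submodule.mkQ_surjective _)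
    have h4 : LinearMap.range (X.torsionHom 1).g = ⊤ :=
      LinearMap.range_eq_top.2 (Submodule.mkQ_surjective _)
    rw [hX.out.span_eq_top, Submodule.map_top, Submodule.map_top, h3, h4] at h2
    exact h2.symm
  have h5 : X.torsionSub 1 ⊤ = ⊤ := by
    rw [torsionSub, Submodule.map_top]
    exact LinearMap.range_eq_top.2 (Submodule.mkQ_surjective _)
  rw [← torsionSlope_sub_top h1, ← h5, torsionSlope_torsionSub X le_top, coheight_top, codeg_top,
    slope]
  simp

theorem slopeConst_slope [Nontrivial X.T] : X.slopeConst X.slope = 0 := by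
  have : (0 : ℝ) < X.rkT := by exact_mod_cast Module.finrank_pos
  rw [slopeConst, slope]
  field_simp
  ring

/-- For μ the slope of X itself, `slopeConst` vanishes. -/
theorem semistable_iff : X.Semistable ↔ Nontrivial X.T ∧
    ∀ A : Submodule ℤ_[p] X.T, ppow p 1 ⊤ ≤ A → 0 ≤ X.slopeFun X.slope A := by
  constructor
  · rintro ⟨h0, h⟩
    have h1 : Nontrivial X.T :=
      Function.Surjective.nontrivial (f := (X.torsionHom 1).f) (Submodule.mkQ_surjective _)
    refine ⟨h1, fun A hA => ?_⟩
    rcases hA.eq_or_lt with rfl | hA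
    · have := slopeConst_slope (X := X)
      rw [slopeConst] at this
      rw [slopeFun, X.coheight_ppow_top, codeg_ppow X isFull_top, codeg_top]
      push_cast
      linarith
    · have h2 := h (X.torsionSub 1 A) fun h => hA.not_ge (torsionSub_eq_bot_iff.1 h)
      rw [torsionSlope_torsion_one, torsionSlope_torsionSub_eq X.slope hA, slopeConst_slope,
        mul_zero, zero_sub, add_le_iff_nonpos_right, neg_div, neg_nonpos] at h2
      simpa using (le_div_iff₀ (coheight_lt_of_lt hA)).1 h2
  · rintro ⟨h0, h⟩
    refine ⟨?_, fun N hN => ?_⟩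
    · obtain ⟨t, -, ht⟩ := SetLike.exists_of_lt (ppow_one_top_lt (X := X))
      exact ⟨(X.torsionHom 1).f t, 0, fun h => ht (torsionHom_eq_zero_iff.1 h)⟩
    · obtain ⟨A, hA, rfl⟩ := exists_eq_torsionSub 1 N
      have hA' : ppow p 1 ⊤ < A := lt_of_le_of_ne hA fun h => hN (torsionSub_eq_bot_iff.2 h.ge)
      rw [torsionSlope_torsion_one, torsionSlope_torsionSub_eq X.slope hA', slopeConst_slope,
        mul_zero, zero_sub, add_le_iff_nonpos_right, neg_div, neg_nonpos]
      exact div_nonneg (h A hA) (coheight_lt_of_lt hA').le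

theorem IsFirstSteps.semistable {μ : ℝ} {Y : ℕ → Submodule ℤ_[p] X.T} (h : IsFirstSteps μ Y)
    {D : Submodule ℤ_[p] X.T} (hDY : D = ⨅ k, Y k) (hD : D ≠ ⊥) :
    (X.sub D).slope = μ ∧ (X.sub D).Semistable := by
  have h0 : Nontrivial (X.sub D).T := Submodule.nontrivial_iff_ne_bot.2 hD
  have hpos : (0 : ℝ) < (X.sub D).rkT := by exact_mod_cast Module.finrank_pos
  have h1 := h.rkω_eq
  rw [← hDY] at h1
  have h2 : (X.sub D).slope = μ := by
    rw [slope, div_eq_iff hpos.ne', h1]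
    ring
  refine ⟨h2, semistable_iff.2 ⟨h0, fun A hA => ?_⟩⟩
  rw [h2, slopeFun]
  linarith [h.codeg_sub_le hDY hA]

end Semistable

/-! ### Isomorphisms and subquotients. -/

section Iso

/-- An isomorphism of triples. -/
def Hom.IsIso (φ : Hom X Z) : Prop := Function.Bijective φ.f ∧ Function.Bijective φ.g

theorem Hom.IsIso.exists_symm {φ : Hom X Z} (hφ : φ.IsIso) : ∃ ψ : Hom Z X, ψ.IsIso := by
  let e := LinearEquiv.ofBijective φ.f hφ.1
  let e' := LinearEquiv.ofBijective φ.g hφ.2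
  refine ⟨⟨e.symm.toLinearMap, e'.symm.toLinearMap, fun t => ?_⟩, e.symm.bijective, e'.symm.bijective⟩
  obtain ⟨t, rfl⟩ := e.surjective t
  have h1 : Z.α (e t) = e' (X.α t) := (φ.comm t).symm
  rw [h1]
  simp

theorem Hom.IsIso.isIntegral {φ : Hom X Z} (hφ : φ.IsIso) (hX : X.IsIntegral) :
    Z.IsIntegral := by
  let e := LinearEquiv.ofBijective φ.f hφ.1
  let e' := LinearEquiv.ofBijective φ.g hφ.2
  have := hX.free_T
  have := hX.finite_T
  have := hX.free_ω
  have := hX.finite_ω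
  refine ⟨Module.Free.of_equiv e, Module.Finite.equiv e, Module.Free.of_equiv e',
    Module.Finite.equiv e', ?_⟩
  have := φ.map_spanImage ⊤
  rw [hX.span_eq_top, Submodule.map_top, Submodule.map_top, LinearMap.range_eq_top.2 hφ.1.2,
    LinearMap.range_eq_top.2 hφ.2.2] at this
  exact this.symm

theorem Hom.IsIso.slope_eq {φ : Hom X Z} (hφ : φ.IsIso) : Z.slope = X.slope := by
  rw [slope, slope, (LinearEquiv.ofBijective φ.f hφ.1).finrank_eq,
    (LinearEquiv.ofBijective φ.g hφ.2).finrank_eq]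

theorem Hom.IsIso.semistable [hX : Fact X.IsIntegral] {φ : Hom X Z} (hφ : φ.IsIso)
    (h : X.Semistable) : Z.Semistable := by
  have := Fact.mk (hφ.isIntegral hX.out)
  rw [semistable_iff] at h ⊢
  have h0 := h.1
  refine ⟨hφ.1.1.nontrivial, fun A hA => ?_⟩
  obtain ⟨A, rfl⟩ : ∃ B : Submodule ℤ_[p] X.T, A = B.map φ.f :=
    ⟨A.comap φ.f, (Submodule.map_comap_eq_of_surjective hφ.1.2 A).symm⟩
  have h1 : ppow p 1 ⊤ ≤ A := by
    rw [← Submodule.map_le_map_iff_of_injective hφ.1.1, map_ppow, Submodule.map_top,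
      LinearMap.range_eq_top.2 hφ.1.2]
    exact hA
  have h2 : coheight p (A.map φ.f) = coheight p A := by
    have := index_comap_of_surjective hφ.1.2 (A.map φ.f)
    rw [Submodule.comap_map_eq_of_injective hφ.1.1] at this
    rw [coheight, coheight, this]
  have h3 : Z.codeg (A.map φ.f) = X.codeg A := by
    rw [codeg, codeg, ← φ.map_spanImage]
    exact (degree_congr (Submodule.Quotient.equiv _ _ (LinearEquiv.ofBijective φ.g hφ.2) rfl)).symm
  rw [slopeFun, h2, h3, hφ.slope_eq]
  exact h.2 A h1

theorem map_submoduleOf {A B : Submodule ℤ_[p] X.T} (h : A ≤ B) :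
    (A.submoduleOf B).map (X.subHom B).f = A :=
  Submodule.map_comap_eq_of_le (h.trans (Submodule.range_subtype B).ge)

theorem mem_spanImage_submoduleOf {A B : Submodule ℤ_[p] X.T} (h : A ≤ B)
    {x : (X.sub B).ω} : x ∈ (X.sub B).spanImage (A.submoduleOf B) ↔
      (X.subHom B).g x ∈ X.spanImage A := by
  have h2 := submoduleOf_spanImage_map_subtype B (A.submoduleOf B)
  rw [map_submoduleOf h] at h2
  rw [← h2]
  rfl

/-- The morphism induced on subquotients. -/
def Hom.subquot (φ : Hom X Z) {A B : Submodule ℤ_[p] X.T} (h : A ≤ B) :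
    Hom (X.subquot A B) (Z.subquot (A.map φ.f) (B.map φ.f)) where
  f := Submodule.mapQ _ _ (φ.restrict B).f fun t ht => by
    show φ.f ((X.subHom B).f t) ∈ A.map φ.f
    exact Submodule.mem_map_of_mem ht
  g := Submodule.mapQ _ _ (φ.restrict B).g fun x hx => by
    rw [Submodule.mem_comap, mem_spanImage_submoduleOf (Submodule.map_mono h)]
    rw [mem_spanImage_submoduleOf h] at hx
    exact φ.map_spanImage A ▸ Submodule.mem_map_of_mem (f := φ.g) hx
  comm t := by
    obtain ⟨t, rfl⟩ := Submodule.mkQ_surjective _ t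
    exact congrArg (Submodule.mkQ _) ((φ.restrict B).comm t)

/-- Injectivity of `φ` is not required, since this is applied to the projection modulo D. -/
theorem Hom.subquot_isIso (φ : Hom X Z) {A B : Submodule ℤ_[p] X.T} (h : A ≤ B)
    (hf : ∀ t ∈ B, φ.f t ∈ A.map φ.f → t ∈ A)
    (hg : ∀ x ∈ X.spanImage B, φ.g x ∈ Z.spanImage (A.map φ.f) → x ∈ X.spanImage A) :
    (φ.subquot h).IsIso := by
  refine ⟨⟨?_, ?_⟩, ⟨?_, ?_⟩⟩
  · rw [injective_iff_map_eq_zero]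
    intro t ht
    obtain ⟨t, rfl⟩ := Submodule.mkQ_surjective _ t
    exact (Submodule.Quotient.mk_eq_zero _).2 (hf _ t.2
      ((Submodule.Quotient.mk_eq_zero ((A.map φ.f).submoduleOf (B.map φ.f))).1 ht))
  · intro s
    obtain ⟨s, rfl⟩ := Submodule.mkQ_surjective _ s
    obtain ⟨t, rfl⟩ := φ.restrict_f_surjective B s
    exact ⟨Submodule.Quotient.mk t, rfl⟩
  · rw [injective_iff_map_eq_zero]
    intro x hx
    obtain ⟨x, rfl⟩ := Submodule.mkQ_surjective _ x
    refine (Submodule.Quotient.mk_eq_zero _).2 ((mem_spanImage_submoduleOf h).2 (hg _ x.2 ?_))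
    exact (mem_spanImage_submoduleOf (Submodule.map_mono h)).1
      ((Submodule.Quotient.mk_eq_zero _).1 hx)
  · intro y
    obtain ⟨y, rfl⟩ := Submodule.mkQ_surjective _ y
    obtain ⟨x, rfl⟩ := φ.restrict_g_surjective B y
    exact ⟨Submodule.Quotient.mk x, rfl⟩

theorem Hom.subquot_isIso_of_injective (φ : Hom X Z) {A B : Submodule ℤ_[p] X.T} (h : A ≤ B)
    (hf : Function.Injective φ.f) (hg : Function.Injective φ.g) : (φ.subquot h).IsIso := by
  refine φ.subquot_isIso h ?_ ?_
  · rintro t - ⟨a, ha, hat⟩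
    exact hf hat ▸ ha
  · intro x _ hx
    rw [← φ.map_spanImage] at hx
    obtain ⟨a, ha, hax⟩ := hx
    exact hg hax ▸ ha

theorem exists_isIso_sub_subquot_bot (B : Submodule ℤ_[p] X.T) :
    ∃ φ : Hom (X.sub B) (X.subquot ⊥ B), φ.IsIso := by
  refine ⟨quotHom _ _ _ _, ⟨?_, Submodule.mkQ_surjective _⟩, ⟨?_, Submodule.mkQ_surjective _⟩⟩
  · rw [injective_iff_map_eq_zero]
    intro t ht
    exact Subtype.ext ((Submodule.mem_bot ℤ_[p]).1 ((Submodule.Quotient.mk_eq_zero ((⊥ : Submodule ℤ_[p] X.T).submoduleOf B)).1 ht))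
  · rw [injective_iff_map_eq_zero]
    intro x hx
    have h1 := (mem_spanImage_submoduleOf bot_le).1 ((Submodule.Quotient.mk_eq_zero _).1 hx)
    rw [spanImage_bot, Submodule.mem_bot] at h1
    exact Subtype.ext h1

end Iso

/-! ### Harder-Narasimhan chains of a subobject, seen inside X. -/

section Chain

/-- `F` is a chain `0 = F_0 ⊊ ... ⊊ F_r = B` whose graded pieces are semi-stable integral
Hodge-Tate modules with strictly decreasing slopes. -/
structure IsHNChain (X : Triple.{u, v, w} p C) {r : ℕ} (F : Fin (r + 1) → Submodule ℤ_[p] X.T)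
    (B : Submodule ℤ_[p] X.T) : Prop where
  zero : F 0 = ⊥
  last : F (Fin.last r) = B
  strictMono : StrictMono F
  isIntegral : ∀ i : Fin r, (X.subquot (F i.castSucc) (F i.succ)).IsIntegral
  semistable : ∀ i : Fin r, (X.subquot (F i.castSucc) (F i.succ)).Semistable
  strictAnti : StrictAnti fun i : Fin r => (X.subquot (F i.castSucc) (F i.succ)).slope

theorem IsHNChain.le {r : ℕ} {F : Fin (r + 1) → Submodule ℤ_[p] X.T} {B : Submodule ℤ_[p] X.T}
    (h : X.IsHNChain F B) (i : Fin (r + 1)) : F i ≤ B :=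
  h.last ▸ h.strictMono.monotone (Fin.le_last i)

theorem IsHNChain.le_succ {r : ℕ} {F : Fin (r + 1) → Submodule ℤ_[p] X.T}
    {B : Submodule ℤ_[p] X.T} (h : X.IsHNChain F B) (i : Fin r) : F i.castSucc ≤ F i.succ :=
  h.strictMono.monotone (Fin.castSucc_lt_succ).le

theorem IsHNChain.map {r : ℕ} {F : Fin (r + 1) → Submodule ℤ_[p] X.T} {B : Submodule ℤ_[p] X.T}
    (h : X.IsHNChain F B) (φ : Hom X Z) (hf : Function.Injective φ.f)
    (hg : Function.Injective φ.g) : Z.IsHNChain (fun i => (F i).map φ.f) (B.map φ.f) := by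
  have hiso := fun i => φ.subquot_isIso_of_injective (h.le_succ i) hf hg
  refine ⟨by rw [h.zero, Submodule.map_bot], by rw [h.last], ?_, ?_, ?_, ?_⟩
  · exact (Submodule.map_strictMono_of_injective hf).comp h.strictMono
  · exact fun i => (hiso i).isIntegral (h.isIntegral i)
  · intro i
    have := Fact.mk (h.isIntegral i)
    exact (hiso i).semistable (h.semistable i)
  · intro i j hij
    simp only [(hiso _).slope_eq]
    exact h.strictAnti hij

theorem IsHNChain.isHNType_sub {r : ℕ} {F : Fin (r + 1) → Submodule ℤ_[p] X.T}
    {B : Submodule ℤ_[p] X.T} (h : X.IsHNChain F B) : (X.sub B).IsHNType := by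
  have hmap : ∀ i, ((F i).submoduleOf B).map (X.subHom B).f = F i := fun i =>
    map_submoduleOf (h.le i)
  have hmono : ∀ i : Fin r, (F i.castSucc).submoduleOf B ≤ (F i.succ).submoduleOf B :=
    fun i => Submodule.comap_mono (h.le_succ i)
  have hiso : ∀ i : Fin r, ∃ φ : Hom (X.subquot (F i.castSucc) (F i.succ))
      ((X.sub B).subquot ((F i.castSucc).submoduleOf B) ((F i.succ).submoduleOf B)), φ.IsIso := by
    intro i
    have h1 := (X.subHom B).subquot_isIso_of_injective (hmono i) Subtype.val_injective
      Subtype.val_injective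
    have h2 := h1.exists_symm
    rwa [hmap, hmap] at h2
  choose φ hφ using hiso
  refine ⟨r, fun i => (F i).submoduleOf B, ?_, ?_, ?_, fun i => ⟨?_, ?_⟩, ?_⟩
  · show (F 0).submoduleOf B = ⊥
    rw [h.zero]
    exact (Submodule.comap_bot _).trans (Submodule.ker_subtype _)
  · show (F (Fin.last r)).submoduleOf B = ⊤
    rw [h.last, Submodule.submoduleOf_self]
  · intro i j hij
    refine lt_of_le_of_ne (Submodule.comap_mono (h.strictMono hij).le) fun heq => ?_
    have := congrArg (Submodule.map (X.subHom B).f) heq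
    rw [hmap, hmap] at this
    exact (h.strictMono hij).ne this
  · exact (hφ i).isIntegral (h.isIntegral i)
  · have := Fact.mk (h.isIntegral i)
    exact (hφ i).semistable (h.semistable i)
  · intro i j hij
    simp only [(hφ _).slope_eq]
    exact h.strictAnti hij

end Chain

end Triple

theorem finrank_range_add_finrank_ker {R M N : Type*} [CommRing R] [IsDomain R] [AddCommGroup M]
    [AddCommGroup N] [Module R M] [Module R N] [Module.Finite R M] (f : M →ₗ[R] N) :
    Module.finrank R (LinearMap.range f) + Module.finrank R (LinearMap.ker f) =
      Module.finrank R M := by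
  rw [← f.quotKerEquivRange.finrank_eq, Submodule.finrank_quotient_add_finrank]

/-! ### Lifting chains from X/D, and the induction. -/

namespace Triple

variable {p : ℕ} [hp : Fact p.Prime] {C : Type w} [NormedField C] [IsUltrametricDist C]
  [NormedAlgebra ℚ_[p] C] {X : Triple.{u, v, w} p C}

/-- Multiplication by `p^k`. -/
def smulHom (X : Triple.{u, v, w} p C) (k : ℕ) : Hom X X where
  f := LinearMap.lsmul ℤ_[p] X.T ((p : ℤ_[p]) ^ k)
  g := LinearMap.lsmul (OC C) X.ω ((p : OC C) ^ k)
  comm t := (X.α_pow_smul k t).symm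

/-- The first graded piece has the largest slope and is a subobject, so a bound for the slopes of
subobjects bounds those of all graded pieces. -/
theorem IsHNChain.exists_slope_le {r : ℕ} {F : Fin (r + 1) → Submodule ℤ_[p] X.T}
    {B : Submodule ℤ_[p] X.T} (h : X.IsHNChain F B) (i : Fin r) :
    ∃ E : Submodule ℤ_[p] X.T, E ≠ ⊥ ∧
      (X.subquot (F i.castSucc) (F i.succ)).slope ≤ (X.sub E).slope := by
  cases r with
  | zero => exact i.elim0
  | succ r =>
    have h0 : F (Fin.castSucc (0 : Fin (r + 1))) = ⊥ := h.zero
    refine ⟨F (Fin.succ 0), ?_, ?_⟩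
    · rw [← bot_lt_iff_ne_bot, ← h0]
      exact h.strictMono Fin.castSucc_lt_succ
    · obtain ⟨φ, hφ⟩ := exists_isIso_sub_subquot_bot (F (Fin.succ 0))
      have h1 := h.strictAnti.antitone (Fin.zero_le i)
      simp only [h0] at h1
      rwa [← hφ.slope_eq]

variable [hX : Fact X.IsIntegral]

theorem isogenous_sub {B : Submodule ℤ_[p] X.T} (hB : IsFull p B) : X.Isogenous (X.sub B) := by
  obtain ⟨k, hk⟩ := hB
  exact ⟨k, powHom k B hk hX.out.span_eq_top, X.subHom B, fun _ => rfl, fun _ => rfl,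
    fun _ => rfl, fun _ => rfl⟩

/-- Inside D + p^k T, the module 𝒪α(D) becomes saturated: if u + p^k v is in the saturation with u ∈
𝒪α(D), then so is v, and p^k v ∈ 𝒪α(D). -/
theorem mem_spanImage_of_mem_satImage {D : Submodule ℤ_[p] X.T} {k : ℕ}
    (hk : ∀ x ∈ X.satImage D, (p : OC C) ^ k • x ∈ X.spanImage D) {x : X.ω}
    (hx : x ∈ X.satImage D) (hx' : x ∈ X.spanImage (D ⊔ ppow p k ⊤)) : x ∈ X.spanImage D := by
  rw [spanImage_sup, spanImage_ppow] at hx'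
  obtain ⟨u, hu, _, ⟨v, -, rfl⟩, rfl⟩ := Submodule.mem_sup.1 hx'
  refine Submodule.add_mem _ hu (hk v ?_)
  have h1 := (X.satImage D).sub_mem hx (X.spanImage_le_satImage D hu)
  rw [add_sub_cancel_left] at h1
  exact X.satImage_smul_mem (pow_ne_zero k prime_cast_ne_zero) h1

/-- The chain is 0 followed by the preimages `G i` of p^k `F' i`, with `G 0` = D. The factor p^k
puts them in D + p^k T, where the failure of 𝒪α(D) to be saturated in ω is invisible, so the graded
pieces are unchanged. -/
theorem exists_isHNChain_of_satQuot {D : Submodule ℤ_[p] X.T} (hD : IsSaturated p D)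
    (hD0 : D ≠ ⊥) (hss : (X.sub D).Semistable)
    (hslope : ∀ E : Submodule ℤ_[p] (X.satQuot D).T, E ≠ ⊥ →
      ((X.satQuot D).sub E).slope < (X.sub D).slope)
    {r : ℕ} {F' : Fin (r + 1) → Submodule ℤ_[p] (X.satQuot D).T}
    {B' : Submodule ℤ_[p] (X.satQuot D).T} (hB' : IsFull p B')
    (hF' : (X.satQuot D).IsHNChain F' B') :
    ∃ B, IsFull p B ∧ ∃ (r : ℕ) (F : Fin (r + 1) → Submodule ℤ_[p] X.T), X.IsHNChain F B := by
  have hQ := Fact.mk (X.satQuot_isIntegral hD)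
  obtain ⟨k, hk⟩ := exists_pow_smul_mem_spanImage hD
  let π := X.satQuotHom D
  have hπ : Function.Surjective π.f := X.satQuotHom_f_surjective D
  have hF : (X.satQuot D).IsHNChain (fun i => ppow p k (F' i)) (ppow p k B') :=
    hF'.map ((X.satQuot D).smulHom k) (smul_pow_injective k)
      (smul_right_injective _ (pow_ne_zero k prime_cast_ne_zero))
  let G : Fin (r + 1) → Submodule ℤ_[p] X.T := fun i => (ppow p k (F' i)).comap π.f
  have hGmap : ∀ i, (G i).map π.f = ppow p k (F' i) := fun i =>
    Submodule.map_comap_eq_of_surjective hπ _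
  have hDG : ∀ i, D ≤ G i := fun i t ht => by
    show π.f t ∈ ppow p k (F' i)
    rw [X.satQuotHom_f_eq_zero.2 ht]
    exact Submodule.zero_mem _
  have hGk : ∀ i, G i ≤ D ⊔ ppow p k ⊤ := by
    rintro i t ⟨s, -, hs⟩
    obtain ⟨y, rfl⟩ := hπ s
    have h1 : π.f (t - (p : ℤ_[p]) ^ k • y) = 0 := by
      rw [map_sub, map_smul, sub_eq_zero]
      exact hs.symm
    exact Submodule.mem_sup.2 ⟨_, X.satQuotHom_f_eq_zero.1 h1, _, smul_mem_ppow trivial,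
      sub_add_cancel _ _⟩
  have hG0 : G 0 = D := by
    ext t
    have : ppow p k (F' 0) = ⊥ := hF.zero
    show π.f t ∈ ppow p k (F' 0) ↔ _
    rw [this, Submodule.mem_bot, X.satQuotHom_f_eq_zero]
  have hGmono : StrictMono G := (Submodule.comap_strictMono_of_surjective hπ).comp hF.strictMono
  have hiso : ∀ i : Fin r, ∃ φ : Hom ((X.satQuot D).subquot (ppow p k (F' i.castSucc))
      (ppow p k (F' i.succ))) (X.subquot (G i.castSucc) (G i.succ)), φ.IsIso := by
    intro i
    have h1 : (π.subquot (hGmono.monotone (Fin.castSucc_lt_succ (i := i)).le)).IsIso := by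
      refine π.subquot_isIso _ ?_ ?_
      · intro t _ ht
        rwa [hGmap] at ht
      · intro x hx hx'
        rw [← π.map_spanImage] at hx'
        obtain ⟨y, hy, hyx⟩ := hx'
        have h2 : x - y ∈ X.satImage D := by
          rw [← X.satQuotHom_g_eq_zero, map_sub, sub_eq_zero]
          exact hyx.symm
        have h3 := mem_spanImage_of_mem_satImage hk h2 ((X.spanImage _).sub_mem
          (X.spanImage_mono (hGk _) hx) (X.spanImage_mono (hGk _) hy))
        simpa using Submodule.add_mem _ (X.spanImage_mono (hDG _) h3) hy
    have h2 := h1.exists_symm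
    rwa [hGmap, hGmap] at h2
  choose φ hφ using hiso
  obtain ⟨φ0, hφ0⟩ := exists_isIso_sub_subquot_bot D
  refine ⟨(ppow p k B').comap π.f, ?_, r + 1, Fin.cons ⊥ G, rfl, ?_, ?_, ?_, ?_, ?_⟩
  · obtain ⟨j, hj⟩ := hB'.ppow k
    refine ⟨j, ?_⟩
    rw [← Submodule.map_le_iff_le_comap, map_ppow]
    exact (ppow_mono le_top).trans hj
  · rw [← Fin.succ_last, Fin.cons_succ]
    show (ppow p k (F' (Fin.last r))).comap π.f = _
    rw [hF'.last]
  · intro i j hij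
    cases j using Fin.cases with
    | zero => exact absurd hij (Fin.not_lt_zero i)
    | succ j =>
      cases i using Fin.cases with
      | zero =>
        rw [Fin.cons_zero, Fin.cons_succ]
        exact (bot_lt_iff_ne_bot.2 hD0).trans_le (hDG j)
      | succ i =>
        rw [Fin.cons_succ, Fin.cons_succ]
        exact hGmono (Fin.succ_lt_succ_iff.1 hij)
  · intro i
    cases i using Fin.cases with
    | zero =>
      rw [Fin.castSucc_zero, Fin.cons_zero, Fin.cons_succ, hG0]
      exact hφ0.isIntegral (sub_isIntegral D).out
    | succ i =>
      rw [Fin.castSucc_succ, Fin.cons_succ, Fin.cons_succ]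
      exact (hφ i).isIntegral (hF.isIntegral i)
  · intro i
    cases i using Fin.cases with
    | zero =>
      rw [Fin.castSucc_zero, Fin.cons_zero, Fin.cons_succ, hG0]
      exact hφ0.semistable hss
    | succ i =>
      rw [Fin.castSucc_succ, Fin.cons_succ, Fin.cons_succ]
      have := Fact.mk (hF.isIntegral i)
      exact (hφ i).semistable (hF.semistable i)
  · intro i j hij
    simp only
    cases j using Fin.cases with
    | zero => exact absurd hij (Fin.not_lt_zero i)
    | succ j =>
      rw [Fin.castSucc_succ, Fin.cons_succ, Fin.cons_succ, (hφ j).slope_eq]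
      cases i using Fin.cases with
      | zero =>
        rw [Fin.castSucc_zero, Fin.cons_zero, Fin.cons_succ, hG0, hφ0.slope_eq]
        obtain ⟨E, hE, hle⟩ := hF.exists_slope_le j
        exact hle.trans_lt (hslope E hE)
      | succ i =>
        rw [Fin.castSucc_succ, Fin.cons_succ, Fin.cons_succ, (hφ i).slope_eq]
        exact hF.strictAnti (Fin.succ_lt_succ_iff.1 hij)

theorem finrank_comap_satQuotHom (D : Submodule ℤ_[p] X.T)
    (E : Submodule ℤ_[p] (X.satQuot D).T) :
    Module.finrank ℤ_[p] E + Module.finrank ℤ_[p] D =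
      Module.finrank ℤ_[p] (E.comap (X.satQuotHom D).f) := by
  have hle : D ≤ E.comap (X.satQuotHom D).f := fun t ht => by
    rw [Submodule.mem_comap, X.satQuotHom_f_eq_zero.2 ht]
    exact Submodule.zero_mem _
  have h1 := finrank_range_add_finrank_ker
    ((X.satQuotHom D).f.domRestrict (E.comap (X.satQuotHom D).f))
  have h2 : LinearMap.ker ((X.satQuotHom D).f.domRestrict (E.comap (X.satQuotHom D).f)) =
      D.submoduleOf (E.comap (X.satQuotHom D).f) := by
    ext t
    exact X.satQuotHom_f_eq_zero
  rwa [LinearMap.range_domRestrict,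
    Submodule.map_comap_eq_of_surjective (X.satQuotHom_f_surjective D), h2,
    (Submodule.submoduleOfEquivOfLe hle).finrank_eq] at h1

theorem finrank_spanImage_comap_le {D : Submodule ℤ_[p] X.T} (hD : IsSaturated p D)
    (E : Submodule ℤ_[p] (X.satQuot D).T) :
    Module.finrank (OC C) (X.spanImage (E.comap (X.satQuotHom D).f)) ≤
      ((X.satQuot D).sub E).rkω + (X.sub D).rkω := by
  have := finite_spanImage (E.comap (X.satQuotHom D).f)
  have h3 := Module.Finite.iff_fg.2 (satImage_fg hD)
  have h1 := finrank_range_add_finrank_ker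
    ((X.satQuotHom D).g.domRestrict (X.spanImage (E.comap (X.satQuotHom D).f)))
  rw [LinearMap.range_domRestrict, Hom.map_spanImage,
    Submodule.map_comap_eq_of_surjective (X.satQuotHom_f_surjective D)] at h1
  rw [← h1, ← finrank_satImage hD]
  refine Nat.add_le_add_left ?_ _
  let f := (X.spanImage (E.comap (X.satQuotHom D).f)).subtype.restrict
    (p := LinearMap.ker ((X.satQuotHom D).g.domRestrict
      (X.spanImage (E.comap (X.satQuotHom D).f)))) (q := X.satImage D)
    fun x hx => X.satQuotHom_g_eq_zero.1 hx
  refine LinearMap.finrank_le_finrank_of_injective (f := f) fun x y hxy => ?_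
  exact Subtype.ext (Subtype.ext (congrArg (Subtype.val : X.satImage D → X.ω) hxy))

theorem finrank_spanImage_saturation_le (E : Submodule ℤ_[p] X.T) :
    (X.sub (saturation (p : ℤ_[p]) E)).rkω ≤ Module.finrank (OC C) (X.spanImage E) := by
  obtain ⟨k, hk⟩ := exists_pow_smul_mem_of_fg
    (IsNoetherian.noetherian (saturation (p : ℤ_[p]) E))
  have := finite_spanImage E
  refine finrank_le_of_pow_smul_mem (N := X.spanImage (saturation (p : ℤ_[p]) E))
    (prime_cast_ne_zero (p := p) (C := C)) k fun x hx => ?_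
  refine X.spanImage_mono (A := ppow p k (saturation (p : ℤ_[p]) E)) ?_ ?_
  · rintro _ ⟨t, ht, rfl⟩
    exact hk t ht
  · rw [spanImage_ppow]
    exact Submodule.mem_map_of_mem hx

/-- Since D has slope μ, the saturated preimage of an E of slope ≥ μ also has slope ≥ μ. It is then
contained in every `Y k`, hence in D, so E = 0. -/
theorem IsFirstSteps.slope_satQuot_sub_lt {μ : ℝ} {Y : ℕ → Submodule ℤ_[p] X.T}
    (h : IsFirstSteps μ Y) {D : Submodule ℤ_[p] X.T} (hDY : D = ⨅ k, Y k)
    {E : Submodule ℤ_[p] (X.satQuot D).T} (hE : E ≠ ⊥) : ((X.satQuot D).sub E).slope < μ := by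
  have hD := h.isSaturated
  have hrk := h.rkω_eq
  rw [← hDY] at hD hrk
  have hQ := Fact.mk (X.satQuot_isIntegral hD)
  have hnt : Nontrivial ((X.satQuot D).sub E).T := Submodule.nontrivial_iff_ne_bot.2 hE
  have hpos : (0 : ℝ) < ((X.satQuot D).sub E).rkT := by exact_mod_cast Module.finrank_pos
  by_contra! hle
  rw [slope, le_div_iff₀ hpos] at hle
  let E0 := E.comap (X.satQuotHom D).f
  have h1 : ((X.satQuot D).sub E).rkT + (X.sub D).rkT ≤
      (X.sub (saturation (p : ℤ_[p]) E0)).rkT :=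
    (finrank_comap_satQuotHom D E).trans_le (Submodule.finrank_mono (le_saturation _ E0))
  have h2 : (X.sub (saturation (p : ℤ_[p]) E0)).rkω ≤
      ((X.satQuot D).sub E).rkω + (X.sub D).rkω :=
    (finrank_spanImage_saturation_le E0).trans (finrank_spanImage_comap_le hD E)
  have h1' : (((X.satQuot D).sub E).rkT + (X.sub D).rkT : ℝ) ≤
      (X.sub (saturation (p : ℤ_[p]) E0)).rkT := by exact_mod_cast h1
  have h2' : ((X.sub (saturation (p : ℤ_[p]) E0)).rkω : ℝ) ≤
      ((X.satQuot D).sub E).rkω + (X.sub D).rkω := by exact_mod_cast h2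
  have h3 := mul_le_mul_of_nonneg_left h1' (sub_nonneg.2 h.isMaxSlope.le_one)
  have h4 := IsFirstSteps.le_iInf_of_rkω_le (isSaturated_saturation E0) h (by linarith)
  refine hE ((Submodule.eq_bot_iff _).2 fun s hs => ?_)
  obtain ⟨t, rfl⟩ := X.satQuotHom_f_surjective D s
  rw [X.satQuotHom_f_eq_zero, hDY]
  exact h4 (le_saturation _ E0 hs)

omit hX in
theorem isHNChain_and_descentTerminates (n : ℕ) : ∀ (X : Triple.{u, v, w} p C), X.IsIntegral →
    X.rkT = n → (∃ B, IsFull p B ∧ ∃ (r : ℕ) (F : Fin (r + 1) → Submodule ℤ_[p] X.T),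
      X.IsHNChain F B) ∧ X.DescentTerminates := by
  induction n using Nat.strong_induction_on with
  | _ n ih =>
    -- For fixed rank, the inner induction bounds the number of elements of S that are at most μ; it
    -- drops when D = 0, because μ lies in S and the new maximal slope is smaller.
    suffices H : ∀ (N : ℕ) (S : Finset ℝ) (X : Triple.{u, v, w} p C) (hX : Fact X.IsIntegral),
        X.rkT = n → X.SlopesIn S → (∀ μ, X.IsMaxSlope μ → (S.filter (· ≤ μ)).card < N) →
        (∃ B, IsFull p B ∧ ∃ (r : ℕ) (F : Fin (r + 1) → Submodule ℤ_[p] X.T),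
          X.IsHNChain F B) ∧ X.DescentTerminates by
      intro X hX hn
      have := Fact.mk hX
      obtain ⟨S, hS⟩ := X.exists_slopesIn
      exact H (S.card + 1) S X ⟨hX⟩ hn hS fun μ _ =>
        Nat.lt_succ_of_le (Finset.card_filter_le _ _)
    intro N
    induction N with
    | zero =>
      intro S X hX hn hS hN
      rcases subsingleton_or_nontrivial X.T with h0 | h0
      · refine ⟨⟨⊤, isFull_top, 0, fun _ => ⊤, Subsingleton.elim _ _, rfl, ?_, fun i => i.elim0,
          fun i => i.elim0, fun i => i.elim0⟩, descentTerminates_of_subsingleton h0⟩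
        exact fun i j hij => absurd hij (by
          rw [Subsingleton.elim (α := Fin 1) i j]
          exact lt_irrefl _)
      · obtain ⟨μ, hμ⟩ := exists_isMaxSlope (X := X)
        exact absurd (hN μ hμ) (Nat.not_lt_zero _)
    | succ N ihN =>
      intro S X hX hn hS hN
      rcases subsingleton_or_nontrivial X.T with h0 | h0
      -- The zero module has no maximal slope, so the bound holds vacuously.
      · exact ihN S X hX hn hS fun μ hμ => by
          obtain ⟨A, hA, -⟩ := hμ.exists_eq
          exact absurd (Subsingleton.elim _ _) hA.ne
      obtain ⟨μ, hμ⟩ := exists_isMaxSlope (X := X)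
      obtain ⟨Y, hY⟩ := hμ.exists_isFirstSteps
      obtain ⟨m, hm⟩ := hY.exists_le
      by_cases hD : ⨅ k, Y k = ⊥
      · have hfull := hY.isFull m
        obtain ⟨⟨B, hB, r, F, hF⟩, hterm⟩ := ihN S (X.sub (Y m)) inferInstance
          ((rkT_sub hfull).trans hn) (hS.sub hfull) fun ν hν => by
            have hlt := hY.maxSlope_sub_lt hm hD hν
            refine lt_of_lt_of_le (Finset.card_lt_card ?_) (Nat.le_of_lt_succ (hN μ hμ))
            refine (Finset.ssubset_iff_of_subset ?_).2 ⟨μ, ?_, ?_⟩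
            · exact Finset.monotone_filter_right _ fun x _ hx => le_trans hx hlt.le
            · exact Finset.mem_filter.2 ⟨hμ.mem hS, le_rfl⟩
            · exact fun h => hlt.not_ge (Finset.mem_filter.1 h).2
        refine ⟨⟨B.map (X.subHom (Y m)).f, hfull.map_subtype hB, r, _,
          hF.map (X.subHom (Y m)) Subtype.val_injective Subtype.val_injective⟩, ?_⟩
        exact hterm.of_step h0 (hY.isDescentStep_sub hm hD)
      · obtain ⟨D, hDY⟩ : ∃ D, D = ⨅ k, Y k := ⟨_, rfl⟩
        have hQ := Fact.mk (X.satQuot_isIntegral hY.isSaturated)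
        have hstep := hY.isDescentStep_satQuot hm
        have hsat := hY.isSaturated
        rw [← hDY] at hQ hstep hsat hD
        obtain ⟨hsl, hss⟩ := hY.semistable hDY hD
        have hrk : (X.satQuot D).rkT < n := by
          have h1 : (X.satQuot D).rkT + Module.finrank ℤ_[p] D = X.rkT :=
            D.finrank_quotient_add_finrank
          have h2 : Nontrivial D := Submodule.nontrivial_iff_ne_bot.2 hD
          have h3 : 0 < Module.finrank ℤ_[p] D := Module.finrank_pos
          omega
        -- The chain comes from the whole quotient X/D; termination comes from its sublattice, the
        -- image of `Y m`, which is the actual next term of the descent.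
        obtain ⟨⟨B, hB, r, F, hF⟩, -⟩ := ih _ hrk (X.satQuot D) hQ.out rfl
        refine ⟨exists_isHNChain_of_satQuot hsat hD hss (fun E hE => ?_) hB hF, ?_⟩
        · rw [hsl]
          exact hY.slope_satQuot_sub_lt hDY hE
        · refine DescentTerminates.of_step h0 hstep (ih _ ?_ _ hstep.1 rfl).2
          exact (Submodule.finrank_le _).trans_lt hrk

end Triple

end HodgeTate

end

theorem mainTheorem5 (p : ℕ) [Fact p.Prime] (C : Type*) [NormedField C] [IsUltrametricDist C]
    [NormedAlgebra ℚ_[p] C] [CompleteSpace C] [IsAlgClosed C]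
    (X : HodgeTate.Triple p C) (hX : X.IsIntegral) :
    (∃ Y : HodgeTate.Triple p C, Y.IsIntegral ∧ X.Isogenous Y ∧ Y.IsHNType) ∧
      X.DescentTerminates := by
  have := Fact.mk hX
  obtain ⟨⟨B, hB, r, F, hF⟩, h⟩ :=
    HodgeTate.Triple.isHNChain_and_descentTerminates X.rkT X hX rfl
  exact ⟨⟨X.sub B, (HodgeTate.Triple.sub_isIntegral B).out, HodgeTate.Triple.isogenous_sub hB,
    hF.isHNType_sub⟩, h⟩
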